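/- **Setting.** Let $d,n\ge 1$, $\beta_*\in\mathbb R^d$, $\sigma\ge 0$, and $Y_i=X_i^{\top}\beta_*+\sigma\epsilon_i$, $1\le i\le n$, where the $\epsilon_i$ are i.i.d. with mean zero and unit variance. In the random design case the $X_i$ are i.i.d. random vectors in $\mathbb R^d$, independent of the $\epsilon_i$, and $\Sigma=\mathbb E[X_1X_1^{\top}]$; in the fixed design case the $X_i$ are fixed vectors and $\Sigma=\frac1n\sum_{i=1}^n X_iX_i^{\top}$. In both cases $\lambda_{\min}(\Sigma)>0$. For a range $[\ell,u]$ with $\Delta=u-\ell$, the 1-bit dithered quantization of $z$ is $q(z+\xi)$, where $\xi\sim\mathrm{Unif}(-\Delta/2,\Delta/2)$ and $q(t)$ is the point of $\{\ell,u\}$ nearest to $t$. All dithers are independent of each other and of the data. Let $\widetilde X_{ij}$, $\widetilde{X_{ij}^2}$ and $\widetilde Y_i$ be the quantizations of $X_{ij}$, $X_{ij}^2$ and $Y_i$ with ranges $[-R,R]$, $[0,R^2]$ and $[-L,L]$, and let $$\widehat\Sigma=\frac1n\sum_{i=1}^n\Big\{\widetilde X_i\widetilde X_i^{\top}+\mathrm{diag}\big(\widetilde{X_{ij}^2}-(\widetilde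 X_{ij})^2\big)_{j=1}^d\Big\},\quad \widehat\Sigma_{Xy}=\frac1n\sum_{i=1}^n\widetilde X_i\widetilde Y_i,\quad \widehat\beta=\operatorname*{argmin}_{\beta\in\mathbb R^d}\Big\{\tfrac12\beta^{\top}\widehat\Sigma\beta-\beta^{\top}\widehat\Sigma_{Xy}\Big\}.$$ Write $\ell_{n,d}=\max\{\log n,\log(2d)\}$ and $$\mathsf{err}(d,n,R,L)=\frac{2}{\lambda_{\min}(\Sigma)}\left(\|\beta_*\|_2\sqrt{\frac{\{32dR^4+8dR^2\|\Sigma\|_{\rm op}\}\,\ell_{n,d}}{n}}+\|\beta_*\|_2\frac{8(2d+1)R^2\,\ell_{n,d}}{n}+\sqrt{\frac{4dR^2L^2\,\ell_{n,d}}{n}}\right),$$ $$N(R)=\max\left\{\frac{512dR^4+128dR^2\|\Sigma\|_{\rm op}}{\lambda_{\min}(\Sigma)^2},\;32(2d+1)R^2\right\}\ell_{n,d}.$$ **(I)** (Random or fixed design, fixed ranges.) If $|X_{ij}|\le R$ and $|Y_i|\le L$ almost surely for all $i,j$, and $n\ge N(R)$, then with probability at least $1-2/n$ the minimizer $\widehat\beta$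 exists, is unique, and satisfies $\|\widehat\beta-\beta_*\|_2\le\mathsf{err}(d,n,R,L)$. **(II)** (Random design, sub-Gaussian case.) For a random variable $Z$ let $\|Z\|_{\psi_2}=\inf\{t>0:\mathbb E\exp(Z^2/t^2)\le 2\}$, and for a random vector let $\|Z\|_{\psi_2}=\sup_{\|v\|_2=1}\|\langle Z,v\rangle\|_{\psi_2}$. Suppose that $X_1$ has mean zero, coordinates of unit variance, and finite $\|X_1\|_{\psi_2}$, and that $\|\epsilon_1\|_{\psi_2}<\infty$. Let $K=\max_j\|X_{1j}\|_{\psi_2}$, $\overline K=\|\Sigma^{-1/2}X_1\|_{\psi_2}$, $K_\epsilon=\|\epsilon_1\|_{\psi_2}$, and $C_\kappa=c_0\kappa^2$ with a fixed absolute constant $c_0\ge 1/2$ (so that $\mathbb P(|Z|\ge t)\le 2e^{-t^2/(2C_\kappa)}$ whenever $\|Z\|_{\psi_2}=\kappa>0$). Set $$R_n=\sqrt{8C_K\log(nd)},\qquad L_n=\Big(\sqrt{8C_{\overline K}}\,\|\Sigma^{1/2}\beta_*\|_2+\sigma\sqrt{8C_{K_\epsilon}}\Big)\sqrt{\log n}.$$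 There are constants $C,C'>0$, depending only on $K,\overline K,K_\epsilon$ (and $c_0$), such that, if $n\ge N(R_n)$ and $$n\ge C\left\{\lambda_{\min}(\Sigma)^{-1}\,d\,\max\{\|\Sigma^{1/2}\beta_*\|_2+\sigma,\,1\}\right\}^{2/3},$$ then, for the quantizers with ranges given by $R=R_n$ and $L=L_n$, with probability at least $1-6/n-2/(nd)$ the minimizer $\widehat\beta$ exists, is unique, and satisfies $$\|\widehat\beta-\beta_*\|_2\le 2\,\mathsf{err}(d,n,R_n,L_n)+C'\,\frac{d}{n^{3/2}}.$$ -/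

import Mathlib

open MeasureTheory ProbabilityTheory
open scoped ENNReal NNReal

universe uΩ

noncomputable section

namespace OneBitRegression

/-- Real `d`-dimensional space with the Euclidean norm. -/
abbrev Vec (d : ℕ) : Type := EuclideanSpace ℝ (Fin d)

/-! ### Matrices -/

/-- The operator (spectral) norm of a square matrix. -/
def opNorm {d : ℕ} (A : Matrix (Fin d) (Fin d) ℝ) : ℝ :=
  ‖Matrix.toEuclideanCLM (𝕜 := ℝ) A‖

/-- The minimum eigenvalue of a (symmetric) matrix. -/
def lambdaMin {d : ℕ} (A : Matrix (Fin d) (Fin d) ℝ) : ℝ :=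
  sInf (spectrum ℝ A)

open scoped MatrixOrder in
/-- The positive semidefinite square root `A ^ (1/2)` of a positive semidefinite matrix. -/
def sqrtMat {d : ℕ} (A : Matrix (Fin d) (Fin d) ℝ) : Matrix (Fin d) (Fin d) ℝ :=
  CFC.sqrt A

/-- A matrix acting on a vector of Euclidean space. -/
def act {d : ℕ} (A : Matrix (Fin d) (Fin d) ℝ) (x : Vec d) : Vec d :=
  Matrix.toEuclideanCLM (𝕜 := ℝ) A x

/-- `Σ = E[X Xᵀ]` for a random vector `X` with law `P`. -/
def secondMoment {d : ℕ} (P : Measure (Vec d)) : Matrix (Fin d) (Fin d) ℝ :=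
  Matrix.of fun j k => ∫ x, x j * x k ∂P

/-- `Σ = (1/n) ∑ i, x i (x i)ᵀ` for fixed design points `x i`. -/
def empiricalSecondMoment {n d : ℕ} (x : Fin n → Vec d) : Matrix (Fin d) (Fin d) ℝ :=
  Matrix.of fun j k => (1 / (n : ℝ)) * ∑ i, x i j * x i k

/-! ### Sub-Gaussian norms -/

/-- `‖Z‖_ψ₂ = inf {t > 0 : E[exp(|Z|² / t²)] ≤ 2}`, equal to `∞` if there is no such `t`. -/
def psi2Norm {Ω : Type*} [MeasurableSpace Ω] (μ : Measure Ω) (Z : Ω → ℝ) : ℝ≥0∞ :=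
  ⨅ t : {t : ℝ // 0 < t ∧ ∫⁻ ω, ENNReal.ofReal (Real.exp (|Z ω| ^ 2 / t ^ 2)) ∂μ ≤ 2},
    ENNReal.ofReal t

/-- `‖Z‖_ψ₂ = sup {‖⟨Z, v⟩‖_ψ₂ : ‖v‖₂ = 1}` for a random vector `Z`. -/
def psi2NormVec {Ω : Type*} [MeasurableSpace Ω] {d : ℕ} (μ : Measure Ω) (Z : Ω → Vec d) :
    ℝ≥0∞ :=
  ⨆ v : {v : Vec d // ‖v‖ = 1}, psi2Norm μ fun ω => inner ℝ (Z ω) (v : Vec d)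

/-- Zero mean and unit variance (a law on `ℝ`). -/
def IsStandardized (ν : Measure ℝ) : Prop :=
  ∫ e, e ∂ν = 0 ∧ ∫ e, e ^ 2 ∂ν = 1

/-- Condition on the predictors in the unbounded case, for the law `P` of a single `X i`:
zero mean, unit variance of every coordinate, sub-Gaussian. -/
structure SubGaussianDesign {d : ℕ} (P : Measure (Vec d)) : Prop where
  zero_mean : ∀ j, ∫ x, x j ∂P = 0
  unit_variance : ∀ j, ∫ x, x j ^ 2 ∂P = 1
  subGaussian : psi2NormVec P (fun x => x) < ∞

/-- Condition on the errors in the unbounded case, for the law `ν` of a single error: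
zero mean, unit variance, sub-Gaussian. -/
structure SubGaussianNoise (ν : Measure ℝ) : Prop where
  standardized : IsStandardized ν
  subGaussian : psi2Norm ν (fun e => e) < ∞

/-! ### One-bit dithered quantization -/

/-- The point of `{ℓ, u}` that is nearest to `t`. -/
def nearest (ℓ u t : ℝ) : ℝ := if |t - u| ≤ |t - ℓ| then u else ℓ

/-- Dithered one-bit quantization `q(z + ξ)` of `z` with range `[ℓ, u]`. With `Δ = u - ℓ`, the
dither is `ξ = Δ w`, which is uniform on `(-Δ/2, Δ/2)` if `w` is uniform on `(-1/2, 1/2)`. -/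
def quantize (ℓ u z w : ℝ) : ℝ := nearest ℓ u (z + (u - ℓ) * w)

/-- The `2 d + 1` scalars quantized per sample: `inl j` is the coordinate `X j`, `inr (inl j)` is
its square, and `inr (inr ())` is `Y`. -/
abbrev Channel (d : ℕ) : Type := Fin d ⊕ Fin d ⊕ Unit

/-- Quantized predictor: every coordinate with range `[-R, R]`. -/
def quantX {d : ℕ} (R : ℝ) (x : Vec d) (w : Channel d → ℝ) : Fin d → ℝ :=
  fun j => quantize (-R) R (x j) (w (Sum.inl j))

/-- Quantized squares of the predictor: every coordinate with range `[0, R²]`. -/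
def quantSq {d : ℕ} (R : ℝ) (x : Vec d) (w : Channel d → ℝ) : Fin d → ℝ :=
  fun j => quantize 0 (R ^ 2) (x j ^ 2) (w (Sum.inr (Sum.inl j)))

/-- Quantized response, with range `[-L, L]`. -/
def quantY {d : ℕ} (L : ℝ) (y : ℝ) (w : Channel d → ℝ) : ℝ :=
  quantize (-L) L y (w (Sum.inr (Sum.inr ())))

/-! ### The estimator -/

/-- The plug-in estimator of `Σ`. -/
def sigmaHat {n d : ℕ} (R : ℝ) (x : Fin n → Vec d) (w : Fin n → Channel d → ℝ) :
    Matrix (Fin d) (Fin d) ℝ :=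
  (1 / (n : ℝ)) • ∑ i, (Matrix.vecMulVec (quantX R (x i) (w i)) (quantX R (x i) (w i)) +
    Matrix.diagonal fun j => quantSq R (x i) (w i) j - quantX R (x i) (w i) j ^ 2)

/-- The plug-in estimator of `Σ_Xy`. -/
def crossHat {n d : ℕ} (R L : ℝ) (x : Fin n → Vec d) (y : Fin n → ℝ)
    (w : Fin n → Channel d → ℝ) : Fin d → ℝ :=
  (1 / (n : ℝ)) • ∑ i, quantY L (y i) (w i) • quantX R (x i) (w i)

/-- The quadratic objective that the estimator minimizes. -/
def objective {n d : ℕ} (R L : ℝ) (x : Fin n → Vec d) (y : Fin n → ℝ)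
    (w : Fin n → Channel d → ℝ) (b : Vec d) : ℝ :=
  (1 / 2) * (b.ofLp ⬝ᵥ (sigmaHat R x w).mulVec b.ofLp) - b.ofLp ⬝ᵥ crossHat R L x y w

/-- `b` is the unique minimizer of `f`. -/
def IsUniqueMinimizer {d : ℕ} (f : Vec d → ℝ) (b : Vec d) : Prop :=
  ∀ b', b' ≠ b → f b < f b'

/-- The response `Y = Xᵀ β + σ ε`. -/
def response {d : ℕ} (β : Vec d) (σ : ℝ) (x : Vec d) (e : ℝ) : ℝ := inner ℝ x β + σ * e

/-- The event that the estimator `β̂` computed from the quantized data exists, is unique, and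
satisfies `‖β̂ - β‖₂ ≤ r`. -/
def errorEvent {Ω : Type*} {n d : ℕ} (R L : ℝ) (β : Vec d) (σ : ℝ) (X : Fin n → Ω → Vec d)
    (ε : Fin n → Ω → ℝ) (U : Fin n → Channel d → Ω → ℝ) (r : ℝ) : Set Ω :=
  {ω | ∃ b : Vec d,
    IsUniqueMinimizer (objective R L (fun i => X i ω)
      (fun i => response β σ (X i ω) (ε i ω)) (fun i c => U i c ω)) b ∧ ‖b - β‖ ≤ r}

/-! ### The sampling models -/

/-- The normalized dithers: independent, uniform on `(-1/2, 1/2)`. -/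
structure IsDither {Ω : Type*} [MeasurableSpace Ω] {n d : ℕ} (μ : Measure Ω)
    (U : Fin n → Channel d → Ω → ℝ) : Prop where
  measurable : ∀ i c, Measurable (U i c)
  uniform : ∀ i c, μ.map (U i c) = volume.restrict (Set.Ioo (-(1 / 2)) (1 / 2))
  indep : iIndepFun (fun (p : Fin n × Channel d) => U p.1 p.2) μ

/-- Independent, identically distributed random elements with law `P`. -/
structure IsIID {Ω E : Type*} [MeasurableSpace Ω] [MeasurableSpace E] {n : ℕ} (μ : Measure Ω)
    (Z : Fin n → Ω → E) (P : Measure E) : Prop where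
  measurable : ∀ i, Measurable (Z i)
  law : ∀ i, μ.map (Z i) = P
  indep : iIndepFun Z μ

/-- Random design: i.i.d. predictors with law `P`, i.i.d. errors with law `ν`, and dithers; these
three families are independent. -/
structure RandomDesign {Ω : Type*} [MeasurableSpace Ω] {n d : ℕ} (μ : Measure Ω)
    (P : Measure (Vec d)) (ν : Measure ℝ) (X : Fin n → Ω → Vec d) (ε : Fin n → Ω → ℝ)
    (U : Fin n → Channel d → Ω → ℝ) : Prop where
  predictors : IsIID μ X P
  errors : IsIID μ ε ν
  dither : IsDither μ U
  indep_errors : IndepFun (fun ω i => X i ω) (fun ω i => ε i ω) μ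
  indep_dither : IndepFun (fun ω => ((fun i => X i ω), (fun i => ε i ω)))
    (fun ω i c => U i c ω) μ

/-- Fixed design: i.i.d. errors with law `ν`, and dithers; the two families are independent. -/
structure FixedDesign {Ω : Type*} [MeasurableSpace Ω] {n d : ℕ} (μ : Measure Ω)
    (ν : Measure ℝ) (ε : Fin n → Ω → ℝ) (U : Fin n → Channel d → Ω → ℝ) : Prop where
  errors : IsIID μ ε ν
  dither : IsDither μ U
  indep_dither : IndepFun (fun ω i => ε i ω) (fun ω i c => U i c ω) μ

/-! ### The quantities in the bound -/

/-- `log n ∨ log (2 d)`. -/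
def logFactor (d n : ℕ) : ℝ := max (Real.log n) (Real.log (2 * d))

/-- The lower bound on the sample size; `S` is the matrix `Σ`. -/
def sampleBound {d : ℕ} (S : Matrix (Fin d) (Fin d) ℝ) (n : ℕ) (R : ℝ) : ℝ :=
  max ((512 * d * R ^ 4 + 128 * d * R ^ 2 * opNorm S) / lambdaMin S ^ 2)
    (32 * (2 * d + 1) * R ^ 2) * logFactor d n

/-- The error bound `err(d, n, R, L)`; `S` is the matrix `Σ`. -/
def err {d : ℕ} (S : Matrix (Fin d) (Fin d) ℝ) (β : Vec d) (n : ℕ) (R L : ℝ) : ℝ :=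
  2 / lambdaMin S *
    (‖β‖ * √((32 * d * R ^ 4 + 8 * d * R ^ 2 * opNorm S) * logFactor d n / n) +
      ‖β‖ * (8 * (2 * d + 1) * R ^ 2 * logFactor d n / n) +
      √(4 * d * R ^ 2 * L ^ 2 * logFactor d n / n))

/-- `C_K = c K²`, the constant in the tail bound `P(|Z| ≥ t) ≤ 2 exp(-t² / (2 C_K))`. -/
def tailConst (c K : ℝ) : ℝ := c * K ^ 2

/-- The truncation level `R_n` for the predictors. -/
def truncX (c K q : ℝ) (d n : ℕ) : ℝ :=
  √(2 * tailConst c K * (q + 1) * Real.log (n * d))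

/-- The truncation level `L_n` for the responses; `S` is the matrix `Σ`. -/
def truncY {d : ℕ} (c Kbar Keps q : ℝ) (S : Matrix (Fin d) (Fin d) ℝ) (β : Vec d) (σ : ℝ)
    (n : ℕ) : ℝ :=
  (√(2 * (q + 1) * tailConst c Kbar) * ‖act (sqrtMat S) β‖ +
    σ * √(2 * (q + 1) * tailConst c Keps)) * √(Real.log n)

end OneBitRegression

end

namespace OneBitRegression

/-! ### A trace inequality for symmetric operators -/

/-! A dithered one-bit quantizer is unbiased on its range (`integral_quantize`). Distinct
coordinates carry independent dithers and the diagonal is read off from the separately quantized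
squares, so for data inside the ranges the plug-in matrix has mean exactly `Σ`
(`integral_bitMatrix`). The plug-in cross moment has mean `Σ β`, because the noise is centred and
independent of the design. On the event that the least eigenvalue of the plug-in matrix is at least
`λ_min / 2`, the objective is strictly convex and its minimizer misses `β` by at most `2 / λ_min`
times the residual of the normal equations at `β` (`exists_minimizer_of_quadratic`). The residual
splits into the error of the cross moment, handled by Hoeffding in each coordinate
(`crossHat_tail`), and the error of the matrix estimator applied to `β`.

The matrix estimator needs a Bernstein inequality for independent symmetric matrices, obtained here
by exchangeable pairs, with no appeal to Golden-Thompson or Lieb. Quantized samples take finitely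
many values, so expectations are finite weighted sums. Let `m(θ)` be the mean of `tr exp(θ X)` for
the centred sum `X`. Exchanging one sample with an independent copy symmetrizes `m'(θ)` into traces
of `(X - X')(exp(θ X) - exp(θ X'))`, and a scalar convexity inequality, applied in the two
eigenbases, bounds these by traces involving `(X - X')²` (`expTrace_mean_value`). Each summand
satisfies `W² ≤ c W + κ` with `c = d R²`, `κ = (d + 1) R⁴` (`selfBounded_bitMatrix`), so the squares
become linear in `W` again and feed back into `m'`. The result is, for `θ > 0`, `m'(θ) (1 - c θ) ≤ v
θ m(θ)`, with `v = n (2 c s + 2 κ)` and `s` a bound on the averaged mean; Grönwall and Markov finish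
(`laplace_bound`, `tail_le_laplace`). For negative `θ` the feedback has a favourable sign, so the
lower tail is purely sub-Gaussian.

In the sub-Gaussian case predictors and responses are set to zero outside their ranges. The
truncated sample is bounded and agrees with the true one with high probability
(`measureReal_not_box_le`, `measureReal_response_gt_le`). Truncation costs at most a twelfth of the
quadratic form of `Σ` (`inner_truncated_secondMoment_ge`) and a bias of order `1 / n` in the normal
equations (`norm_truncation_bias_le`); the factor 2 in front of the error bound absorbs both losses.
-/

lemma exp_sub_one_le_trapezoid {h : ℝ} (hh : 0 ≤ h) :
    Real.exp h - 1 ≤ h / 2 * (Real.exp h + 1) := by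
  -- The trapezoid rule overestimates the integral of a convex function. The gap has derivative `(1
  -- - (1 - x) e^x) / 2`, nonnegative because `1 - x ≤ e^(-x)`.
  have key : MonotoneOn (fun x : ℝ => x / 2 * (Real.exp x + 1) - Real.exp x) (Set.Ici 0) := by
    have hd : ∀ x : ℝ, HasDerivAt (fun x : ℝ => x / 2 * (Real.exp x + 1) - Real.exp x)
        (1 / 2 * (Real.exp x + 1) + x / 2 * Real.exp x - Real.exp x) x := fun x =>
      (((hasDerivAt_id x).div_const 2).mul ((Real.hasDerivAt_exp x).add_const 1)).sub
        (Real.hasDerivAt_exp x)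
    refine monotoneOn_of_deriv_nonneg (convex_Ici 0)
      (fun x _ => (hd x).continuousAt.continuousWithinAt)
      (fun x _ => (hd x).differentiableAt.differentiableWithinAt) fun x _ => ?_
    rw [(hd x).deriv]
    have h1 : 1 - x ≤ Real.exp (-x) := by linarith [Real.add_one_le_exp (-x)]
    have h2 : (1 - x) * Real.exp x ≤ 1 := by
      calc (1 - x) * Real.exp x ≤ Real.exp (-x) * Real.exp x := by gcongr
        _ = 1 := by rw [← Real.exp_add]; simp
    nlinarith
  have := key (Set.mem_Ici.2 le_rfl) (Set.mem_Ici.2 hh) hh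
  simp only [Real.exp_zero] at this
  linarith

lemma sub_mul_exp_sub_le (x y : ℝ) :
    (x - y) * (Real.exp x - Real.exp y) ≤ (x - y) ^ 2 / 2 * (Real.exp x + Real.exp y) := by
  wlog h : y ≤ x generalizing x y
  · have := this y x (le_of_not_ge h)
    linarith
  have h1 := exp_sub_one_le_trapezoid (sub_nonneg.2 h)
  have h2 : Real.exp x = Real.exp y * Real.exp (x - y) := by
    rw [← Real.exp_add]; congr 1; ring
  have h3 := mul_le_mul_of_nonneg_left h1
    (mul_nonneg (sub_nonneg.2 h) (Real.exp_pos y).le)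
  rw [h2]
  nlinarith

section Trace

variable {E : Type*} [NormedAddCommGroup E] [InnerProductSpace ℝ E] [FiniteDimensional ℝ E]

/-- `tr (B exp(θ A))` for a symmetric operator `A`. -/
noncomputable def expTrace {A : E →ₗ[ℝ] E} (hA : A.IsSymmetric) (θ : ℝ) (B : E →ₗ[ℝ] E) : ℝ :=
  ∑ i, Real.exp (θ * hA.eigenvalues rfl i) *
    inner ℝ (hA.eigenvectorBasis rfl i) (B (hA.eigenvectorBasis rfl i))

lemma expTrace_add {A : E →ₗ[ℝ] E} (hA : A.IsSymmetric) (θ : ℝ) (B C : E →ₗ[ℝ] E) :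
    expTrace hA θ (B + C) = expTrace hA θ B + expTrace hA θ C := by
  simp only [expTrace, LinearMap.add_apply, inner_add_right, mul_add, Finset.sum_add_distrib]

lemma expTrace_smul {A : E →ₗ[ℝ] E} (hA : A.IsSymmetric) (θ r : ℝ) (B : E →ₗ[ℝ] E) :
    expTrace hA θ (r • B) = r * expTrace hA θ B := by
  simp only [expTrace, LinearMap.smul_apply, inner_smul_right, Finset.mul_sum]
  exact Finset.sum_congr rfl fun i _ => by ring

/-- `B ↦ tr (B exp(θ A))` as a linear map. -/
noncomputable def expTraceLin {A : E →ₗ[ℝ] E} (hA : A.IsSymmetric) (θ : ℝ) :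
    (E →ₗ[ℝ] E) →ₗ[ℝ] ℝ where
  toFun := expTrace hA θ
  map_add' := expTrace_add hA θ
  map_smul' r B := by simp [expTrace_smul]

lemma expTraceLin_apply {A : E →ₗ[ℝ] E} (hA : A.IsSymmetric) (θ : ℝ) (B : E →ₗ[ℝ] E) :
    expTraceLin hA θ B = ∑ i, Real.exp (θ * hA.eigenvalues rfl i) *
      inner ℝ (hA.eigenvectorBasis rfl i) (B (hA.eigenvectorBasis rfl i)) := rfl

lemma expTraceLin_one {A : E →ₗ[ℝ] E} (hA : A.IsSymmetric) (θ : ℝ) :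
    expTraceLin hA θ 1 = ∑ i, Real.exp (θ * hA.eigenvalues rfl i) := by
  rw [expTraceLin_apply]
  refine Finset.sum_congr rfl fun i _ => ?_
  simp

lemma expTraceLin_self {A : E →ₗ[ℝ] E} (hA : A.IsSymmetric) (θ : ℝ) :
    expTraceLin hA θ A =
      ∑ i, Real.exp (θ * hA.eigenvalues rfl i) * hA.eigenvalues rfl i := by
  rw [expTraceLin_apply]
  refine Finset.sum_congr rfl fun i _ => ?_
  rw [hA.apply_eigenvectorBasis]
  simp [inner_smul_right]

lemma expTraceLin_le_of_forall_norm_eq_one {A : E →ₗ[ℝ] E} (hA : A.IsSymmetric) (θ : ℝ)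
    {B C : E →ₗ[ℝ] E} (h : ∀ u : E, ‖u‖ = 1 → inner ℝ u (B u) ≤ inner ℝ u (C u)) :
    expTraceLin hA θ B ≤ expTraceLin hA θ C := by
  simp only [expTraceLin_apply]
  gcongr with i
  exact h _ (by simp)

/-- Mean value inequality for `tr ((A - B) (exp(θ A) - exp(θ B)))`. -/
lemma expTrace_mean_value {A B : E →ₗ[ℝ] E} (hA : A.IsSymmetric) (hB : B.IsSymmetric) (θ : ℝ) :
    θ * (expTraceLin hA θ (A - B) - expTraceLin hB θ (A - B)) ≤
      θ ^ 2 / 2 * (∑ i, Real.exp (θ * hA.eigenvalues rfl i) *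
          ‖(A - B) (hA.eigenvectorBasis rfl i)‖ ^ 2 +
        ∑ j, Real.exp (θ * hB.eigenvalues rfl j) *
          ‖(A - B) (hB.eigenvectorBasis rfl j)‖ ^ 2) := by
  set a := hA.eigenvalues rfl
  set b := hB.eigenvalues rfl
  set u := hA.eigenvectorBasis rfl with hu
  set v := hB.eigenvectorBasis rfl with hv
  have hau : ∀ i, A (u i) = a i • u i := fun i => hA.apply_eigenvectorBasis rfl i
  have hbv : ∀ j, B (v j) = b j • v j := fun j => hB.apply_eigenvectorBasis rfl j
  -- Between an eigenvector of `A` and one of `B`, the difference `A - B` acts as the scalar `a i -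
  -- b j`. No commutation is needed.
  have cross : ∀ i j, inner ℝ (v j) ((A - B) (u i)) = (a i - b j) * inner ℝ (v j) (u i) := by
    intro i j
    rw [LinearMap.sub_apply, inner_sub_right, hau, ← hB (v j) (u i), hbv]
    simp only [inner_smul_left, inner_smul_right, conj_trivial]
    ring
  have cross' : ∀ i j, inner ℝ (u i) ((A - B) (v j)) = (a i - b j) * inner ℝ (v j) (u i) := by
    intro i j
    rw [LinearMap.sub_apply, inner_sub_right, hbv, ← hA (u i) (v j), hau]
    simp only [inner_smul_left, inner_smul_right, conj_trivial, real_inner_comm (v j) (u i)]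
    ring
  -- With the overlaps `p i j` as nonnegative weights, every trace in the statement becomes a double
  -- sum over pairs of eigenvalues, and the scalar inequality applies term by term.
  set p : _ → _ → ℝ := fun i j => inner ℝ (v j) (u i) ^ 2 with hp
  have e1 : ∀ i, inner ℝ (u i) ((A - B) (u i)) = ∑ j, (a i - b j) * p i j := by
    intro i
    rw [← v.sum_inner_mul_inner (u i) ((A - B) (u i))]
    refine Finset.sum_congr rfl fun j _ => ?_
    rw [cross, real_inner_comm, hp]; ring
  have e2 : ∀ j, inner ℝ (v j) ((A - B) (v j)) = ∑ i, (a i - b j) * p i j := by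
    intro j
    rw [← u.sum_inner_mul_inner (v j) ((A - B) (v j))]
    refine Finset.sum_congr rfl fun i _ => ?_
    rw [cross', hp]; ring
  have e3 : ∀ i, ‖(A - B) (u i)‖ ^ 2 = ∑ j, (a i - b j) ^ 2 * p i j := by
    intro i
    rw [← v.sum_sq_inner_right]
    refine Finset.sum_congr rfl fun j _ => ?_
    rw [cross, hp]; ring
  have e4 : ∀ j, ‖(A - B) (v j)‖ ^ 2 = ∑ i, (a i - b j) ^ 2 * p i j := by
    intro j
    rw [← u.sum_sq_inner_right]
    refine Finset.sum_congr rfl fun i _ => ?_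
    rw [cross', hp]; ring
  simp only [expTraceLin_apply]
  simp only [← hu, ← hv, e1, e2, e3, e4, Finset.mul_sum]
  rw [Finset.sum_comm (f := fun j i => Real.exp (θ * b j) * ((a i - b j) * p i j)),
    Finset.sum_comm (f := fun j i => Real.exp (θ * b j) * ((a i - b j) ^ 2 * p i j))]
  simp only [← Finset.sum_sub_distrib, ← Finset.sum_add_distrib, Finset.mul_sum]
  refine Finset.sum_le_sum fun i _ => Finset.sum_le_sum fun j _ => ?_
  have h := mul_le_mul_of_nonneg_right (sub_mul_exp_sub_le (θ * a i) (θ * b j))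
    (sq_nonneg (inner ℝ (v j) (u i)) : (0 : ℝ) ≤ p i j)
  linarith

/-- An operator whose square is controlled by itself: `W² ≤ c W + κ`. -/
def SelfBounded (c κ : ℝ) (W : E →ₗ[ℝ] E) : Prop :=
  W.IsSymmetric ∧ ∀ u, ‖W u‖ ^ 2 ≤ c * inner ℝ u (W u) + κ * ‖u‖ ^ 2

/-- The mean value inequality produces `(W - W')²`. Since `‖(W - W') u‖² ≤ 2 (‖W u‖² + ‖W' u‖²)`,
self-boundedness trades it for an expression linear in `W + W'`, which can be averaged. -/
lemma expTrace_swap_le {A B W W' : E →ₗ[ℝ] E} (hA : A.IsSymmetric) (hB : B.IsSymmetric)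
    (hAB : A - B = W - W') {c κ : ℝ} (hW : SelfBounded c κ W) (hW' : SelfBounded c κ W') (θ : ℝ) :
    θ * (expTraceLin hA θ (W - W') - expTraceLin hB θ (W - W')) ≤
      θ ^ 2 * (c * expTraceLin hA θ (W + W') + 2 * κ * expTraceLin hA θ 1 +
        (c * expTraceLin hB θ (W + W') + 2 * κ * expTraceLin hB θ 1)) := by
  have hsq : ∀ u : E, ‖u‖ = 1 → ‖(A - B) u‖ ^ 2 ≤
      2 * inner ℝ u ((c • (W + W') + (2 * κ) • (1 : E →ₗ[ℝ] E)) u) := by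
    intro u hu
    have h1 := hW.2 u
    have h2 := hW'.2 u
    have h3 : ‖(W - W') u‖ ^ 2 ≤ 2 * (‖W u‖ ^ 2 + ‖W' u‖ ^ 2) := by
      have := norm_sub_le (W u) (W' u)
      rw [LinearMap.sub_apply]
      nlinarith [norm_nonneg (W u - W' u), sq_nonneg (‖W u‖ - ‖W' u‖)]
    rw [hAB]
    simp only [LinearMap.add_apply, LinearMap.smul_apply, inner_add_right, inner_smul_right,
      Module.End.one_apply, real_inner_self_eq_norm_sq]
    rw [hu] at *
    linarith
  have hsum : ∀ {T : E →ₗ[ℝ] E} (hT : T.IsSymmetric),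
      ∑ i, Real.exp (θ * hT.eigenvalues rfl i) * ‖(A - B) (hT.eigenvectorBasis rfl i)‖ ^ 2 ≤
        2 * (c * expTraceLin hT θ (W + W') + 2 * κ * expTraceLin hT θ 1) := by
    intro T hT
    have : 2 * (c * expTraceLin hT θ (W + W') + 2 * κ * expTraceLin hT θ 1) =
        2 * expTraceLin hT θ (c • (W + W') + (2 * κ) • (1 : E →ₗ[ℝ] E)) := by
      rw [map_add (expTraceLin hT θ) (c • (W + W')), map_smul, map_smul, smul_eq_mul, smul_eq_mul]
    rw [this, expTraceLin_apply, Finset.mul_sum]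
    refine Finset.sum_le_sum fun i _ => ?_
    have := mul_le_mul_of_nonneg_left (hsq (hT.eigenvectorBasis rfl i) (by simp))
      (Real.exp_pos (θ * hT.eigenvalues rfl i)).le
    linarith
  have h := expTrace_mean_value hA hB θ
  rw [hAB] at h hsum
  refine h.trans ?_
  have hθ : 0 ≤ θ ^ 2 / 2 := by positivity
  have := mul_le_mul_of_nonneg_left (add_le_add (hsum hA) (hsum hB)) hθ
  linarith

end Trace

/-! ### Product weights on a finite product -/

section Weights

variable {n : ℕ} {τ : Type*}

lemma prod_weight_swap (p : Fin n → τ → ℝ) (k : Fin n) (σ : Fin n → τ) (a : τ) :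
    (∏ j, p j (Function.update σ k a j)) * p k (σ k) = (∏ j, p j (σ j)) * p k a := by
  rw [← Finset.mul_prod_erase _ _ (Finset.mem_univ k),
    ← Finset.mul_prod_erase Finset.univ (fun j => p j (σ j)) (Finset.mem_univ k)]
  have : ∏ j ∈ Finset.univ.erase k, p j (Function.update σ k a j) =
      ∏ j ∈ Finset.univ.erase k, p j (σ j) :=
    Finset.prod_congr rfl fun j hj => by
      rw [Function.update_of_ne (Finset.ne_of_mem_erase hj)]
  rw [this, Function.update_self]
  ring

variable [Fintype τ]

/-- Exchanging coordinate `k` of a sample with an independent copy. -/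
lemma sum_weight_swap (p : Fin n → τ → ℝ) (k : Fin n) (G : (Fin n → τ) → τ → ℝ) :
    ∑ σ, ∑ a, (∏ j, p j (σ j)) * p k a * G (Function.update σ k a) (σ k) =
      ∑ σ, ∑ a, (∏ j, p j (σ j)) * p k a * G σ a := by
  simp only [← Fintype.sum_prod_type']
  -- Swapping the coordinate with the copy is an involution that preserves the product weight: this
  -- is exchangeability of the pair.
  let e : (Fin n → τ) × τ → (Fin n → τ) × τ := fun q => (Function.update q.1 k q.2, q.1 k)
  have he : Function.Involutive e := fun q => by simp [e]
  refine Fintype.sum_equiv he.toPerm _ _ fun q => ?_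
  simp only [Function.Involutive.coe_toPerm, e]
  rw [prod_weight_swap]

lemma sum_prod_weight (p : Fin n → τ → ℝ) (hp : ∀ k, ∑ a, p k a = 1) :
    ∑ σ : Fin n → τ, ∏ j, p j (σ j) = 1 := by
  have := Finset.sum_prod_piFinset (Finset.univ : Finset τ) p
  simpa [hp] using this

end Weights

/-! ### Matrix Bernstein inequality by exchangeable pairs. -/

section Concentration

variable {E : Type*} [NormedAddCommGroup E] [InnerProductSpace ℝ E] [FiniteDimensional ℝ E]
  {n : ℕ} {τ : Type*} [Fintype τ]

/-- The centred sum `∑ k, W (σ k) - N`. -/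
def centredSum (W : τ → E →ₗ[ℝ] E) (N : E →ₗ[ℝ] E) (σ : Fin n → τ) : E →ₗ[ℝ] E :=
  ∑ k, W (σ k) - N

/-- The mean of the sum of independent operators. -/
def meanSum (p : Fin n → τ → ℝ) (W : τ → E →ₗ[ℝ] E) : E →ₗ[ℝ] E :=
  ∑ k, ∑ a, p k a • W a

omit [FiniteDimensional ℝ E] in
lemma isSymmetric_sum {ι : Type*} (s : Finset ι) {T : ι → E →ₗ[ℝ] E}
    (h : ∀ i, (T i).IsSymmetric) : (∑ i ∈ s, T i).IsSymmetric := by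
  classical
  induction s using Finset.induction_on with
  | empty => simp
  | insert i s hi ih => rw [Finset.sum_insert hi]; exact (h i).add ih

omit [FiniteDimensional ℝ E] in
lemma meanSum_isSymmetric (p : Fin n → τ → ℝ) {W : τ → E →ₗ[ℝ] E}
    (hW : ∀ a, (W a).IsSymmetric) : (meanSum p W).IsSymmetric :=
  isSymmetric_sum _ fun _ => isSymmetric_sum _ fun a => (hW a).smul (by simp)

omit [FiniteDimensional ℝ E] [Fintype τ] in
lemma centredSum_isSymmetric {W : τ → E →ₗ[ℝ] E} {N : E →ₗ[ℝ] E}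
    (hW : ∀ a, (W a).IsSymmetric) (hN : N.IsSymmetric) (σ : Fin n → τ) :
    (centredSum W N σ).IsSymmetric :=
  (isSymmetric_sum _ fun k => hW (σ k)).sub hN

omit [FiniteDimensional ℝ E] [Fintype τ] in
lemma centredSum_sub_update [DecidableEq τ] (W : τ → E →ₗ[ℝ] E) (N : E →ₗ[ℝ] E) (σ : Fin n → τ)
    (k : Fin n) (a : τ) :
    centredSum W N σ - centredSum W N (Function.update σ k a) = W (σ k) - W a := by
  simp only [centredSum]
  rw [← Finset.add_sum_erase _ _ (Finset.mem_univ k),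
    ← Finset.add_sum_erase Finset.univ (fun j => W (Function.update σ k a j)) (Finset.mem_univ k)]
  have : ∑ j ∈ Finset.univ.erase k, W (Function.update σ k a j) =
      ∑ j ∈ Finset.univ.erase k, W (σ j) :=
    Finset.sum_congr rfl fun j hj => by
      rw [Function.update_of_ne (Finset.ne_of_mem_erase hj)]
  rw [this, Function.update_self]
  abel

/-- The mean of `W` under `p k` is the average over an independent copy `a` of the `k`th sample, so
both sides are averages over the pair `(σ, a)`. Averaging with the swapped pair turns `exp(θ X)`
into the difference of two exponentials, where `expTrace_swap_le` applies. -/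
lemma coordinate_bound {p : Fin n → τ → ℝ} (hp0 : ∀ k a, 0 ≤ p k a) (hp1 : ∀ k, ∑ a, p k a = 1)
    {W : τ → E →ₗ[ℝ] E} {c κ : ℝ} (hW : ∀ a, SelfBounded c κ (W a)) {N : E →ₗ[ℝ] E}
    (hX : ∀ σ : Fin n → τ, (centredSum W N σ).IsSymmetric) (θ : ℝ) (k : Fin n) :
    θ * ∑ σ, (∏ j, p j (σ j)) * expTraceLin (hX σ) θ (W (σ k) - ∑ a, p k a • W a) ≤
      θ ^ 2 * ∑ σ, (∏ j, p j (σ j)) * (c * expTraceLin (hX σ) θ (W (σ k) + ∑ a, p k a • W a) +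
        2 * κ * expTraceLin (hX σ) θ 1) := by
  classical
  set G : (Fin n → τ) → τ → ℝ := fun σ a => θ * expTraceLin (hX σ) θ (W (σ k) - W a) with hG
  set H : (Fin n → τ) → τ → ℝ := fun σ a => θ ^ 2 * (c * expTraceLin (hX σ) θ (W (σ k) + W a) +
    2 * κ * expTraceLin (hX σ) θ 1) with hH
  have e1 : θ * ∑ σ, (∏ j, p j (σ j)) * expTraceLin (hX σ) θ (W (σ k) - ∑ a, p k a • W a) =
      ∑ σ, ∑ a, (∏ j, p j (σ j)) * p k a * G σ a := by
    rw [Finset.mul_sum]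
    refine Finset.sum_congr rfl fun σ _ => ?_
    have : W (σ k) - ∑ a, p k a • W a = ∑ a, p k a • (W (σ k) - W a) := by
      simp only [smul_sub, Finset.sum_sub_distrib, ← Finset.sum_smul, hp1, one_smul]
    rw [this, map_sum, Finset.mul_sum, Finset.mul_sum]
    refine Finset.sum_congr rfl fun a _ => ?_
    rw [map_smul, smul_eq_mul, hG]; ring
  have e2 : θ ^ 2 * ∑ σ, (∏ j, p j (σ j)) * (c * expTraceLin (hX σ) θ (W (σ k) +
      ∑ a, p k a • W a) + 2 * κ * expTraceLin (hX σ) θ 1) =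
      ∑ σ, ∑ a, (∏ j, p j (σ j)) * p k a * H σ a := by
    rw [Finset.mul_sum]
    refine Finset.sum_congr rfl fun σ _ => ?_
    have h1 : W (σ k) + ∑ a, p k a • W a = ∑ a, p k a • (W (σ k) + W a) := by
      simp only [smul_add, Finset.sum_add_distrib, ← Finset.sum_smul, hp1, one_smul]
    have h2 : 2 * κ * expTraceLin (hX σ) θ 1 =
        ∑ a, p k a * (2 * κ * expTraceLin (hX σ) θ 1) := by
      rw [← Finset.sum_mul, hp1, one_mul]
    rw [h1, h2, map_sum, Finset.mul_sum, ← Finset.sum_add_distrib, Finset.mul_sum, Finset.mul_sum]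
    refine Finset.sum_congr rfl fun a _ => ?_
    rw [map_smul, smul_eq_mul, hH]; ring
  rw [e1, e2]
  -- By exchangeability each side of this sum is twice the corresponding side of the goal.
  have key : ∑ σ, ∑ a, (∏ j, p j (σ j)) * p k a *
        (G σ a + G (Function.update σ k a) (σ k)) ≤
      ∑ σ, ∑ a, (∏ j, p j (σ j)) * p k a *
        (H σ a + H (Function.update σ k a) (σ k)) := by
    refine Finset.sum_le_sum fun σ _ => Finset.sum_le_sum fun a _ => ?_
    refine mul_le_mul_of_nonneg_left ?_
      (mul_nonneg (Finset.prod_nonneg fun j _ => hp0 j _) (hp0 k a))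
    have := expTrace_swap_le (hX σ) (hX (Function.update σ k a))
      (centredSum_sub_update W N σ k a) (hW (σ k)) (hW a) θ
    simp only [hG, hH, Function.update_self]
    rw [← neg_sub (W (σ k)) (W a), map_neg, add_comm (W a) (W (σ k))]
    linarith
  simp only [mul_add, Finset.sum_add_distrib] at key
  rw [sum_weight_swap p k G, sum_weight_swap p k H] at key
  linarith

/-- The differential inequality for the trace of the matrix Laplace transform. -/
lemma laplace_differential_bound {p : Fin n → τ → ℝ} (hp0 : ∀ k a, 0 ≤ p k a)
    (hp1 : ∀ k, ∑ a, p k a = 1) {W : τ → E →ₗ[ℝ] E} {c κ s : ℝ} (hc : 0 ≤ c)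
    (hW : ∀ a, SelfBounded c κ (W a))
    (hs : ∀ u, ‖u‖ = 1 → inner ℝ u (meanSum p W u) ≤ n * s)
    (hX : ∀ σ : Fin n → τ, (centredSum W (meanSum p W) σ).IsSymmetric) (θ : ℝ) :
    θ * ∑ σ, (∏ j, p j (σ j)) * expTraceLin (hX σ) θ (centredSum W (meanSum p W) σ) ≤
      θ ^ 2 * (c * ∑ σ, (∏ j, p j (σ j)) *
          expTraceLin (hX σ) θ (centredSum W (meanSum p W) σ) +
        n * (2 * c * s + 2 * κ) * ∑ σ, (∏ j, p j (σ j)) * expTraceLin (hX σ) θ 1) := by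
  have h := Finset.sum_le_sum fun k (_ : k ∈ Finset.univ) =>
    coordinate_bound hp0 hp1 hW hX θ k
  simp only [← Finset.mul_sum] at h
  rw [Finset.sum_comm, Finset.sum_comm (s := Finset.univ (α := Fin n))] at h
  have e1 : ∀ σ : Fin n → τ, ∑ k, (∏ j, p j (σ j)) *
      expTraceLin (hX σ) θ (W (σ k) - ∑ a, p k a • W a) =
      (∏ j, p j (σ j)) * expTraceLin (hX σ) θ (centredSum W (meanSum p W) σ) := by
    intro σ
    rw [← Finset.mul_sum, ← map_sum, Finset.sum_sub_distrib]; rfl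
  simp only [e1] at h
  refine h.trans (mul_le_mul_of_nonneg_left ?_ (sq_nonneg θ))
  rw [Finset.mul_sum, Finset.mul_sum, ← Finset.sum_add_distrib]
  refine Finset.sum_le_sum fun σ _ => ?_
  rw [← Finset.mul_sum, Finset.sum_add_distrib, ← Finset.mul_sum, ← map_sum,
    Finset.sum_add_distrib]
  -- The feedback: the sum produced by the squares is the centred sum itself, whose trace is the
  -- derivative again, plus twice the mean, which is at most `n s`.
  have e2 : ∑ k, W (σ k) + ∑ k, ∑ a, p k a • W a =
      centredSum W (meanSum p W) σ + (2 : ℝ) • meanSum p W := by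
    rw [centredSum, two_smul, meanSum]; abel
  have e3 : expTraceLin (hX σ) θ (meanSum p W) ≤
      n * s * expTraceLin (hX σ) θ 1 := by
    have := expTraceLin_le_of_forall_norm_eq_one (hX σ) θ (B := meanSum p W)
      (C := (n * s) • (1 : E →ₗ[ℝ] E)) fun u hu => by
        simpa [inner_smul_right, real_inner_self_eq_norm_sq, hu] using hs u hu
    simpa using this
  rw [e2, map_add, map_smul, smul_eq_mul]
  simp only [Finset.sum_const, Finset.card_univ, Fintype.card_fin, nsmul_eq_mul]
  have hw : 0 ≤ ∏ j, p j (σ j) := Finset.prod_nonneg fun j _ => hp0 j _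
  have := mul_le_mul_of_nonneg_left (mul_le_mul_of_nonneg_left e3 hc) hw
  linarith

/-- Grönwall's inequality for `f' ≤ k t f`. -/
lemma le_exp_of_deriv_le {f f' : ℝ → ℝ} {k T : ℝ} (hT : 0 ≤ T)
    (hf : ∀ t, HasDerivAt f (f' t) t) (h : ∀ t, 0 < t → t ≤ T → f' t ≤ k * t * f t) :
    f T ≤ f 0 * Real.exp (k * T ^ 2 / 2) := by
  have hd : ∀ t, HasDerivAt (fun t => f t * Real.exp (-(k * t ^ 2 / 2)))
      (f' t * Real.exp (-(k * t ^ 2 / 2)) +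
        f t * (Real.exp (-(k * t ^ 2 / 2)) * (-(k * (2 * t) / 2)))) t := fun t => by
    refine (hf t).mul (HasDerivAt.exp ?_)
    have := (((hasDerivAt_pow 2 t).const_mul k).div_const 2).fun_neg
    simpa using this
  have anti : AntitoneOn (fun t => f t * Real.exp (-(k * t ^ 2 / 2))) (Set.Icc 0 T) := by
    refine antitoneOn_of_deriv_nonpos (convex_Icc 0 T)
      (fun t _ => (hd t).continuousAt.continuousWithinAt)
      (fun t _ => (hd t).differentiableAt.differentiableWithinAt) fun t ht => ?_
    rw [interior_Icc] at ht
    rw [(hd t).deriv]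
    have := mul_le_mul_of_nonneg_right (h t ht.1 ht.2.le) (Real.exp_pos (-(k * t ^ 2 / 2))).le
    linarith
  have := anti (Set.left_mem_Icc.2 hT) (Set.right_mem_Icc.2 hT) hT
  simp only [ne_eq, OfNat.ofNat_ne_zero, not_false_eq_true, zero_pow, mul_zero, zero_div, neg_zero,
    Real.exp_zero, mul_one, Real.exp_neg] at this
  rwa [← div_eq_mul_inv, div_le_iff₀ (Real.exp_pos _)] at this

/-- Bound on the trace of the matrix Laplace transform; `ε = 1` gives the upper and `ε = -1` the
lower tail. -/
lemma laplace_bound {p : Fin n → τ → ℝ} (hp0 : ∀ k a, 0 ≤ p k a)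
    (hp1 : ∀ k, ∑ a, p k a = 1) {W : τ → E →ₗ[ℝ] E} {c κ s : ℝ} (hc : 0 ≤ c)
    (hW : ∀ a, SelfBounded c κ (W a))
    (hs : ∀ u, ‖u‖ = 1 → inner ℝ u (meanSum p W u) ≤ n * s)
    (hX : ∀ σ : Fin n → τ, (centredSum W (meanSum p W) σ).IsSymmetric)
    (hv : 0 ≤ n * (2 * c * s + 2 * κ)) {ε q T : ℝ} (hε : ε ^ 2 = 1) (hT : 0 ≤ T)
    (hq : 0 < q) (hq1 : q ≤ 1) (hqT : q ≤ 1 - ε * c * T) :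
    ∑ σ, (∏ j, p j (σ j)) * expTraceLin (hX σ) (ε * T) 1 ≤
      Module.finrank ℝ E * Real.exp (n * (2 * c * s + 2 * κ) / q * T ^ 2 / 2) := by
  set v := n * (2 * c * s + 2 * κ)
  set f : ℝ → ℝ := fun t => ∑ σ, (∏ j, p j (σ j)) * expTraceLin (hX σ) (ε * t) 1 with hf
  set f' : ℝ → ℝ := fun t => ∑ σ, (∏ j, p j (σ j)) *
    (ε * expTraceLin (hX σ) (ε * t) (centredSum W (meanSum p W) σ)) with hf'
  have hd : ∀ t, HasDerivAt f (f' t) t := by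
    intro t
    refine HasDerivAt.fun_sum fun σ _ => HasDerivAt.const_mul _ ?_
    simp only [expTraceLin_one]
    rw [expTraceLin_self, Finset.mul_sum]
    refine HasDerivAt.fun_sum fun i _ => ?_
    have h1 : HasDerivAt (fun t : ℝ => ε * t * (hX σ).eigenvalues rfl i)
        (ε * (hX σ).eigenvalues rfl i) t := by
      simpa using ((hasDerivAt_id t).const_mul ε).mul_const ((hX σ).eigenvalues rfl i)
    exact h1.exp.congr_deriv (by ring)
  have hf0 : f 0 = Module.finrank ℝ E := by
    simp only [hf, expTraceLin_one, mul_zero, zero_mul, Real.exp_zero, Finset.sum_const,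
      Finset.card_univ, Fintype.card_fin, nsmul_eq_mul, mul_one]
    rw [← Finset.sum_mul, sum_prod_weight p hp1, one_mul]
  rw [← hf0]
  refine le_exp_of_deriv_le hT hd fun t ht htT => ?_
  have hpos : 0 ≤ f t := by
    refine Finset.sum_nonneg fun σ _ => mul_nonneg (Finset.prod_nonneg fun j _ => hp0 j _) ?_
    rw [expTraceLin_one]
    positivity
  have h := laplace_differential_bound hp0 hp1 hc hW hs hX (ε * t)
  have e1 : f' t = ε * ∑ σ, (∏ j, p j (σ j)) *
      expTraceLin (hX σ) (ε * t) (centredSum W (meanSum p W) σ) := by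
    rw [hf', Finset.mul_sum]
    exact Finset.sum_congr rfl fun σ _ => by ring
  set D := ∑ σ, (∏ j, p j (σ j)) *
      expTraceLin (hX σ) (ε * t) (centredSum W (meanSum p W) σ)
  change _ ≤ (ε * t) ^ 2 * (c * D + v * f t) at h
  rw [mul_pow, hε, one_mul] at h
  -- The feedback term is moved to the left. For `ε = -1` its factor is at least 1, which is why the
  -- lower tail loses nothing; for `ε = 1` it stays above `q` as long as `t ≤ T`.
  have h2 : f' t * (1 - ε * c * t) ≤ v * t * f t := by
    have hD : D = ε * f' t := by rw [e1, ← mul_assoc, ← sq, hε, one_mul]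
    rw [hD] at h
    have h3 : t * (f' t) ≤ t * (t * (c * (ε * f' t) + v * f t)) := by
      calc t * f' t = ε * t * (ε * f' t) := by
            rw [show ε * t * (ε * f' t) = ε ^ 2 * (t * f' t) by ring, hε, one_mul]
        _ ≤ _ := by linarith
    have := le_of_mul_le_mul_left h3 ht
    linarith
  rcases le_or_gt (f' t) 0 with h0 | h0
  · exact h0.trans (by positivity)
  · have hqt : q ≤ 1 - ε * c * t := by
      rcases le_or_gt 0 (ε * c) with h1 | h1
      · nlinarith
      · nlinarith
    rw [div_mul_eq_mul_div, div_mul_eq_mul_div, le_div_iff₀ hq]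
    nlinarith

lemma eigenvectorBasis_inner_apply {A : E →ₗ[ℝ] E} (hA : A.IsSymmetric) (u : E)
    (i : Fin (Module.finrank ℝ E)) :
    inner ℝ (hA.eigenvectorBasis rfl i) (A u) =
      hA.eigenvalues rfl i * inner ℝ (hA.eigenvectorBasis rfl i) u := by
  rw [← hA, hA.apply_eigenvectorBasis]
  simp [inner_smul_left]

lemma inner_apply_eq_sum_eigenvalues {A : E →ₗ[ℝ] E} (hA : A.IsSymmetric) (u : E) :
    inner ℝ u (A u) = ∑ i, hA.eigenvalues rfl i * inner ℝ (hA.eigenvectorBasis rfl i) u ^ 2 := by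
  rw [← (hA.eigenvectorBasis rfl).sum_inner_mul_inner]
  refine Finset.sum_congr rfl fun i _ => ?_
  rw [eigenvectorBasis_inner_apply, real_inner_comm]; ring

lemma inner_eigenvectorBasis_apply {A : E →ₗ[ℝ] E} (hA : A.IsSymmetric)
    (i : Fin (Module.finrank ℝ E)) :
    inner ℝ (hA.eigenvectorBasis rfl i) (A (hA.eigenvectorBasis rfl i)) =
      hA.eigenvalues rfl i := by
  rw [eigenvectorBasis_inner_apply]
  simp

lemma norm_apply_le_of_abs_inner_le {A : E →ₗ[ℝ] E} (hA : A.IsSymmetric) {t : ℝ} (ht : 0 ≤ t)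
    (h : ∀ u, |inner ℝ u (A u)| ≤ t * ‖u‖ ^ 2) (v : E) : ‖A v‖ ≤ t * ‖v‖ := by
  have hl : ∀ i, |hA.eigenvalues rfl i| ≤ t := fun i => by
    have := h (hA.eigenvectorBasis rfl i)
    rw [inner_eigenvectorBasis_apply] at this
    simpa using this
  refine abs_le_of_sq_le_sq' ?_ (by positivity) |>.2
  rw [mul_pow, ← (hA.eigenvectorBasis rfl).sum_sq_inner_right (A v),
    ← (hA.eigenvectorBasis rfl).sum_sq_inner_right v, Finset.mul_sum]
  refine Finset.sum_le_sum fun i _ => ?_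
  rw [eigenvectorBasis_inner_apply, mul_pow]
  exact mul_le_mul_of_nonneg_right (sq_le_sq' (abs_le.1 (hl i)).1 (abs_le.1 (hl i)).2)
    (sq_nonneg _)

open Classical in
/-- Markov's inequality for the trace of the matrix Laplace transform. -/
lemma tail_le_laplace {p : Fin n → τ → ℝ} (hp0 : ∀ k a, 0 ≤ p k a) {X : (Fin n → τ) → E →ₗ[ℝ] E}
    (hX : ∀ σ, (X σ).IsSymmetric) {ε T t B : ℝ} (hT : 0 ≤ T)
    (hB : ∑ σ, (∏ j, p j (σ j)) * expTraceLin (hX σ) (ε * T) 1 ≤ B) :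
    ∑ σ with ∃ u, t * ‖u‖ ^ 2 < ε * inner ℝ u (X σ u), ∏ j, p j (σ j) ≤
      Real.exp (-(T * t)) * B := by
  refine le_trans ?_ (mul_le_mul_of_nonneg_left hB (Real.exp_pos _).le)
  rw [Finset.mul_sum]
  have hw : ∀ σ : Fin n → τ, 0 ≤ ∏ j, p j (σ j) := fun σ => Finset.prod_nonneg fun j _ => hp0 j _
  have hpos : ∀ σ, 0 ≤ expTraceLin (hX σ) (ε * T) 1 := fun σ => by
    rw [expTraceLin_one]; positivity
  refine (Finset.sum_le_sum fun σ hσ => ?_).trans (Finset.sum_le_univ_sum_of_nonneg fun σ =>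
    mul_nonneg (Real.exp_pos _).le (mul_nonneg (hw σ) (hpos σ)))
  obtain ⟨u, hu⟩ := (Finset.mem_filter.1 hσ).2
  -- A quadratic form exceeding `t` in some direction forces a signed eigenvalue above `t`, and that
  -- single eigenvalue already makes the trace at least `exp(T t)`.
  obtain ⟨i, hi⟩ : ∃ i, t < ε * (hX σ).eigenvalues rfl i := by
    by_contra! hcon
    rw [inner_apply_eq_sum_eigenvalues (hX σ), Finset.mul_sum,
      ← ((hX σ).eigenvectorBasis rfl).sum_sq_inner_right u, Finset.mul_sum] at hu
    refine absurd hu (not_lt.2 (Finset.sum_le_sum fun i _ => ?_))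
    rw [← mul_assoc]
    exact mul_le_mul_of_nonneg_right (hcon i) (sq_nonneg _)
  have h1 : Real.exp (T * t) ≤ expTraceLin (hX σ) (ε * T) 1 := by
    rw [expTraceLin_one]
    refine le_trans ?_ (Finset.single_le_sum (f := fun i =>
      Real.exp (ε * T * (hX σ).eigenvalues rfl i)) (fun i _ => (Real.exp_pos _).le)
      (Finset.mem_univ i))
    refine Real.exp_le_exp.2 ?_
    nlinarith
  calc ∏ j, p j (σ j) = Real.exp (-(T * t)) * ((∏ j, p j (σ j)) * Real.exp (T * t)) := by
        rw [mul_left_comm, ← Real.exp_add]; simp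
    _ ≤ _ := by
        have := hw σ
        gcongr

open Classical in
/-- Upper tail of a sum of independent self-bounded operators. -/
lemma upper_tail {p : Fin n → τ → ℝ} (hp0 : ∀ k a, 0 ≤ p k a)
    (hp1 : ∀ k, ∑ a, p k a = 1) {W : τ → E →ₗ[ℝ] E} {c κ s : ℝ} (hc : 0 ≤ c)
    (hW : ∀ a, SelfBounded c κ (W a))
    (hs : ∀ u, ‖u‖ = 1 → inner ℝ u (meanSum p W u) ≤ n * s)
    (hv : 0 < n * (2 * c * s + 2 * κ)) {t : ℝ} (ht : 0 ≤ t) :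
    ∑ σ with ∃ u, t * ‖u‖ ^ 2 < inner ℝ u (centredSum W (meanSum p W) σ u),
        ∏ j : Fin n, p j (σ j) ≤
      Module.finrank ℝ E * Real.exp (-(t ^ 2 / (2 * (n * (2 * c * s + 2 * κ) + c * t)))) := by
  have hX : ∀ σ : Fin n → τ, (centredSum W (meanSum p W) σ).IsSymmetric :=
    centredSum_isSymmetric (fun a => (hW a).1) (meanSum_isSymmetric p fun a => (hW a).1)
  set v := n * (2 * c * s + 2 * κ)
  have hvc : 0 < v + c * t := by positivity
  -- This `T` makes `1 - c T` equal to `q = v / (v + c t)`, and the exponent `-T t + (v / q) T² / 2`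
  -- collapses to `-t² / (2 (v + c t))`.
  have h1 := laplace_bound hp0 hp1 hc hW hs hX hv.le (ε := 1) (q := v / (v + c * t))
    (T := t / (v + c * t)) (by norm_num) (by positivity) (by positivity)
    (by rw [div_le_one hvc]; nlinarith)
    (by rw [show 1 - 1 * c * (t / (v + c * t)) = v / (v + c * t) by field_simp; ring])
  have h2 := tail_le_laplace hp0 hX (t := t) (by positivity) h1
  simp only [one_mul] at h2
  refine h2.trans (le_of_eq ?_)
  rw [mul_left_comm, ← Real.exp_add]
  congr 2
  field_simp
  ring

open Classical in
/-- Lower tail of a sum of independent self-bounded operators. -/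
lemma lower_tail {p : Fin n → τ → ℝ} (hp0 : ∀ k a, 0 ≤ p k a)
    (hp1 : ∀ k, ∑ a, p k a = 1) {W : τ → E →ₗ[ℝ] E} {c κ s : ℝ} (hc : 0 ≤ c)
    (hW : ∀ a, SelfBounded c κ (W a))
    (hs : ∀ u, ‖u‖ = 1 → inner ℝ u (meanSum p W u) ≤ n * s)
    (hv : 0 < n * (2 * c * s + 2 * κ)) {t : ℝ} (ht : 0 ≤ t) :
    ∑ σ with ∃ u, t * ‖u‖ ^ 2 < -inner ℝ u (centredSum W (meanSum p W) σ u),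
        ∏ j : Fin n, p j (σ j) ≤
      Module.finrank ℝ E * Real.exp (-(t ^ 2 / (2 * (n * (2 * c * s + 2 * κ))))) := by
  have hX : ∀ σ : Fin n → τ, (centredSum W (meanSum p W) σ).IsSymmetric :=
    centredSum_isSymmetric (fun a => (hW a).1) (meanSum_isSymmetric p fun a => (hW a).1)
  set v := n * (2 * c * s + 2 * κ)
  -- Here `1 + c T ≥ 1`, so `q = 1` is allowed and the Gaussian optimum `T = t / v` can be used for
  -- every `t`.
  have h1 := laplace_bound hp0 hp1 hc hW hs hX hv.le (ε := -1) (q := 1)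
    (T := t / v) (by norm_num) (by positivity) (by positivity) le_rfl
    (by have : 0 ≤ c * (t / v) := by positivity
        linarith)
  have h2 := tail_le_laplace hp0 hX (t := t) (by positivity) h1
  simp only [neg_mul, one_mul] at h2
  refine h2.trans (le_of_eq ?_)
  rw [mul_left_comm, ← Real.exp_add]
  congr 2
  field_simp
  ring

end Concentration

/-! ### The quantized sample as a finite-valued variable -/

/-- The quantized predictor encoded by bits. -/
noncomputable def bitX {d : ℕ} (R : ℝ) (a : Fin d → Bool × Bool) (j : Fin d) : ℝ := if (a j).1 then R else -R

/-- The quantized squares encoded by bits. -/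
noncomputable def bitSq {d : ℕ} (R : ℝ) (a : Fin d → Bool × Bool) (j : Fin d) : ℝ := if (a j).2 then R ^ 2 else 0

/-- The contribution of one sample to the plug-in estimator of `Σ`. -/
noncomputable def bitMatrix {d : ℕ} (R : ℝ) (a : Fin d → Bool × Bool) : Matrix (Fin d) (Fin d) ℝ :=
  Matrix.vecMulVec (bitX R a) (bitX R a) + Matrix.diagonal fun j => bitSq R a j - bitX R a j ^ 2

/-- Whether the dithered quantizer rounds up. -/
noncomputable def upBit (ℓ u z w : ℝ) : Bool :=
  decide (|z + (u - ℓ) * w - u| ≤ |z + (u - ℓ) * w - ℓ|)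

/-- The bits that encode a quantized predictor. -/
noncomputable def sampleBits {d : ℕ} (R : ℝ) (x : Vec d) (w : Channel d → ℝ) : Fin d → Bool × Bool := fun j =>
  (upBit (-R) R (x j) (w (Sum.inl j)), upBit 0 (R ^ 2) (x j ^ 2) (w (Sum.inr (Sum.inl j))))

lemma quantize_eq_ite (ℓ u z w : ℝ) : quantize ℓ u z w = if upBit ℓ u z w then u else ℓ := by
  simp [quantize, nearest, upBit]

lemma bitX_sampleBits {d : ℕ} (R : ℝ) (x : Vec d) (w : Channel d → ℝ) :
    bitX R (sampleBits R x w) = quantX R x w := by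
  ext j; simp [bitX, sampleBits, quantX, quantize_eq_ite]; rfl

lemma bitSq_sampleBits {d : ℕ} (R : ℝ) (x : Vec d) (w : Channel d → ℝ) :
    bitSq R (sampleBits R x w) = quantSq R x w := by
  ext j; simp [bitSq, sampleBits, quantSq, quantize_eq_ite]; rfl

lemma sigmaHat_eq {n d : ℕ} (R : ℝ) (x : Fin n → Vec d) (w : Fin n → Channel d → ℝ) :
    sigmaHat R x w = (1 / (n : ℝ)) • ∑ i, bitMatrix R (sampleBits R (x i) (w i)) := by
  simp only [sigmaHat, bitMatrix, bitX_sampleBits, bitSq_sampleBits]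

lemma bitMatrix_transpose {d : ℕ} (R : ℝ) (a : Fin d → Bool × Bool) :
    (bitMatrix R a).IsSymm := by
  refine Matrix.IsSymm.ext fun i j => ?_
  by_cases h : i = j
  · rw [h]
  · simp [bitMatrix, Matrix.vecMulVec_apply, Matrix.diagonal_apply_ne _ h,
      Matrix.diagonal_apply_ne' _ h, mul_comm]

lemma toEuclideanLin_apply_apply {d : ℕ} (M : Matrix (Fin d) (Fin d) ℝ) (u : Vec d) (j : Fin d) :
    Matrix.toEuclideanLin M u j = ∑ k, M j k * u k := by
  simp [Matrix.toLpLin_apply, Matrix.mulVec, dotProduct]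

lemma inner_eq_sum {d : ℕ} (u v : Vec d) : inner ℝ u v = ∑ j, u j * v j := by
  simp [PiLp.inner_apply, mul_comm]

lemma norm_sq_eq_sum {d : ℕ} (u : Vec d) : ‖u‖ ^ 2 = ∑ j, u j ^ 2 := by
  simp [EuclideanSpace.norm_sq_eq]

lemma toEuclideanLin_isSymmetric {d : ℕ} {M : Matrix (Fin d) (Fin d) ℝ} (hM : M.IsSymm) :
    (Matrix.toEuclideanLin M).IsSymmetric := by
  intro u v
  simp only [inner_eq_sum, toEuclideanLin_apply_apply, Finset.sum_mul, Finset.mul_sum]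
  rw [Finset.sum_comm]
  refine Finset.sum_congr rfl fun j _ => Finset.sum_congr rfl fun k _ => ?_
  rw [hM.apply j k]; ring

lemma bitMatrix_apply_apply {d : ℕ} (R : ℝ) (a : Fin d → Bool × Bool) (u : Vec d) (j : Fin d) :
    Matrix.toEuclideanLin (bitMatrix R a) u j =
      bitX R a j * ∑ k, bitX R a k * u k + (bitSq R a j - bitX R a j ^ 2) * u j := by
  rw [toEuclideanLin_apply_apply, Finset.mul_sum]
  simp only [bitMatrix, Matrix.add_apply, Matrix.vecMulVec_apply, add_mul, Finset.sum_add_distrib,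
    Matrix.diagonal_apply, ite_mul, zero_mul, Finset.sum_ite_eq, Finset.mem_univ, if_true]
  congr 1
  exact Finset.sum_congr rfl fun k _ => by ring

/-- The contribution is `x xᵀ - R² diag(e)`, where `x` has entries `±R` and `e j ∈ {0, 1}` marks the
squares rounded down. Hence `⟨u, W u⟩ = A² - R² Q` and `‖W u‖² = d R² A² - 2 R² A (A - F) + R⁴ Q`,
with `A = ⟨x, u⟩`, `Q = ∑ e u²` and `F` the part of `A` where `e` vanishes. Cauchy-Schwarz gives `F²
≤ d R² (‖u‖² - Q)`, and `2 A F ≤ A² + F²` closes the estimate. The gain over the crude `‖W u‖² ≤ d²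
R⁴ ‖u‖²` is one power of `d` in the variance. -/
lemma selfBounded_bitMatrix {d : ℕ} {R : ℝ} (hR : 0 < R) (a : Fin d → Bool × Bool) :
    SelfBounded (d * R ^ 2) ((d + 1) * R ^ 4) (Matrix.toEuclideanLin (bitMatrix R a)) := by
  refine ⟨toEuclideanLin_isSymmetric (bitMatrix_transpose R a), fun u => ?_⟩
  set e : Fin d → ℝ := fun j => if (a j).2 then 0 else 1 with he
  set x := bitX R a with hx
  have hx2 : ∀ j, x j ^ 2 = R ^ 2 := fun j => by
    simp only [hx, bitX]; split_ifs <;> ring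
  have hq : ∀ j, bitSq R a j - x j ^ 2 = -(R ^ 2 * e j) := fun j => by
    rw [hx2]; simp only [bitSq, he]; split_ifs <;> ring
  have he2 : ∀ j, e j ^ 2 = e j := fun j => by
    simp only [he]; split_ifs <;> norm_num
  have he1 : ∀ j, e j ≤ 1 := fun j => by
    simp only [he]; split_ifs <;> norm_num
  set A := ∑ k, x k * u k with hA
  set P := ∑ k, u k ^ 2
  set Q := ∑ k, e k * u k ^ 2
  set F := ∑ k, ((1 - e k) * u k) * x k with hF
  have hexu : ∑ j, e j * (x j * u j) = A - F := by
    rw [hA, hF, ← Finset.sum_sub_distrib]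
    exact Finset.sum_congr rfl fun j _ => by ring
  have h1 : inner ℝ u (Matrix.toEuclideanLin (bitMatrix R a) u) = A ^ 2 - R ^ 2 * Q := by
    rw [inner_eq_sum]
    simp only [bitMatrix_apply_apply, ← hx, hq, ← hA]
    calc _ = ∑ j, (A * (x j * u j) - R ^ 2 * (e j * u j ^ 2)) :=
          Finset.sum_congr rfl fun j _ => by ring
      _ = _ := by rw [Finset.sum_sub_distrib, ← Finset.mul_sum, ← Finset.mul_sum]; ring
  have h2 : ‖Matrix.toEuclideanLin (bitMatrix R a) u‖ ^ 2 =
      d * R ^ 2 * A ^ 2 - 2 * R ^ 2 * A * (A - F) + R ^ 4 * Q := by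
    rw [norm_sq_eq_sum]
    simp only [bitMatrix_apply_apply, ← hx, hq, ← hA]
    calc _ = ∑ j, (R ^ 2 * A ^ 2 - 2 * R ^ 2 * A * (e j * (x j * u j)) +
          R ^ 4 * (e j * u j ^ 2)) := by
          refine Finset.sum_congr rfl fun j _ => ?_
          linear_combination A ^ 2 * hx2 j + R ^ 4 * u j ^ 2 * he2 j
      _ = _ := by
          rw [Finset.sum_add_distrib, Finset.sum_sub_distrib, Finset.sum_const, ← Finset.mul_sum,
            ← Finset.mul_sum, hexu]
          simp only [Finset.card_univ, Fintype.card_fin, nsmul_eq_mul]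
          ring
  have hFle : F ^ 2 ≤ (P - Q) * (d * R ^ 2) := by
    refine (Finset.sum_mul_sq_le_sq_mul_sq _ _ _).trans (le_of_eq ?_)
    congr 1
    · simp only [P, Q]
      rw [← Finset.sum_sub_distrib]
      refine Finset.sum_congr rfl fun j _ => ?_
      linear_combination u j ^ 2 * he2 j
    · simp [hx2]
  have hQP : Q ≤ P := Finset.sum_le_sum fun j _ => by nlinarith [he1 j, sq_nonneg (u j)]
  rw [h1, h2, norm_sq_eq_sum]
  change _ ≤ d * R ^ 2 * (A ^ 2 - R ^ 2 * Q) + (d + 1) * R ^ 4 * P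
  have hR2 : 0 ≤ R ^ 2 := by positivity
  have h3 : 2 * A * F ≤ A ^ 2 + F ^ 2 := by nlinarith [sq_nonneg (A - F)]
  have h4 := mul_le_mul_of_nonneg_left (h3.trans (add_le_add_right hFle _)) hR2
  have h5 : 0 ≤ R ^ 2 * A ^ 2 := by positivity
  have h6 := mul_le_mul_of_nonneg_left hQP (show 0 ≤ R ^ 4 by positivity)
  nlinarith

/-! ### From the probability space to finite weighted sums. -/

section Transfer

variable {Ω : Type*} [MeasurableSpace Ω] {μ : Measure Ω} [IsProbabilityMeasure μ] {n : ℕ}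
  {τ : Type*} [Fintype τ] [MeasurableSpace τ] [MeasurableSingletonClass τ]

open Classical in
lemma measureReal_eq_sum_prod {A : Fin n → Ω → τ} (hA : ∀ k, Measurable (A k))
    (hind : iIndepFun A μ) (p : (Fin n → τ) → Prop) :
    μ.real {ω | p fun k => A k ω} = ∑ σ with p σ, ∏ k, μ.real (A k ⁻¹' {σ k}) := by
  have hm : Measurable fun ω k => A k ω := measurable_pi_lambda _ hA
  have h1 := sum_measureReal_preimage_singleton (μ := μ) (f := fun ω k => A k ω)
    (Finset.univ.filter p) (fun y _ => hm (measurableSet_singleton y))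
  have h2 : (fun ω k => A k ω) ⁻¹' ↑(Finset.univ.filter p) = {ω | p fun k => A k ω} := by
    ext ω; simp
  rw [h2] at h1
  rw [← h1]
  refine Finset.sum_congr rfl fun σ _ => ?_
  have h3 : (fun ω k => A k ω) ⁻¹' {σ} = ⋂ k, A k ⁻¹' {σ k} := by
    ext ω; simp [funext_iff]
  rw [h3, measureReal_def, hind.meas_iInter fun k => ⟨{σ k}, measurableSet_singleton _, rfl⟩,
    ENNReal.toReal_prod]
  rfl

lemma sum_measureReal_preimage_mul {A : Ω → τ} (hA : Measurable A) (f : τ → ℝ) :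
    ∑ a, μ.real (A ⁻¹' {a}) * f a = ∫ ω, f (A ω) ∂μ := by
  rw [← integral_map hA.aemeasurable (measurable_of_finite f).aestronglyMeasurable]
  have : IsProbabilityMeasure (μ.map A) := Measure.isProbabilityMeasure_map hA.aemeasurable
  rw [integral_fintype .of_finite]
  refine Finset.sum_congr rfl fun a _ => ?_
  rw [map_measureReal_apply hA (measurableSet_singleton a), smul_eq_mul]

lemma sum_measureReal_preimage_eq_one {A : Ω → τ} (hA : Measurable A) :
    ∑ a, μ.real (A ⁻¹' {a}) = 1 := by
  have := sum_measureReal_preimage_mul (μ := μ) hA fun _ => 1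
  simpa using this

end Transfer

/-! ### Tail bounds for the sum of the quantized matrices. -/

section BitMatrix

variable {Ω : Type*} [MeasurableSpace Ω] {μ : Measure Ω} [IsProbabilityMeasure μ] {n d : ℕ}

/-- Only the total of the means is prescribed, not each one separately, so the samples need not be
identically distributed. This form covers fixed design. -/
lemma meanSum_bitMatrix {A : Fin n → Ω → Fin d → Bool × Bool} (hA : ∀ k, Measurable (A k))
    {R : ℝ} {S : Matrix (Fin d) (Fin d) ℝ}
    (hS : ∀ j l, n * S j l = ∑ k, ∫ ω, bitMatrix R (A k ω) j l ∂μ) :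
    meanSum (fun k a => μ.real (A k ⁻¹' {a})) (fun a => Matrix.toEuclideanLin (bitMatrix R a)) =
      Matrix.toEuclideanLin ((n : ℝ) • S) := by
  simp only [meanSum, ← map_smul, ← map_sum]
  congr 1
  ext j l
  simp only [Matrix.sum_apply, Matrix.smul_apply, smul_eq_mul, hS]
  exact Finset.sum_congr rfl fun k _ =>
    sum_measureReal_preimage_mul (hA k) fun a => bitMatrix R a j l

lemma centredSum_bitMatrix (R : ℝ) (N : Matrix (Fin d) (Fin d) ℝ)
    (σ : Fin n → Fin d → Bool × Bool) :
    centredSum (fun a => Matrix.toEuclideanLin (bitMatrix R a)) (Matrix.toEuclideanLin N) σ =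
      Matrix.toEuclideanLin (∑ k, bitMatrix R (σ k) - N) := by
  simp only [centredSum, ← map_sum, ← map_sub]

variable {A : Fin n → Ω → Fin d → Bool × Bool} {R s : ℝ} {S : Matrix (Fin d) (Fin d) ℝ}

lemma mean_bound (hA : ∀ k, Measurable (A k))
    (hS : ∀ j l, n * S j l = ∑ k, ∫ ω, bitMatrix R (A k ω) j l ∂μ)
    (hs : ∀ u : Vec d, ‖u‖ = 1 → inner ℝ u (Matrix.toEuclideanLin S u) ≤ s) (u : Vec d)
    (hu : ‖u‖ = 1) :
    inner ℝ u (meanSum (fun k a => μ.real (A k ⁻¹' {a}))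
      (fun a => Matrix.toEuclideanLin (bitMatrix R a)) u) ≤ n * s := by
  rw [meanSum_bitMatrix hA hS, map_smul, LinearMap.smul_apply, inner_smul_right]
  exact mul_le_mul_of_nonneg_left (hs u hu) (Nat.cast_nonneg n)

lemma bitMatrix_upper_tail (hn : 1 ≤ n) (hA : ∀ k, Measurable (A k)) (hind : iIndepFun A μ)
    (hR : 0 < R) (hS : ∀ j l, n * S j l = ∑ k, ∫ ω, bitMatrix R (A k ω) j l ∂μ) (hs0 : 0 ≤ s)
    (hs : ∀ u : Vec d, ‖u‖ = 1 → inner ℝ u (Matrix.toEuclideanLin S u) ≤ s) {t : ℝ} (ht : 0 ≤ t) :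
    μ.real {ω | ∃ u : Vec d, t * ‖u‖ ^ 2 < inner ℝ u (Matrix.toEuclideanLin
        (∑ k, bitMatrix R (A k ω) - (n : ℝ) • S) u)} ≤
      d * Real.exp (-(t ^ 2 / (2 * (n * (2 * (d * R ^ 2) * s + 2 * ((d + 1) * R ^ 4)) +
        d * R ^ 2 * t)))) := by
  classical
  have h := upper_tail (p := fun k a => μ.real (A k ⁻¹' {a})) (fun k a => measureReal_nonneg)
    (fun k => sum_measureReal_preimage_eq_one (hA k)) (by positivity)
    (selfBounded_bitMatrix hR) (mean_bound hA hS hs)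
    (by have : (1 : ℝ) ≤ n := by exact_mod_cast hn
        positivity) ht
  simp only [meanSum_bitMatrix hA hS, centredSum_bitMatrix, finrank_euclideanSpace,
    Fintype.card_fin] at h
  rw [measureReal_eq_sum_prod hA hind fun σ => ∃ u : Vec d, t * ‖u‖ ^ 2 <
    inner ℝ u (Matrix.toEuclideanLin (∑ k, bitMatrix R (σ k) - (n : ℝ) • S) u)]
  exact h

lemma bitMatrix_lower_tail (hn : 1 ≤ n) (hA : ∀ k, Measurable (A k)) (hind : iIndepFun A μ)
    (hR : 0 < R) (hS : ∀ j l, n * S j l = ∑ k, ∫ ω, bitMatrix R (A k ω) j l ∂μ) (hs0 : 0 ≤ s)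
    (hs : ∀ u : Vec d, ‖u‖ = 1 → inner ℝ u (Matrix.toEuclideanLin S u) ≤ s) {t : ℝ} (ht : 0 ≤ t) :
    μ.real {ω | ∃ u : Vec d, t * ‖u‖ ^ 2 < -inner ℝ u (Matrix.toEuclideanLin
        (∑ k, bitMatrix R (A k ω) - (n : ℝ) • S) u)} ≤
      d * Real.exp (-(t ^ 2 / (2 * (n * (2 * (d * R ^ 2) * s + 2 * ((d + 1) * R ^ 4)))))) := by
  classical
  have h := lower_tail (p := fun k a => μ.real (A k ⁻¹' {a})) (fun k a => measureReal_nonneg)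
    (fun k => sum_measureReal_preimage_eq_one (hA k)) (by positivity)
    (selfBounded_bitMatrix hR) (mean_bound hA hS hs)
    (by have : (1 : ℝ) ≤ n := by exact_mod_cast hn
        positivity) ht
  simp only [meanSum_bitMatrix hA hS, centredSum_bitMatrix, finrank_euclideanSpace,
    Fintype.card_fin] at h
  rw [measureReal_eq_sum_prod hA hind fun σ => ∃ u : Vec d, t * ‖u‖ ^ 2 <
    -inner ℝ u (Matrix.toEuclideanLin (∑ k, bitMatrix R (σ k) - (n : ℝ) • S) u)]
  exact h

end BitMatrix

/-! ### Expectations of dithered quantizations -/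

/-- The law of a normalized dither. -/
noncomputable def ditherLaw : Measure ℝ := volume.restrict (Set.Ioo (-(1 / 2)) (1 / 2))

instance : IsProbabilityMeasure ditherLaw :=
  ⟨by simp [ditherLaw]; norm_num⟩

lemma measurable_upBit (ℓ u : ℝ) : Measurable fun p : ℝ × ℝ => upBit ℓ u p.1 p.2 := by
  refine measurable_to_bool ?_
  have : (fun p : ℝ × ℝ => upBit ℓ u p.1 p.2) ⁻¹' {true} =
      {p | |p.1 + (u - ℓ) * p.2 - u| ≤ |p.1 + (u - ℓ) * p.2 - ℓ|} := by
    ext p; simp [upBit]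
  rw [this]
  exact measurableSet_le (by fun_prop) (by fun_prop)

lemma measurable_quantize (ℓ u : ℝ) : Measurable fun p : ℝ × ℝ => quantize ℓ u p.1 p.2 := by
  simp only [quantize_eq_ite]
  exact Measurable.ite (measurable_upBit ℓ u (measurableSet_singleton true)) measurable_const
    measurable_const

lemma abs_quantize_le (ℓ u z w : ℝ) : |quantize ℓ u z w| ≤ max |ℓ| |u| := by
  rw [quantize_eq_ite]; split_ifs <;> simp

lemma quantize_neg_mem (r z w : ℝ) : quantize (-r) r z w = r ∨ quantize (-r) r z w = -r := by
  rw [quantize_eq_ite]; split_ifs <;> simp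

/-- Dithering makes the quantizer unbiased. -/
lemma integral_quantize {ℓ u z : ℝ} (h1 : ℓ ≤ z) (h2 : z ≤ u) :
    ∫ w, quantize ℓ u z w ∂ditherLaw = z := by
  rcases (h1.trans h2).eq_or_lt with h | h
  · have hz : z = ℓ := le_antisymm (h ▸ h2) h1
    subst h; subst hz
    have : ∀ w, quantize z z z w = z := fun w => by simp [quantize, nearest]
    simp [this]
  have hΔ : 0 < u - ℓ := sub_pos.2 h
  -- The quantizer rounds up exactly when the dither is at least `c`, an event of probability `1 / 2
  -- - c = (z - ℓ) / (u - ℓ)`. The bounds on `z` put `c` inside the support of the dither.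
  set c := ((ℓ + u) / 2 - z) / (u - ℓ) with hc
  have hc1 : -(1 / 2) ≤ c := by rw [hc, le_div_iff₀ hΔ]; linarith
  have hc2 : c ≤ 1 / 2 := by rw [hc, div_le_iff₀ hΔ]; linarith
  have hq : ∀ w, quantize ℓ u z w = ℓ + (Set.Ici c).indicator (fun _ => u - ℓ) w := by
    intro w
    have : |z + (u - ℓ) * w - u| ≤ |z + (u - ℓ) * w - ℓ| ↔ c ≤ w := by
      rw [← sq_le_sq, hc, div_le_iff₀ hΔ]
      constructor <;> intro hh <;> nlinarith
    simp only [quantize, nearest, this, Set.indicator_apply, Set.mem_Ici]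
    split_ifs <;> ring
  have hI : ditherLaw (Set.Ici c) = ENNReal.ofReal (1 / 2 - c) := by
    rw [ditherLaw, Measure.restrict_congr_set Ioo_ae_eq_Icc,
      Measure.restrict_apply measurableSet_Ici]
    have : Set.Ici c ∩ Set.Icc (-(1 / 2)) (1 / 2) = Set.Icc c (1 / 2) := by
      ext w
      simp only [Set.mem_inter_iff, Set.mem_Ici, Set.mem_Icc]
      constructor
      · rintro ⟨a, b, e⟩; exact ⟨a, e⟩
      · rintro ⟨a, e⟩; exact ⟨a, by linarith, e⟩
    rw [this, Real.volume_Icc]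
  simp only [hq]
  rw [integral_add (integrable_const _) ((integrable_const _).indicator measurableSet_Ici),
    integral_indicator measurableSet_Ici]
  simp only [integral_const, probReal_univ, measureReal_restrict_apply_univ, smul_eq_mul, one_mul]
  rw [measureReal_def, hI, ENNReal.toReal_ofReal (by linarith), hc]
  field_simp
  ring

section Indep

variable {Ω : Type*} [MeasurableSpace Ω] {μ : Measure Ω} [IsProbabilityMeasure μ]

lemma integral_comp_of_indepFun {α β : Type*} [MeasurableSpace α] [MeasurableSpace β]
    {f : Ω → α} {g : Ω → β} (hf : Measurable f) (hg : Measurable g) (h : IndepFun f g μ)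
    {F : α × β → ℝ} (hF : Measurable F) {C : ℝ} (hC : ∀ q, |F q| ≤ C) :
    ∫ ω, F (f ω, g ω) ∂μ = ∫ ω, ∫ w, F (f ω, w) ∂(μ.map g) ∂μ := by
  have : IsProbabilityMeasure (μ.map f) := Measure.isProbabilityMeasure_map hf.aemeasurable
  have : IsProbabilityMeasure (μ.map g) := Measure.isProbabilityMeasure_map hg.aemeasurable
  rw [← integral_map (φ := fun ω => (f ω, g ω)) (hf.prodMk hg).aemeasurable
      hF.aestronglyMeasurable,
    (indepFun_iff_map_prod_eq_prod_map_map hf.aemeasurable hg.aemeasurable).1 h,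
    integral_prod _ (Integrable.of_bound hF.aestronglyMeasurable C (ae_of_all _ hC)),
    integral_map hf.aemeasurable
      hF.stronglyMeasurable.integral_prod_right'.aestronglyMeasurable]

lemma integral_quantize_of_indepFun {a V : Ω → ℝ} (ha : Measurable a) (hV : Measurable V)
    (hVlaw : μ.map V = ditherLaw) (h : IndepFun a V μ) {ℓ u : ℝ} (hl : ∀ᵐ ω ∂μ, ℓ ≤ a ω)
    (hu : ∀ᵐ ω ∂μ, a ω ≤ u) :
    ∫ ω, quantize ℓ u (a ω) (V ω) ∂μ = ∫ ω, a ω ∂μ := by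
  rw [integral_comp_of_indepFun ha hV h (measurable_quantize ℓ u)
    (fun q => abs_quantize_le ℓ u q.1 q.2), hVlaw]
  refine integral_congr_ae ?_
  filter_upwards [hl, hu] with ω h1 h2
  exact integral_quantize h1 h2

lemma integral_quantize_mul_of_indepFun {a b V W : Ω → ℝ} (ha : Measurable a) (hb : Measurable b)
    (hV : Measurable V) (hW : Measurable W) (hVlaw : μ.map V = ditherLaw)
    (hWlaw : μ.map W = ditherLaw) (hVW : IndepFun V W μ)
    (h : IndepFun (fun ω => (a ω, b ω)) (fun ω => (V ω, W ω)) μ) {R L : ℝ}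
    (hR : ∀ᵐ ω ∂μ, |a ω| ≤ R) (hL : ∀ᵐ ω ∂μ, |b ω| ≤ L) :
    ∫ ω, quantize (-R) R (a ω) (V ω) * quantize (-L) L (b ω) (W ω) ∂μ =
      ∫ ω, a ω * b ω ∂μ := by
  have hF : Measurable fun q : (ℝ × ℝ) × ℝ × ℝ =>
      quantize (-R) R q.1.1 q.2.1 * quantize (-L) L q.1.2 q.2.2 :=
    ((measurable_quantize (-R) R).comp ((measurable_fst.comp measurable_fst).prodMk
      (measurable_fst.comp measurable_snd))).mul
    ((measurable_quantize (-L) L).comp ((measurable_snd.comp measurable_fst).prodMk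
      (measurable_snd.comp measurable_snd)))
  have := integral_comp_of_indepFun (ha.prodMk hb) (hV.prodMk hW) h hF
    (C := max |-R| |R| * max |-L| |L|) (fun q => by
      rw [abs_mul]
      exact mul_le_mul (abs_quantize_le _ _ _ _) (abs_quantize_le _ _ _ _) (abs_nonneg _)
        (by positivity))
  refine this.trans ?_
  rw [(indepFun_iff_map_prod_eq_prod_map_map hV.aemeasurable hW.aemeasurable).1 hVW, hVlaw, hWlaw]
  refine integral_congr_ae ?_
  filter_upwards [hR, hL] with ω h1 h2
  rw [abs_le] at h1 h2
  refine (integral_prod_mul (μ := ditherLaw) (ν := ditherLaw)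
    (fun v => quantize (-R) R (a ω) v) (fun w => quantize (-L) L (b ω) w)).trans ?_
  rw [integral_quantize h1.1 h1.2, integral_quantize h2.1 h2.2]

variable {d : ℕ} {x : Ω → Vec d} {y : Ω → ℝ} {V : Channel d → Ω → ℝ} {R L : ℝ}

lemma measurable_coord (j : Fin d) : Measurable fun v : Vec d => v j := by fun_prop

/-- Off the diagonal the two factors use independent dithers, so unbiasedness multiplies. On the
diagonal the product would be the constant `R²`; the correction replaces it by the quantized square,
which is unbiased on `[0, R²]`. -/
lemma integral_bitMatrix (hx : Measurable x) (hV : ∀ c, Measurable (V c))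
    (hVlaw : ∀ c, μ.map (V c) = ditherLaw) (hVind : iIndepFun V μ)
    (hxV : IndepFun x (fun ω c => V c ω) μ) (hR : ∀ j, ∀ᵐ ω ∂μ, |x ω j| ≤ R) (j l : Fin d) :
    ∫ ω, bitMatrix R (sampleBits R (x ω) fun c => V c ω) j l ∂μ = ∫ ω, x ω j * x ω l ∂μ := by
  have hxm : ∀ j, Measurable fun ω => x ω j := fun j => (measurable_coord j).comp hx
  by_cases h : j = l
  · subst h
    have e : ∀ ω, bitMatrix R (sampleBits R (x ω) fun c => V c ω) j j =
        quantize 0 (R ^ 2) (x ω j ^ 2) (V (Sum.inr (Sum.inl j)) ω) := fun ω => by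
      rw [bitMatrix, bitX_sampleBits, bitSq_sampleBits]
      simp only [Matrix.add_apply, Matrix.vecMulVec_apply, Matrix.diagonal_apply_eq, quantSq]
      ring
    simp only [e]
    rw [integral_quantize_of_indepFun ((hxm j).pow_const 2) (hV _) (hVlaw _)
      (hxV.comp (φ := fun v : Vec d => v j ^ 2) (ψ := fun w => w (Sum.inr (Sum.inl j)))
        ((measurable_coord j).pow_const 2) (measurable_pi_apply _))
      (ae_of_all _ fun ω => sq_nonneg _)]
    · simp only [sq]
    · filter_upwards [hR j] with ω h1
      exact sq_le_sq' (abs_le.1 h1).1 (abs_le.1 h1).2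
  · have e : ∀ ω, bitMatrix R (sampleBits R (x ω) fun c => V c ω) j l =
        quantize (-R) R (x ω j) (V (Sum.inl j) ω) * quantize (-R) R (x ω l) (V (Sum.inl l) ω) :=
      fun ω => by
      rw [bitMatrix, bitX_sampleBits, bitSq_sampleBits]
      simp only [Matrix.add_apply, Matrix.vecMulVec_apply, Matrix.diagonal_apply_ne _ h, quantX,
        add_zero]
    simp only [e]
    have hne : (Sum.inl j : Channel d) ≠ Sum.inl l := by simpa using h
    have hi : IndepFun (fun ω => (x ω j, x ω l)) (fun ω => (V (Sum.inl j) ω, V (Sum.inl l) ω)) μ :=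
      hxV.comp (φ := fun v : Vec d => (v j, v l))
        (ψ := fun w : Channel d → ℝ => (w (Sum.inl j), w (Sum.inl l)))
        ((measurable_coord j).prodMk (measurable_coord l)) (by fun_prop)
    exact integral_quantize_mul_of_indepFun (hxm j) (hxm l) (hV _) (hV _) (hVlaw _) (hVlaw _)
      (hVind.indepFun hne) hi (hR j) (hR l)

lemma integral_quantX_mul_quantY (hx : Measurable x) (hy : Measurable y)
    (hV : ∀ c, Measurable (V c)) (hVlaw : ∀ c, μ.map (V c) = ditherLaw) (hVind : iIndepFun V μ)
    (hxyV : IndepFun (fun ω => (x ω, y ω)) (fun ω c => V c ω) μ)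
    (hR : ∀ j, ∀ᵐ ω ∂μ, |x ω j| ≤ R) (hL : ∀ᵐ ω ∂μ, |y ω| ≤ L) (j : Fin d) :
    ∫ ω, quantX R (x ω) (fun c => V c ω) j * quantY L (y ω) (fun c : Channel d => V c ω) ∂μ =
      ∫ ω, x ω j * y ω ∂μ := by
  have hne : (Sum.inl j : Channel d) ≠ Sum.inr (Sum.inr ()) := by simp
  have hi : IndepFun (fun ω => (x ω j, y ω))
      (fun ω => (V (Sum.inl j) ω, V (Sum.inr (Sum.inr ())) ω)) μ :=
    hxyV.comp (φ := fun p : Vec d × ℝ => (p.1 j, p.2))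
      (ψ := fun w : Channel d → ℝ => (w (Sum.inl j), w (Sum.inr (Sum.inr ()))))
      (by fun_prop) (by fun_prop)
  exact integral_quantize_mul_of_indepFun ((measurable_coord j).comp hx) hy (hV _) (hV _)
    (hVlaw _) (hVlaw _) (hVind.indepFun hne) hi (hR j) hL

lemma measurable_sampleBits (R : ℝ) :
    Measurable fun p : Vec d × (Channel d → ℝ) => sampleBits R p.1 p.2 := by
  refine measurable_pi_lambda _ fun j => Measurable.prodMk ?_ ?_
  · exact (measurable_upBit (-R) R).comp (f := fun p : Vec d × (Channel d → ℝ) =>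
      (p.1 j, p.2 (Sum.inl j))) (by fun_prop)
  · exact (measurable_upBit 0 (R ^ 2)).comp (f := fun p : Vec d × (Channel d → ℝ) =>
      (p.1 j ^ 2, p.2 (Sum.inr (Sum.inl j)))) (by fun_prop)

lemma measurable_quantX_mul_quantY (R L : ℝ) (j : Fin d) :
    Measurable fun p : (Vec d × ℝ) × (Channel d → ℝ) =>
      quantX R p.1.1 p.2 j * quantY L p.1.2 p.2 := by
  refine Measurable.mul ?_ ?_
  · exact (measurable_quantize (-R) R).comp (f := fun p : (Vec d × ℝ) × (Channel d → ℝ) =>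
      (p.1.1 j, p.2 (Sum.inl j))) (by fun_prop)
  · exact (measurable_quantize (-L) L).comp (f := fun p : (Vec d × ℝ) × (Channel d → ℝ) =>
      (p.1.2, p.2 (Sum.inr (Sum.inr ())))) (by fun_prop)

end Indep

/-! ### The estimator on a good event -/

section Estimator

variable {d : ℕ}

lemma toEuclideanLin_apply_ofLp (M : Matrix (Fin d) (Fin d) ℝ) (u : Vec d) :
    (Matrix.toEuclideanLin M u).ofLp = M.mulVec u.ofLp := by
  simp [Matrix.toLpLin_apply]

/-- A positive definite quadratic objective has a unique minimizer, which is close to every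
approximate solution of the normal equations. -/
lemma exists_minimizer_of_quadratic {M : Matrix (Fin d) (Fin d) ℝ} (hM : M.IsSymm) {ρ : ℝ}
    (hρ : 0 < ρ) (hpos : ∀ u : Vec d, ρ * ‖u‖ ^ 2 ≤ inner ℝ u (Matrix.toEuclideanLin M u))
    (g β : Vec d) {r : ℝ} (hr : ‖g - Matrix.toEuclideanLin M β‖ ≤ ρ * r) :
    ∃ b : Vec d, IsUniqueMinimizer
      (fun u : Vec d => (1 / 2) * (u.ofLp ⬝ᵥ M.mulVec u.ofLp) - u.ofLp ⬝ᵥ g.ofLp) b ∧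
      ‖b - β‖ ≤ r := by
  set T := Matrix.toEuclideanLin M with hT
  have hsymm : T.IsSymmetric := toEuclideanLin_isSymmetric hM
  have hinj : Function.Injective T := by
    rw [← LinearMap.ker_eq_bot, LinearMap.ker_eq_bot']
    intro u hu
    have h := hpos u
    rw [hu, inner_zero_right] at h
    have : ‖u‖ ^ 2 ≤ 0 := by
      by_contra! hc
      nlinarith
    simpa using this
  obtain ⟨b, hb⟩ := (LinearMap.injective_iff_surjective.1 hinj) g
  have hobj : ∀ u : Vec d, (1 / 2) * (u.ofLp ⬝ᵥ M.mulVec u.ofLp) - u.ofLp ⬝ᵥ g.ofLp =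
      (1 / 2) * inner ℝ u (T u) - inner ℝ u g := by
    intro u
    rw [← toEuclideanLin_apply_ofLp, inner_eq_sum, inner_eq_sum]
    rfl
  refine ⟨b, fun u hu => ?_, ?_⟩
  · simp only [hobj]
    -- The gap of the objective between `u` and the solution `b` of the normal equations is half the
    -- form at `u - b`.
    have hw := hpos (u - b)
    have hn : 0 < ‖u - b‖ := norm_pos_iff.2 (sub_ne_zero.2 hu)
    have h1 : 0 < inner ℝ (u - b) (T (u - b)) := lt_of_lt_of_le (by positivity) hw
    have h2 : inner ℝ b (T u) = inner ℝ u g := by rw [← hsymm, hb, real_inner_comm]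
    rw [map_sub, hb, inner_sub_left, inner_sub_right, inner_sub_right, h2] at h1
    rw [hb]
    linarith
  · have h1 := hpos (b - β)
    rw [map_sub, hb] at h1
    have h2 := (h1.trans (real_inner_le_norm _ _)).trans
      (mul_le_mul_of_nonneg_left hr (norm_nonneg _))
    -- The estimate `ρ ‖b - β‖² ≤ ‖b - β‖ ρ r` can only be divided by `‖b - β‖` when this is
    -- nonzero; otherwise `hr` supplies `0 ≤ r`.
    rcases (norm_nonneg (b - β)).eq_or_lt with h0 | h0
    · rw [← h0]
      have := (norm_nonneg _).trans hr
      nlinarith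
    · have h3 : (ρ * ‖b - β‖) * ‖b - β‖ ≤ (ρ * ‖b - β‖) * r := by linarith
      exact le_of_mul_le_mul_left h3 (by positivity)

lemma sigmaHat_isSymm {n : ℕ} (R : ℝ) (x : Fin n → Vec d) (w : Fin n → Channel d → ℝ) :
    (sigmaHat R x w).IsSymm := by
  rw [sigmaHat_eq, Matrix.IsSymm, Matrix.transpose_smul, Matrix.transpose_sum]
  simp only [(bitMatrix_transpose R _).eq]

lemma inner_toEuclideanLin_le_opNorm (M : Matrix (Fin d) (Fin d) ℝ) (u : Vec d) :
    inner ℝ u (Matrix.toEuclideanLin M u) ≤ opNorm M * ‖u‖ ^ 2 := by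
  have h1 : ‖Matrix.toEuclideanLin M u‖ ≤ opNorm M * ‖u‖ :=
    (Matrix.toEuclideanCLM (𝕜 := ℝ) M).le_opNorm u
  calc _ ≤ ‖u‖ * ‖Matrix.toEuclideanLin M u‖ := real_inner_le_norm _ _
    _ ≤ ‖u‖ * (opNorm M * ‖u‖) := by gcongr
    _ = _ := by ring

lemma opNorm_nonneg (M : Matrix (Fin d) (Fin d) ℝ) : 0 ≤ opNorm M := norm_nonneg _

/-- The vector form of `crossHat`. -/
noncomputable def crossVec {n : ℕ} (R L : ℝ) (x : Fin n → Vec d) (y : Fin n → ℝ)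
    (w : Fin n → Channel d → ℝ) : Vec d := WithLp.toLp 2 (crossHat R L x y w)

end Estimator

/-! ### Concentration for bounded independent samples -/

section Core

variable {Ω : Type*} [MeasurableSpace Ω] {μ : Measure Ω} [IsProbabilityMeasure μ] {n d : ℕ}

/-- Independent data with bounded predictors and responses, and independent dithers. -/
structure DitheredSample (μ : Measure Ω) (x : Fin n → Ω → Vec d) (y : Fin n → Ω → ℝ)
    (U : Fin n → Channel d → Ω → ℝ) (R L : ℝ) : Prop where
  measurable_x : ∀ i, Measurable (x i)
  measurable_y : ∀ i, Measurable (y i)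
  dither : IsDither μ U
  indep : iIndepFun (fun i ω => ((x i ω, y i ω), fun c => U i c ω)) μ
  indep_dither : ∀ i, IndepFun (fun ω => (x i ω, y i ω)) (fun ω c => U i c ω) μ
  bound_x : ∀ i j, ∀ᵐ ω ∂μ, |x i ω j| ≤ R
  bound_y : ∀ i, ∀ᵐ ω ∂μ, |y i ω| ≤ L

lemma logFactor_pos (hd : 1 ≤ d) (n : ℕ) : 0 < logFactor d n := by
  have : (1 : ℝ) ≤ d := by exact_mod_cast hd
  exact lt_max_of_lt_right (Real.log_pos (by linarith))

/-- One copy of the log factor pays for `2 d` by `log (2 d)`, the other yields `1 / n` by `log n`.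
All deviation levels are tuned to the exponent `2 * logFactor d n`. -/
lemma card_mul_exp_logFactor_le (hd : 1 ≤ d) (hn : 1 ≤ n) :
    2 * d * Real.exp (-(2 * logFactor d n)) ≤ 1 / n := by
  have hd' : (1 : ℝ) ≤ d := by exact_mod_cast hd
  have hn' : (1 : ℝ) ≤ n := by exact_mod_cast hn
  have h1 : Real.exp (-logFactor d n) ≤ 1 / n := by
    rw [Real.exp_neg, one_div]
    gcongr
    rw [← Real.log_le_iff_le_exp (by linarith)]
    exact le_max_left _ _
  have h2 : 2 * d * Real.exp (-logFactor d n) ≤ 1 := by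
    rw [Real.exp_neg, mul_inv_le_iff₀ (Real.exp_pos _), one_mul,
      ← Real.log_le_iff_le_exp (by linarith)]
    exact le_max_right _ _
  have h3 : Real.exp (-(2 * logFactor d n)) =
      Real.exp (-logFactor d n) * Real.exp (-logFactor d n) := by
    rw [← Real.exp_add]; congr 1; ring
  rw [h3, ← mul_assoc]
  calc _ ≤ 1 * (1 / (n : ℝ)) := by gcongr
    _ = _ := one_mul _

variable {x : Fin n → Ω → Vec d} {y : Fin n → Ω → ℝ} {U : Fin n → Channel d → Ω → ℝ} {R L : ℝ}

omit [IsProbabilityMeasure μ] in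
lemma DitheredSample.indep_channels (h : DitheredSample μ x y U R L) (i : Fin n) :
    iIndepFun (U i) μ :=
  h.dither.indep.precomp (g := fun c => (i, c)) fun a b hab => by simpa using hab

lemma two_sided_hoeffding {Z : Fin n → Ω → ℝ} (hZ : ∀ i, Measurable (Z i))
    (hind : iIndepFun Z μ)
    {b : ℝ} (hb : 0 < b) (hbound : ∀ i ω, Z i ω ∈ Set.Icc (-b) b) {s : ℝ} (hs : 0 ≤ s) :
    μ.real {ω | s < |∑ i, (Z i ω - ∫ ω', Z i ω' ∂μ)|} ≤
      2 * Real.exp (-(s ^ 2 / (2 * (n * b ^ 2)))) := by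
  have hsub : ∀ i, HasSubgaussianMGF (fun ω => Z i ω - ∫ ω', Z i ω' ∂μ) (b.toNNReal ^ 2) μ := by
    intro i
    have := hasSubgaussianMGF_of_mem_Icc (μ := μ) (hZ i).aemeasurable (ae_of_all _ (hbound i))
    convert this using 1
    ext
    push_cast
    rw [Real.coe_toNNReal _ hb.le, Real.norm_eq_abs, abs_of_pos (by linarith)]
    ring
  have hind' : iIndepFun (fun i ω => Z i ω - ∫ ω', Z i ω' ∂μ) μ :=
    hind.comp (fun i z => z - ∫ ω', Z i ω' ∂μ) fun i => measurable_id.sub_const _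
  have hindn : iIndepFun (fun i ω => -(Z i ω - ∫ ω', Z i ω' ∂μ)) μ :=
    hind.comp (fun i z => -(z - ∫ ω', Z i ω' ∂μ)) fun i => (measurable_id.sub_const _).neg
  have h1 := HasSubgaussianMGF.measure_sum_ge_le_of_iIndepFun hind' (s := Finset.univ)
    (fun i _ => hsub i) hs
  have h2 := HasSubgaussianMGF.measure_sum_ge_le_of_iIndepFun hindn (s := Finset.univ)
    (fun i _ => (hsub i).neg) hs
  have hc : ((∑ _i : Fin n, b.toNNReal ^ 2 : ℝ≥0) : ℝ) = n * b ^ 2 := by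
    simp [Real.coe_toNNReal _ hb.le]
  rw [hc, neg_div] at h1 h2
  have hsubset : {ω | s < |∑ i, (Z i ω - ∫ ω', Z i ω' ∂μ)|} ⊆
      {ω | s ≤ ∑ i, (Z i ω - ∫ ω', Z i ω' ∂μ)} ∪
        {ω | s ≤ ∑ i, -(Z i ω - ∫ ω', Z i ω' ∂μ)} := by
    intro ω hω
    rcases lt_abs.1 (Set.mem_ofPred_eq ▸ hω : s < |_|) with h | h
    · exact Or.inl h.le
    · refine Or.inr ?_
      rw [Set.mem_ofPred_eq, Finset.sum_neg_distrib]
      exact h.le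
  calc _ ≤ _ := measureReal_mono hsubset
    _ ≤ _ := measureReal_union_le _ _
    _ ≤ _ := by linarith

lemma crossHat_tail (h : DitheredSample μ x y U R L) (hd : 1 ≤ d) (hn : 1 ≤ n) (hR : 0 ≤ R)
    (hL : 0 ≤ L) {g : Vec d} (hg : ∀ j, n * g j = ∑ i, ∫ ω, x i ω j * y i ω ∂μ) :
    μ.real {ω | √(4 * d * R ^ 2 * L ^ 2 * logFactor d n / n) <
      ‖crossVec R L (fun i => x i ω) (fun i => y i ω) (fun i c => U i c ω) - g‖} ≤ 1 / n := by
  have hn' : (0 : ℝ) < n := by exact_mod_cast hn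
  have hℓ := logFactor_pos hd n
  set Z : Fin d → Fin n → Ω → ℝ := fun j i ω =>
    quantX R (x i ω) (fun c => U i c ω) j * quantY L (y i ω) (fun c : Channel d => U i c ω) with hZ
  have hZmeas : ∀ j i, Measurable (Z j i) := fun j i =>
    (measurable_quantX_mul_quantY R L j).comp (((h.measurable_x i).prodMk (h.measurable_y i)).prodMk
      (measurable_pi_lambda _ fun c => h.dither.measurable i c))
  have hZind : ∀ j, iIndepFun (Z j) μ := fun j =>
    h.indep.comp (fun _ p => quantX R p.1.1 p.2 j * quantY L p.1.2 p.2)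
      fun _ => measurable_quantX_mul_quantY R L j
  have hZint : ∀ j i, ∫ ω, Z j i ω ∂μ = ∫ ω, x i ω j * y i ω ∂μ := fun j i =>
    integral_quantX_mul_quantY (h.measurable_x i) (h.measurable_y i) (h.dither.measurable i)
      (h.dither.uniform i) (h.indep_channels i) (h.indep_dither i) (h.bound_x i) (h.bound_y i) j
  have hcoord : ∀ ω j, (crossVec R L (fun i => x i ω) (fun i => y i ω) (fun i c => U i c ω) - g) j =
      (1 / n) * ∑ i, (Z j i ω - ∫ ω', Z j i ω' ∂μ) := by
    intro ω j
    rw [Finset.sum_sub_distrib]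
    simp only [hZint]
    rw [← hg j, mul_sub, ← mul_assoc, one_div_mul_cancel hn'.ne', one_mul, PiLp.sub_apply]
    congr 1
    simp only [crossVec, crossHat, Pi.smul_apply, Finset.sum_apply, smul_eq_mul, hZ]
    simp only [mul_comm]
  have hZval : ∀ j i ω, Z j i ω = R * L ∨ Z j i ω = -(R * L) := by
    intro j i ω
    have h1 : quantX R (x i ω) (fun c => U i c ω) j = R ∨
        quantX R (x i ω) (fun c => U i c ω) j = -R := quantize_neg_mem _ _ _
    have h2 : quantY L (y i ω) (fun c : Channel d => U i c ω) = L ∨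
        quantY L (y i ω) (fun c : Channel d => U i c ω) = -L := quantize_neg_mem _ _ _
    simp only [hZ]
    rcases h1 with h1 | h1 <;> rcases h2 with h2 | h2 <;> rw [h1, h2] <;> simp
  have hsq : ∀ ω, ‖crossVec R L (fun i => x i ω) (fun i => y i ω) (fun i c => U i c ω) - g‖ ^ 2 =
      ∑ j, ((1 / n) * ∑ i, (Z j i ω - ∫ ω', Z j i ω' ∂μ)) ^ 2 := fun ω => by
    rw [norm_sq_eq_sum]; simp only [hcoord]
  have hb0 : 0 ≤ R * L := mul_nonneg hR hL
  -- If `R * L = 0` the summands vanish identically; Hoeffding is used only with a positive range.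
  rcases hb0.eq_or_lt with hb | hb
  · have hZ0 : ∀ j i ω, Z j i ω = 0 := fun j i ω => by
      rcases hZval j i ω with h1 | h1 <;> rw [h1, ← hb] <;> simp
    have : ∀ ω, ‖crossVec R L (fun i => x i ω) (fun i => y i ω) (fun i c => U i c ω) - g‖ = 0 := by
      intro ω
      have := hsq ω
      simpa [hZ0] using this
    simp only [this]
    have he : {ω : Ω | √(4 * d * R ^ 2 * L ^ 2 * logFactor d n / n) < (0 : ℝ)} = ∅ :=
      Set.eq_empty_of_forall_notMem fun ω hω => absurd hω (not_lt.2 (Real.sqrt_nonneg _))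
    rw [he]
    simp
  -- This level makes the Hoeffding exponent `s² / (2 n (R L)²)` equal to `2 * logFactor d n`.
  set s := 2 * (R * L) * √(n * logFactor d n) with hs
  have hs2 : s ^ 2 = 4 * (R * L) ^ 2 * (n * logFactor d n) := by
    rw [hs, mul_pow, Real.sq_sqrt (by positivity)]; ring
  have hsub : {ω | √(4 * d * R ^ 2 * L ^ 2 * logFactor d n / n) <
      ‖crossVec R L (fun i => x i ω) (fun i => y i ω) (fun i c => U i c ω) - g‖} ⊆
      ⋃ j ∈ (Finset.univ : Finset (Fin d)), {ω | s < |∑ i, (Z j i ω - ∫ ω', Z j i ω' ∂μ)|} := by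
    intro ω hω
    rw [Set.mem_ofPred_eq, Real.sqrt_lt' (lt_of_le_of_lt (Real.sqrt_nonneg _) hω), hsq] at hω
    by_contra hcon
    simp only [Finset.mem_univ, Set.iUnion_true, Set.mem_iUnion, Set.mem_ofPred_eq, not_exists,
      not_lt] at hcon
    refine absurd hω (not_lt.2 ?_)
    calc _ ≤ ∑ j : Fin d, 4 * (R * L) ^ 2 * logFactor d n / n := by
          refine Finset.sum_le_sum fun j _ => ?_
          have h1 : (∑ i, (Z j i ω - ∫ ω', Z j i ω' ∂μ)) ^ 2 ≤ s ^ 2 :=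
            sq_le_sq' (abs_le.1 (hcon j)).1 (abs_le.1 (hcon j)).2
          rw [mul_pow]
          calc _ ≤ (1 / (n : ℝ)) ^ 2 * s ^ 2 := by gcongr
            _ = _ := by rw [hs2]; field_simp
      _ = _ := by
          rw [Finset.sum_const, Finset.card_univ, Fintype.card_fin, nsmul_eq_mul]
          ring
  calc _ ≤ _ := measureReal_mono hsub (measure_ne_top _ _)
    _ ≤ _ := measureReal_biUnion_finset_le _ _
    _ ≤ ∑ j : Fin d, 2 * Real.exp (-(2 * logFactor d n)) := by
        refine Finset.sum_le_sum fun j _ => ?_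
        refine (two_sided_hoeffding (hZmeas j) (hZind j) hb (fun i ω => ?_)
          (by positivity)).trans (le_of_eq ?_)
        · rcases hZval j i ω with h1 | h1 <;> rw [h1] <;> constructor <;> linarith
        · rw [hs2]
          congr 3
          rw [div_eq_iff (by positivity)]
          ring
    _ = 2 * d * Real.exp (-(2 * logFactor d n)) := by
        rw [Finset.sum_const, Finset.card_univ, Fintype.card_fin, nsmul_eq_mul]
        ring
    _ ≤ _ := card_mul_exp_logFactor_le hd hn

lemma card_mul_exp_le {ℓ D V : ℝ} (hV : 0 < V) (h : 4 * ℓ * V ≤ D) :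
    d * Real.exp (-(D / (2 * V))) ≤ d * Real.exp (-(2 * ℓ)) := by
  gcongr
  rw [le_div_iff₀ (by positivity)]
  linarith

/-- Level `t` serves the norm error and level `r` the least eigenvalue. A single lower-tail event at
`min t r` serves both, so only two one-sided tails are paid, each `d exp(-2 ℓ)` with `ℓ = logFactor
d n`. The lower tail has no linear term, which is why the condition on `r` has none either. -/
lemma sigmaHat_tail (h : DitheredSample μ x y U R L) (hd : 1 ≤ d) (hn : 1 ≤ n) (hR : 0 < R)
    {S : Matrix (Fin d) (Fin d) ℝ} (hS : ∀ j l, n * S j l = ∑ i, ∫ ω, x i ω j * x i ω l ∂μ)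
    {s : ℝ} (hs0 : 0 ≤ s)
    (hs : ∀ u : Vec d, ‖u‖ = 1 → inner ℝ u (Matrix.toEuclideanLin S u) ≤ s) {t r : ℝ}
    (ht : 0 ≤ t) (hr : 0 ≤ r)
    (ht2 : 4 * logFactor d n * (n * (2 * (d * R ^ 2) * s + 2 * ((d + 1) * R ^ 4)) +
      d * R ^ 2 * t) ≤ t ^ 2)
    (hr2 : 4 * logFactor d n * (n * (2 * (d * R ^ 2) * s + 2 * ((d + 1) * R ^ 4))) ≤ r ^ 2) :
    μ.real {ω | ¬ ∀ u : Vec d,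
      -(min t r * ‖u‖ ^ 2) ≤ inner ℝ u (Matrix.toEuclideanLin
        ((n : ℝ) • sigmaHat R (fun i => x i ω) (fun i c => U i c ω) - (n : ℝ) • S) u) ∧
      inner ℝ u (Matrix.toEuclideanLin
        ((n : ℝ) • sigmaHat R (fun i => x i ω) (fun i c => U i c ω) - (n : ℝ) • S) u) ≤
          t * ‖u‖ ^ 2} ≤ 1 / n := by
  have hn' : (0 : ℝ) < n := by exact_mod_cast hn
  set A : Fin n → Ω → Fin d → Bool × Bool := fun i ω => sampleBits R (x i ω) fun c => U i c ω
  have hA : ∀ i, Measurable (A i) := fun i => (measurable_sampleBits R).comp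
    ((h.measurable_x i).prodMk (measurable_pi_lambda _ fun c => h.dither.measurable i c))
  have hind : iIndepFun A μ := h.indep.comp (fun _ p => sampleBits R p.1.1 p.2) fun _ =>
    (measurable_sampleBits R).comp ((measurable_fst.comp measurable_fst).prodMk measurable_snd)
  have hmean : ∀ j l, n * S j l = ∑ i, ∫ ω, bitMatrix R (A i ω) j l ∂μ := fun j l => by
    rw [hS]
    refine Finset.sum_congr rfl fun i _ => (integral_bitMatrix (h.measurable_x i)
      (h.dither.measurable i) (h.dither.uniform i) (h.indep_channels i) ?_ (h.bound_x i) j l).symm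
    exact (h.indep_dither i).comp measurable_fst measurable_id
  have hsig : ∀ ω, (n : ℝ) • sigmaHat R (fun i => x i ω) (fun i c => U i c ω) =
      ∑ i, bitMatrix R (A i ω) := fun ω => by
    rw [sigmaHat_eq, smul_smul, mul_one_div_cancel hn'.ne', one_smul]
  simp only [hsig]
  have hd' : (0 : ℝ) < d := by exact_mod_cast hd
  set v := n * (2 * (d * R ^ 2) * s + 2 * ((d + 1) * R ^ 4)) with hv
  have hvpos : 0 < v := by positivity
  have hℓ := logFactor_pos hd n
  have hup := bitMatrix_upper_tail hn hA hind hR hmean hs0 hs ht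
  have hlow := bitMatrix_lower_tail hn hA hind hR hmean hs0 hs (le_min ht hr)
  have hmin : 4 * logFactor d n * v ≤ min t r ^ 2 := by
    rcases min_choice t r with hm | hm <;> rw [hm]
    · refine le_trans ?_ ht2
      have : 0 ≤ d * R ^ 2 * t := by positivity
      gcongr
      linarith
    · exact hr2
  have hup' := hup.trans (card_mul_exp_le (d := d) (by positivity) ht2)
  have hlow' := hlow.trans (card_mul_exp_le (d := d) hvpos hmin)
  have hsub : {ω | ¬ ∀ u : Vec d,
      -(min t r * ‖u‖ ^ 2) ≤ inner ℝ u (Matrix.toEuclideanLin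
        (∑ i, bitMatrix R (A i ω) - (n : ℝ) • S) u) ∧
      inner ℝ u (Matrix.toEuclideanLin
        (∑ i, bitMatrix R (A i ω) - (n : ℝ) • S) u) ≤ t * ‖u‖ ^ 2} ⊆
      {ω | ∃ u : Vec d, min t r * ‖u‖ ^ 2 < -inner ℝ u (Matrix.toEuclideanLin
        (∑ k, bitMatrix R (A k ω) - (n : ℝ) • S) u)} ∪
      {ω | ∃ u : Vec d, t * ‖u‖ ^ 2 < inner ℝ u (Matrix.toEuclideanLin
        (∑ k, bitMatrix R (A k ω) - (n : ℝ) • S) u)} := by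
    intro ω hω
    simp only [Set.mem_ofPred_eq, not_forall, not_and_or, not_le] at hω
    obtain ⟨u, hu | hu⟩ := hω
    · exact Or.inl ⟨u, by linarith⟩
    · exact Or.inr ⟨u, hu⟩
  have hfin := card_mul_exp_logFactor_le (d := d) hd hn
  calc _ ≤ _ := measureReal_mono hsub
    _ ≤ _ := measureReal_union_le _ _
    _ ≤ _ := by linarith

/-- Simultaneous concentration of both plug-in estimators around the moments of the bounded
sample, with `S₀` fixing the scale of the bounds. -/
theorem plugIn_concentration (h : DitheredSample μ x y U R L) (hd : 1 ≤ d) (hn : 1 ≤ n)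
    (hR : 0 < R) (hL : 0 ≤ L) {S : Matrix (Fin d) (Fin d) ℝ}
    (hS : ∀ j l, n * S j l = ∑ i, ∫ ω, x i ω j * x i ω l ∂μ) {g : Vec d}
    (hg : ∀ j, n * g j = ∑ i, ∫ ω, x i ω j * y i ω ∂μ) {S₀ : Matrix (Fin d) (Fin d) ℝ}
    (hS₀ : 0 < lambdaMin S₀)
    (hs : ∀ u : Vec d, inner ℝ u (Matrix.toEuclideanLin S u) ≤ opNorm S₀ * ‖u‖ ^ 2)
    (hsample : sampleBound S₀ n R ≤ n) (β : Vec d) :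
    1 - 2 / (n : ℝ) ≤ μ.real {ω |
      (∀ u : Vec d, inner ℝ u (Matrix.toEuclideanLin S u) - lambdaMin S₀ / 2 * ‖u‖ ^ 2 ≤
        inner ℝ u (Matrix.toEuclideanLin
          (sigmaHat R (fun i => x i ω) (fun i c => U i c ω)) u)) ∧
      ‖Matrix.toEuclideanLin (sigmaHat R (fun i => x i ω) (fun i c => U i c ω) - S) β‖ ≤
        ‖β‖ * √((32 * d * R ^ 4 + 8 * d * R ^ 2 * opNorm S₀) * logFactor d n / n) +
          ‖β‖ * (8 * (2 * d + 1) * R ^ 2 * logFactor d n / n) ∧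
      ‖crossVec R L (fun i => x i ω) (fun i => y i ω) (fun i c => U i c ω) - g‖ ≤
        √(4 * d * R ^ 2 * L ^ 2 * logFactor d n / n)} := by
  have hn' : (0 : ℝ) < n := by exact_mod_cast hn
  have hd1 : (1 : ℝ) ≤ d := by exact_mod_cast hd
  have hℓ := logFactor_pos hd n
  have hs0 := opNorm_nonneg S₀
  set ℓ := logFactor d n
  set lam := lambdaMin S₀
  set s := opNorm S₀
  set α := √((32 * d * R ^ 4 + 8 * d * R ^ 2 * s) * ℓ / n) with hα
  set b := 8 * (2 * d + 1) * R ^ 2 with hb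
  set t := n * (α + b * ℓ / n) with htdef
  have hb0 : 0 ≤ b := by positivity
  have hα0 : 0 ≤ α := Real.sqrt_nonneg _
  have hα2 : n * α ^ 2 = (32 * d * R ^ 4 + 8 * d * R ^ 2 * s) * ℓ := by
    rw [hα, Real.sq_sqrt (by positivity)]; field_simp
  have ht0 : 0 ≤ t := by positivity
  have htexp : t = n * α + b * ℓ := by rw [htdef]; field_simp
  have hR4 : 0 < R ^ 4 := by positivity
  -- With `t = n α + b ℓ` one has `t² ≥ (n α)² + b ℓ t`: the first part pays for the variance, the
  -- second for the linear Bernstein term, since `b ≥ 4 d R²`.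
  have ht2 : 4 * ℓ * (n * (2 * (d * R ^ 2) * s + 2 * ((d + 1) * R ^ 4)) + d * R ^ 2 * t) ≤
      t ^ 2 := by
    have h1 : t ^ 2 ≥ n * ((32 * d * R ^ 4 + 8 * d * R ^ 2 * s) * ℓ) + b * ℓ * t := by
      have : t ^ 2 = n * α * t + b * ℓ * t := by nth_rw 1 [sq, htexp]; ring
      rw [this, ← hα2]
      have : n * α * (n * α) ≤ n * α * t := by
        gcongr
        rw [htexp]
        have : 0 ≤ b * ℓ := by positivity
        linarith
      linarith
    have h2 : 4 * ℓ * (d * R ^ 2 * t) ≤ b * ℓ * t := by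
      have : 4 * (d * R ^ 2) ≤ b := by rw [hb]; nlinarith [sq_nonneg R]
      have := mul_le_mul_of_nonneg_right this (mul_nonneg hℓ.le ht0)
      linarith
    have h3 : 4 * ℓ * (n * (2 * (d * R ^ 2) * s + 2 * ((d + 1) * R ^ 4))) ≤
        n * ((32 * d * R ^ 4 + 8 * d * R ^ 2 * s) * ℓ) := by
      have h4 : 8 * ((d + 1) * R ^ 4) ≤ 32 * d * R ^ 4 := by nlinarith
      have := mul_le_mul_of_nonneg_right h4 (mul_nonneg hn'.le hℓ.le)
      linarith
    linarith
  -- The first entry of the maximum in `sampleBound` is what allows the deviation `n λ_min / 2`.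
  have hr2 : 4 * ℓ * (n * (2 * (d * R ^ 2) * s + 2 * ((d + 1) * R ^ 4))) ≤
      (n * (lam / 2)) ^ 2 := by
    have h1 : (512 * d * R ^ 4 + 128 * d * R ^ 2 * s) / lam ^ 2 * ℓ ≤ n :=
      (mul_le_mul_of_nonneg_right (le_max_left _ _) hℓ.le).trans hsample
    rw [div_mul_eq_mul_div, div_le_iff₀ (by positivity)] at h1
    have h2 := mul_le_mul_of_nonneg_left h1 hn'.le
    have h3 : 0 ≤ d * R ^ 2 * s := by positivity
    have h4 : 16 * (2 * (d * R ^ 2) * s + 2 * ((d + 1) * R ^ 4)) ≤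
        512 * d * R ^ 4 + 128 * d * R ^ 2 * s := by nlinarith
    have := mul_le_mul_of_nonneg_right h4 (mul_nonneg hn'.le hℓ.le)
    linarith
  have hT1 := sigmaHat_tail h hd hn hR hS hs0
    (fun u hu => by simpa [hu] using hs u) ht0 (by positivity) ht2 hr2
  have hT2 := crossHat_tail h hd hn hR.le hL hg
  set B1 := {ω | ¬ ∀ u : Vec d,
      -(min t (n * (lam / 2)) * ‖u‖ ^ 2) ≤ inner ℝ u (Matrix.toEuclideanLin
        ((n : ℝ) • sigmaHat R (fun i => x i ω) (fun i c => U i c ω) - (n : ℝ) • S) u) ∧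
      inner ℝ u (Matrix.toEuclideanLin
        ((n : ℝ) • sigmaHat R (fun i => x i ω) (fun i c => U i c ω) - (n : ℝ) • S) u) ≤
          t * ‖u‖ ^ 2}
  set B2 := {ω | √(4 * d * R ^ 2 * L ^ 2 * ℓ / n) <
      ‖crossVec R L (fun i => x i ω) (fun i => y i ω) (fun i c => U i c ω) - g‖}
  have hcover : (B1 ∪ B2)ᶜ ⊆ {ω |
      (∀ u : Vec d, inner ℝ u (Matrix.toEuclideanLin S u) - lam / 2 * ‖u‖ ^ 2 ≤
        inner ℝ u (Matrix.toEuclideanLin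
          (sigmaHat R (fun i => x i ω) (fun i c => U i c ω)) u)) ∧
      ‖Matrix.toEuclideanLin (sigmaHat R (fun i => x i ω) (fun i c => U i c ω) - S) β‖ ≤
        ‖β‖ * α + ‖β‖ * (b * ℓ / n) ∧
      ‖crossVec R L (fun i => x i ω) (fun i => y i ω) (fun i c => U i c ω) - g‖ ≤
        √(4 * d * R ^ 2 * L ^ 2 * ℓ / n)} := by
    intro ω hω
    simp only [Set.mem_compl_iff, Set.mem_union, not_or, B1, B2, Set.mem_ofPred_eq, not_not,
      not_lt] at hω
    obtain ⟨h1, h2⟩ := hω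
    have heq : ∀ u : Vec d, Matrix.toEuclideanLin
        ((n : ℝ) • sigmaHat R (fun i => x i ω) (fun i c => U i c ω) - (n : ℝ) • S) u =
        (n : ℝ) • Matrix.toEuclideanLin
          (sigmaHat R (fun i => x i ω) (fun i c => U i c ω) - S) u := fun u => by
      rw [← smul_sub, map_smul, LinearMap.smul_apply]
    simp only [heq, inner_smul_right] at h1
    refine ⟨fun u => ?_, ?_, h2⟩
    · have h3 := (h1 u).1
      have h4 : min t (n * (lam / 2)) * ‖u‖ ^ 2 ≤ n * (lam / 2 * ‖u‖ ^ 2) := by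
        calc _ ≤ n * (lam / 2) * ‖u‖ ^ 2 := by gcongr; exact min_le_right _ _
          _ = _ := by ring
      have h5 : n * -(lam / 2 * ‖u‖ ^ 2) ≤ n * inner ℝ u (Matrix.toEuclideanLin
          (sigmaHat R (fun i => x i ω) (fun i c => U i c ω) - S) u) := by linarith
      have h6 := le_of_mul_le_mul_left h5 hn'
      rw [map_sub, LinearMap.sub_apply, inner_sub_right] at h6
      linarith
    · have hsymS : S.IsSymm := Matrix.IsSymm.ext fun j l => by
        have h3 : n * S l j = n * S j l := by rw [hS, hS]; simp only [mul_comm]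
        exact mul_left_cancel₀ hn'.ne' h3
      have hsym := toEuclideanLin_isSymmetric
        ((sigmaHat_isSymm R (fun i => x i ω) (fun i c => U i c ω)).sub hsymS)
      have h3 := norm_apply_le_of_abs_inner_le hsym (t := α + b * ℓ / n) (by positivity)
        (fun u => ?_) β
      · linarith
      · rw [abs_le]
        obtain ⟨h4, h5⟩ := h1 u
        constructor
        · have h6 : n * -((α + b * ℓ / n) * ‖u‖ ^ 2) ≤ n * inner ℝ u (Matrix.toEuclideanLin
              (sigmaHat R (fun i => x i ω) (fun i c => U i c ω) - S) u) := by
            have : min t (n * (lam / 2)) * ‖u‖ ^ 2 ≤ t * ‖u‖ ^ 2 := by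
              gcongr; exact min_le_left _ _
            rw [htdef] at this h4
            linarith
          exact le_of_mul_le_mul_left h6 hn'
        · refine le_of_mul_le_mul_left ?_ hn'
          rw [htdef] at h5
          linarith
  have h1 : μ.real (B1 ∪ B2) ≤ 2 / n := by
    refine (measureReal_union_le _ _).trans ?_
    have : (2 : ℝ) / n = 1 / n + 1 / n := by ring
    linarith
  have h2 : 1 ≤ μ.real (B1 ∪ B2) + μ.real (B1 ∪ B2)ᶜ := by
    have := measureReal_union_le (μ := μ) (B1 ∪ B2) (B1 ∪ B2)ᶜ
    rwa [Set.union_compl_self, probReal_univ] at this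
  have h3 := measureReal_mono (μ := μ) hcover
  linarith

end Core

/-! ### Independence of samples -/

section Independence

variable {Ω : Type*} [MeasurableSpace Ω] {μ : Measure Ω} [IsProbabilityMeasure μ]

/-- The joint law of two independent families, each with independent members, is a product of two
product measures; reshuffling it into a product of pairs is a measure-preserving equivalence. -/
lemma iIndepFun_prodMk {ι α β : Type*} [Fintype ι] [MeasurableSpace α] [MeasurableSpace β]
    {f : ι → Ω → α} {g : ι → Ω → β} (hf : ∀ i, Measurable (f i)) (hg : ∀ i, Measurable (g i))
    (hfi : iIndepFun f μ) (hgi : iIndepFun g μ)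
    (hfg : IndepFun (fun ω i => f i ω) (fun ω i => g i ω) μ) :
    iIndepFun (fun i ω => (f i ω, g i ω)) μ := by
  have hfm : Measurable fun ω i => f i ω := measurable_pi_lambda _ hf
  have hgm : Measurable fun ω i => g i ω := measurable_pi_lambda _ hg
  have hfp : ∀ i, IsProbabilityMeasure (μ.map (f i)) := fun i =>
    Measure.isProbabilityMeasure_map (hf i).aemeasurable
  have hgp : ∀ i, IsProbabilityMeasure (μ.map (g i)) := fun i =>
    Measure.isProbabilityMeasure_map (hg i).aemeasurable
  have hpair : ∀ i, μ.map (fun ω => (f i ω, g i ω)) = (μ.map (f i)).prod (μ.map (g i)) := fun i =>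
    (indepFun_iff_map_prod_eq_prod_map_map (hf i).aemeasurable (hg i).aemeasurable).1
      (hfg.comp (measurable_pi_apply i) (measurable_pi_apply i))
  rw [iIndepFun_iff_map_fun_eq_pi_map fun i => ((hf i).prodMk (hg i)).aemeasurable]
  have h1 := (measurePreserving_arrowProdEquivProdArrow α β ι (fun i => μ.map (f i))
    fun i => μ.map (g i)).map_eq
  refine (MeasurableEquiv.arrowProdEquivProdArrow α β ι).map_measurableEquiv_injective ?_
  simp only [hpair]
  rw [h1, Measure.map_map (MeasurableEquiv.measurable _)
    (measurable_pi_lambda _ fun i => (hf i).prodMk (hg i)),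
    ← (iIndepFun_iff_map_fun_eq_pi_map fun i => (hf i).aemeasurable).1 hfi,
    ← (iIndepFun_iff_map_fun_eq_pi_map fun i => (hg i).aemeasurable).1 hgi,
    ← (indepFun_iff_map_prod_eq_prod_map_map hfm.aemeasurable hgm.aemeasurable).1 hfg]
  rfl

lemma iIndepFun_curry {ι κ α : Type*} [Finite ι] [Finite κ] [MeasurableSpace α]
    {f : ι → κ → Ω → α} (hf : ∀ i k, Measurable (f i k))
    (h : iIndepFun (fun (p : ι × κ) => f p.1 p.2) μ) :
    iIndepFun (fun i ω k => f i k ω) μ := by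
  have hprob : ∀ i k, IsProbabilityMeasure (μ.map (f i k)) := fun i k =>
    Measure.isProbabilityMeasure_map (hf i k).aemeasurable
  have hrow : ∀ i, iIndepFun (f i) μ := fun i =>
    h.precomp (g := fun k => (i, k)) fun a b hab => by simpa using hab
  have hs : iIndepFun (fun (p : (_ : ι) × κ) => f p.1 p.2) μ :=
    h.precomp (g := fun p : (_ : ι) × κ => (p.1, p.2)) (Equiv.sigmaEquivProd ι κ).injective
  rw [iIndepFun_iff_map_fun_eq_infinitePi_map fun i => measurable_pi_lambda _ (hf i)]
  have h1 := (iIndepFun_iff_map_fun_eq_infinitePi_map fun p : (_ : ι) × κ => hf p.1 p.2).1 hs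
  have h2 := congrArg (Measure.map (MeasurableEquiv.piCurry fun (_ : ι) (_ : κ) => α)) h1
  rw [Measure.infinitePi_map_piCurry (fun i k => μ.map (f i k)),
    Measure.map_map (MeasurableEquiv.measurable _)
      (measurable_pi_lambda _ fun p : (_ : ι) × κ => hf p.1 p.2)] at h2
  have h3 : ∀ i, Measure.infinitePi (fun k => μ.map (f i k)) = μ.map fun ω k => f i k ω :=
    fun i => ((iIndepFun_iff_map_fun_eq_infinitePi_map (hf i)).1 (hrow i)).symm
  simp only [h3] at h2
  exact h2

omit [IsProbabilityMeasure μ] in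
lemma IsIID.integral_comp {α : Type*} [MeasurableSpace α] {n : ℕ} {Z : Fin n → Ω → α}
    {P : Measure α} (h : IsIID μ Z P) (i : Fin n) {f : α → ℝ} (hf : Measurable f) :
    ∫ ω, f (Z i ω) ∂μ = ∫ z, f z ∂P := by
  rw [← h.law i, integral_map (h.measurable i).aemeasurable hf.aestronglyMeasurable]

variable {n d : ℕ} {P : Measure (Vec d)} {ν : Measure ℝ} {X : Fin n → Ω → Vec d}
  {ε : Fin n → Ω → ℝ} {U : Fin n → Channel d → Ω → ℝ}

omit [IsProbabilityMeasure μ] in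
lemma RandomDesign.indepFun_sample (h : RandomDesign μ P ν X ε U) (i : Fin n) :
    IndepFun (X i) (ε i) μ :=
  h.indep_errors.comp (measurable_pi_apply i) (measurable_pi_apply i)

lemma RandomDesign.iIndepFun_sample (h : RandomDesign μ P ν X ε U) :
    iIndepFun (fun i ω => ((X i ω, ε i ω), fun c => U i c ω)) μ := by
  have hm : Measurable fun p : (Fin n → Vec d) × (Fin n → ℝ) => fun i => (p.1 i, p.2 i) := by
    fun_prop
  exact iIndepFun_prodMk (fun i => (h.predictors.measurable i).prodMk (h.errors.measurable i))
    (fun i => measurable_pi_lambda _ (h.dither.measurable i))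
    (iIndepFun_prodMk h.predictors.measurable h.errors.measurable h.predictors.indep
      h.errors.indep h.indep_errors)
    (iIndepFun_curry h.dither.measurable h.dither.indep)
    (h.indep_dither.comp hm measurable_id)

/-- Measurable functions of the samples of a random design form a dithered sample. -/
lemma RandomDesign.ditheredSample (h : RandomDesign μ P ν X ε U) {φ : Vec d × ℝ → Vec d}
    {ψ : Vec d × ℝ → ℝ} (hφ : Measurable φ) (hψ : Measurable ψ) {R L : ℝ}
    (hR : ∀ i j, ∀ᵐ ω ∂μ, |φ (X i ω, ε i ω) j| ≤ R)
    (hL : ∀ i, ∀ᵐ ω ∂μ, |ψ (X i ω, ε i ω)| ≤ L) :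
    DitheredSample μ (fun i ω => φ (X i ω, ε i ω)) (fun i ω => ψ (X i ω, ε i ω)) U R L where
  measurable_x i := hφ.comp ((h.predictors.measurable i).prodMk (h.errors.measurable i))
  measurable_y i := hψ.comp ((h.predictors.measurable i).prodMk (h.errors.measurable i))
  dither := h.dither
  indep := h.iIndepFun_sample.comp (fun _ p => ((φ p.1, ψ p.1), p.2)) fun _ => by fun_prop
  indep_dither i := h.indep_dither.comp
    (φ := fun p : (Fin n → Vec d) × (Fin n → ℝ) => (φ (p.1 i, p.2 i), ψ (p.1 i, p.2 i)))
    (by fun_prop) (measurable_pi_apply i)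
  bound_x := hR
  bound_y := hL

lemma measurable_response (β : Vec d) (σ : ℝ) :
    Measurable fun p : Vec d × ℝ => response β σ p.1 p.2 := by
  unfold response; fun_prop

lemma FixedDesign.ditheredSample (h : FixedDesign μ ν ε U) {x : Fin n → Vec d} {β : Vec d}
    {σ R L : ℝ} (hR : ∀ i j, |x i j| ≤ R)
    (hL : ∀ i, ∀ᵐ ω ∂μ, |response β σ (x i) (ε i ω)| ≤ L) :
    DitheredSample μ (fun i _ => x i) (fun i ω => response β σ (x i) (ε i ω)) U R L := by
  have hψ : ∀ i, Measurable fun e => response β σ (x i) e := fun i =>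
    (measurable_response β σ).comp (measurable_const.prodMk measurable_id)
  exact
  { measurable_x := fun i => measurable_const
    measurable_y := fun i => (hψ i).comp (h.errors.measurable i)
    dither := h.dither
    indep := (iIndepFun_prodMk h.errors.measurable
      (fun i => measurable_pi_lambda _ (h.dither.measurable i)) h.errors.indep
      (iIndepFun_curry h.dither.measurable h.dither.indep) h.indep_dither).comp
        (fun i p => ((x i, response β σ (x i) p.1), p.2))
        fun i => (measurable_const.prodMk ((hψ i).comp measurable_fst)).prodMk measurable_snd
    indep_dither := fun i => h.indep_dither.comp
      (φ := fun e : Fin n → ℝ => (x i, response β σ (x i) (e i)))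
      (measurable_const.prodMk ((hψ i).comp (measurable_pi_apply i))) (measurable_pi_apply i)
    bound_x := fun i j => ae_of_all _ fun _ => hR i j
    bound_y := hL }

end Independence

/-! ### Eigenvalues and moments -/

section Moments

variable {d : ℕ}

lemma lambdaMin_mul_le_inner {M : Matrix (Fin d) (Fin d) ℝ} (hM : M.IsSymm) (u : Vec d) :
    lambdaMin M * ‖u‖ ^ 2 ≤ inner ℝ u (Matrix.toEuclideanLin M u) := by
  have hT := toEuclideanLin_isSymmetric hM
  have hH : M.IsHermitian := by
    rw [Matrix.IsHermitian, Matrix.conjTranspose_eq_transpose_of_trivial]; exact hM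
  -- `lambdaMin` is a real `sInf`, which bounds elements from below only for a set that is bounded
  -- below; here the spectrum is finite.
  have hbdd : BddBelow (spectrum ℝ M) := by
    rw [hH.spectrum_real_eq_range_eigenvalues]
    exact (Set.finite_range _).bddBelow
  rw [inner_apply_eq_sum_eigenvalues hT, ← (hT.eigenvectorBasis rfl).sum_sq_inner_right u,
    Finset.mul_sum]
  refine Finset.sum_le_sum fun i _ => mul_le_mul_of_nonneg_right ?_ (sq_nonneg _)
  refine csInf_le hbdd ?_
  rw [← Matrix.spectrum_toLpLin 2]
  exact (hT.hasEigenvalue_eigenvalues rfl i).mem_spectrum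

lemma lambdaMin_le_diag {M : Matrix (Fin d) (Fin d) ℝ} (hM : M.IsSymm) (j : Fin d) :
    lambdaMin M ≤ M j j := by
  have h := lambdaMin_mul_le_inner hM (EuclideanSpace.single j 1)
  rw [inner_eq_sum] at h
  simpa [toEuclideanLin_apply_apply] using h

lemma secondMoment_isSymm (P : Measure (Vec d)) : (secondMoment P).IsSymm :=
  Matrix.IsSymm.ext fun j l => by simp only [secondMoment, Matrix.of_apply, mul_comm]

lemma empiricalSecondMoment_isSymm {n : ℕ} (x : Fin n → Vec d) :
    (empiricalSecondMoment x).IsSymm :=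
  Matrix.IsSymm.ext fun j l => by simp only [empiricalSecondMoment, Matrix.of_apply, mul_comm]

variable {Ω : Type*} [MeasurableSpace Ω] {μ : Measure Ω} [IsProbabilityMeasure μ]

omit [IsProbabilityMeasure μ] in
-- The Bochner integral of a non-integrable function is 0, so unit variance already contains square
-- integrability.
lemma integrable_of_integral_sq_eq_one {Z : Ω → ℝ} (hZ : Measurable Z)
    (h : ∫ ω, Z ω ^ 2 ∂μ = 1) : MemLp Z 2 μ :=
  (memLp_two_iff_integrable_sq hZ.aestronglyMeasurable).2
    (Integrable.of_integral_ne_zero (by rw [h]; exact one_ne_zero))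

omit [IsProbabilityMeasure μ] in
-- The noise part vanishes by independence and centring, leaving the population normal equations.
lemma integral_coord_mul_response {X : Ω → Vec d} {ε : Ω → ℝ} {β : Vec d} {σ : ℝ}
    (hX : ∀ j, MemLp (fun ω => X ω j) 2 μ) (hε : MemLp ε 2 μ) (hε0 : ∫ ω, ε ω ∂μ = 0)
    (hind : IndepFun X ε μ) (j : Fin d) :
    ∫ ω, X ω j * response β σ (X ω) (ε ω) ∂μ = ∑ k, (∫ ω, X ω j * X ω k ∂μ) * β k := by
  have hi : ∀ k, Integrable (fun ω => X ω j * X ω k) μ := fun k => (hX j).integrable_mul (hX k)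
  have hie : Integrable (fun ω => X ω j * ε ω) μ := (hX j).integrable_mul hε
  have h0 : ∫ ω, X ω j * ε ω ∂μ = 0 := by
    have := (hind.comp (measurable_coord j) measurable_id).integral_mul_eq_mul_integral
      (hX j).aestronglyMeasurable hε.aestronglyMeasurable
    refine this.trans ?_
    simp [hε0]
  have e : ∀ ω, X ω j * response β σ (X ω) (ε ω) =
      ∑ k, X ω j * X ω k * β k + σ * (X ω j * ε ω) := fun ω => by
    rw [response, inner_eq_sum, mul_add, Finset.mul_sum]
    congr 1
    · exact Finset.sum_congr rfl fun k _ => by ring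
    · ring
  simp only [e]
  rw [integral_add (integrable_finsetSum _ fun k _ => (hi k).mul_const _) (hie.const_mul σ),
    integral_finsetSum _ fun k _ => (hi k).mul_const _, integral_const_mul, h0]
  simp [integral_mul_const]

end Moments

/-! ### Bounded samples -/

section Bounded

variable {Ω : Type*} [MeasurableSpace Ω] {μ : Measure Ω} [IsProbabilityMeasure μ] {n d : ℕ}

omit [MeasurableSpace Ω] in
lemma mem_errorEvent {X : Fin n → Ω → Vec d} {ε : Fin n → Ω → ℝ}
    {U : Fin n → Channel d → Ω → ℝ} {β : Vec d} {σ R L ρ r : ℝ} {ω : Ω} (hρ : 0 < ρ)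
    (h1 : ∀ u : Vec d, ρ * ‖u‖ ^ 2 ≤ inner ℝ u (Matrix.toEuclideanLin
      (sigmaHat R (fun i => X i ω) fun i c => U i c ω) u))
    (h2 : ‖crossVec R L (fun i => X i ω) (fun i => response β σ (X i ω) (ε i ω))
      (fun i c => U i c ω) - Matrix.toEuclideanLin
      (sigmaHat R (fun i => X i ω) fun i c => U i c ω) β‖ ≤ ρ * r) :
    ω ∈ errorEvent R L β σ X ε U r :=
  exists_minimizer_of_quadratic (sigmaHat_isSymm _ _ _) hρ h1 _ _ h2

/-- On the good event the least eigenvalue of the estimator is at least `λ_min / 2`, and the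
residual at `β` is the cross-moment error minus `(M - S) β` for the plug-in matrix `M`. These are
the three terms of `err`, and `2 / λ_min` is the inverse of the eigenvalue bound. -/
theorem bounded_error_bound {X : Fin n → Ω → Vec d} {ε : Fin n → Ω → ℝ}
    {U : Fin n → Channel d → Ω → ℝ} {β : Vec d} {σ R L : ℝ} (hd : 1 ≤ d) (hn : 1 ≤ n)
    (h : DitheredSample μ X (fun i ω => response β σ (X i ω) (ε i ω)) U R L)
    {S : Matrix (Fin d) (Fin d) ℝ} (hSymm : S.IsSymm)
    (hS : ∀ j l, n * S j l = ∑ i, ∫ ω, X i ω j * X i ω l ∂μ)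
    (hind : ∀ i, IndepFun (X i) (ε i) μ) (hε : ∀ i, MemLp (ε i) 2 μ)
    (hε0 : ∀ i, ∫ ω, ε i ω ∂μ = 0) (hlam : 0 < lambdaMin S) (hsample : sampleBound S n R ≤ n) :
    1 - 2 / (n : ℝ) ≤ μ.real (errorEvent R L β σ X ε U (err S β n R L)) := by
  have hn' : (0 : ℝ) < n := by exact_mod_cast hn
  have hX2 : ∀ i j, MemLp (fun ω => X i ω j) 2 μ := fun i j =>
    MemLp.of_bound ((measurable_coord j).comp (h.measurable_x i)).aestronglyMeasurable R
      (by simpa using h.bound_x i j)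
  have hR0 : 0 ≤ R := by
    obtain ⟨ω, hω⟩ := (h.bound_x ⟨0, hn⟩ ⟨0, hd⟩).exists
    exact (abs_nonneg _).trans hω
  have hL0 : 0 ≤ L := by
    obtain ⟨ω, hω⟩ := (h.bound_y ⟨0, hn⟩).exists
    exact (abs_nonneg _).trans hω
  have hR : 0 < R := by
    refine hR0.lt_of_ne fun h0 => ?_
    have h1 : n * S ⟨0, hd⟩ ⟨0, hd⟩ = 0 := by
      rw [hS]
      refine Finset.sum_eq_zero fun i _ => ?_
      refine (integral_congr_ae ?_).trans (integral_zero _ _)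
      filter_upwards [h.bound_x i ⟨0, hd⟩] with ω hω
      rw [← h0, abs_nonpos_iff] at hω
      simp [hω]
    have h2 := lambdaMin_le_diag hSymm ⟨0, hd⟩
    have h3 : 0 < n * S ⟨0, hd⟩ ⟨0, hd⟩ := mul_pos hn' (hlam.trans_le h2)
    linarith
  have hg : ∀ j, n * (Matrix.toEuclideanLin S β) j =
      ∑ i, ∫ ω, X i ω j * response β σ (X i ω) (ε i ω) ∂μ := fun j => by
    simp only [integral_coord_mul_response (hX2 _) (hε _) (hε0 _) (hind _)]
    rw [toEuclideanLin_apply_apply, Finset.sum_comm, Finset.mul_sum]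
    refine Finset.sum_congr rfl fun k _ => ?_
    rw [← Finset.sum_mul, ← hS, mul_assoc]
  refine (plugIn_concentration h hd hn hR hL0 hS hg hlam
    (inner_toEuclideanLin_le_opNorm S) hsample β).trans (measureReal_mono ?_)
  rintro ω ⟨h1, h2, h3⟩
  refine mem_errorEvent (ρ := lambdaMin S / 2) (by positivity) (fun u => ?_) ?_
  · have := lambdaMin_mul_le_inner hSymm u
    linarith [h1 u]
  · have h4 : lambdaMin S / 2 * err S β n R L =
        ‖β‖ * √((32 * d * R ^ 4 + 8 * d * R ^ 2 * opNorm S) * logFactor d n / n) +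
      ‖β‖ * (8 * (2 * d + 1) * R ^ 2 * logFactor d n / n) +
      √(4 * d * R ^ 2 * L ^ 2 * logFactor d n / n) := by
      rw [err]; field_simp
    rw [h4]
    set M := sigmaHat R (fun i => X i ω) fun i c => U i c ω
    set q := crossVec R L (fun i => X i ω) (fun i => response β σ (X i ω) (ε i ω))
      (fun i c => U i c ω)
    have h5 : q - Matrix.toEuclideanLin M β =
        (q - Matrix.toEuclideanLin S β) - Matrix.toEuclideanLin (M - S) β := by
      rw [map_sub, LinearMap.sub_apply]; abel
    rw [h5]
    linarith [norm_sub_le (q - Matrix.toEuclideanLin S β) (Matrix.toEuclideanLin (M - S) β)]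

theorem random_bounded_error_bound {P : Measure (Vec d)} {ν : Measure ℝ} {X : Fin n → Ω → Vec d}
    {ε : Fin n → Ω → ℝ} {U : Fin n → Channel d → Ω → ℝ} {β : Vec d} {σ R L : ℝ} (hd : 1 ≤ d)
    (hn : 1 ≤ n) (h : RandomDesign μ P ν X ε U) (hν : IsStandardized ν)
    (hlam : 0 < lambdaMin (secondMoment P)) (hR : ∀ i j, ∀ᵐ ω ∂μ, |X i ω j| ≤ R)
    (hL : ∀ i, ∀ᵐ ω ∂μ, |response β σ (X i ω) (ε i ω)| ≤ L)
    (hsample : sampleBound (secondMoment P) n R ≤ n) :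
    1 - 2 / (n : ℝ) ≤ μ.real (errorEvent R L β σ X ε U (err (secondMoment P) β n R L)) := by
  have hmean : ∀ i, ∫ ω, ε i ω ∂μ = 0 := fun i =>
    (h.errors.integral_comp i measurable_id).trans hν.1
  have hvar : ∀ i, ∫ ω, ε i ω ^ 2 ∂μ = 1 := fun i =>
    (h.errors.integral_comp i (measurable_id.pow_const 2)).trans hν.2
  refine bounded_error_bound hd hn (h.ditheredSample measurable_fst (measurable_response β σ) hR hL)
    (secondMoment_isSymm P) (fun j l => ?_) h.indepFun_sample
    (fun i => integrable_of_integral_sq_eq_one (h.errors.measurable i) (hvar i)) hmean hlam hsample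
  have : ∀ i, ∫ ω, X i ω j * X i ω l ∂μ = secondMoment P j l := fun i =>
    h.predictors.integral_comp i ((measurable_coord j).mul (measurable_coord l))
  simp [this]

theorem fixed_bounded_error_bound {x : Fin n → Vec d} {ν : Measure ℝ}
    {ε : Fin n → Ω → ℝ} {U : Fin n → Channel d → Ω → ℝ} {β : Vec d} {σ R L : ℝ} (hd : 1 ≤ d)
    (hn : 1 ≤ n) (h : FixedDesign μ ν ε U) (hν : IsStandardized ν)
    (hlam : 0 < lambdaMin (empiricalSecondMoment x)) (hR : ∀ i j, |x i j| ≤ R)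
    (hL : ∀ i, ∀ᵐ ω ∂μ, |response β σ (x i) (ε i ω)| ≤ L)
    (hsample : sampleBound (empiricalSecondMoment x) n R ≤ n) :
    1 - 2 / (n : ℝ) ≤ μ.real (errorEvent R L β σ (fun i _ => x i) ε U
      (err (empiricalSecondMoment x) β n R L)) := by
  have hn' : (0 : ℝ) < n := by exact_mod_cast hn
  have hmean : ∀ i, ∫ ω, ε i ω ∂μ = 0 := fun i =>
    (h.errors.integral_comp i measurable_id).trans hν.1
  have hvar : ∀ i, ∫ ω, ε i ω ^ 2 ∂μ = 1 := fun i =>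
    (h.errors.integral_comp i (measurable_id.pow_const 2)).trans hν.2
  refine bounded_error_bound hd hn (h.ditheredSample hR hL)
    (empiricalSecondMoment_isSymm x) (fun j l => ?_) (fun i => indepFun_const_left _ _)
    (fun i => integrable_of_integral_sq_eq_one (h.errors.measurable i) (hvar i)) hmean hlam hsample
  simp only [empiricalSecondMoment, Matrix.of_apply, integral_const, probReal_univ, one_smul]
  field_simp

end Bounded

/-! ### Consequences of a bound on the sub-Gaussian norm -/

section Psi2

variable {Ω : Type*} [MeasurableSpace Ω] {μ : Measure Ω} {Z : Ω → ℝ}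

/-- The exponential moment is only claimed strictly above `κ`, which avoids proving that the infimum
is attained. Later arguments take `t = √2 κ` or let `t` decrease to `κ`. -/
lemma lintegral_exp_le_two {κ : ℝ≥0} (h : psi2Norm μ Z ≤ κ) {t : ℝ} (ht : κ < t) :
    ∫⁻ ω, ENNReal.ofReal (Real.exp (|Z ω| ^ 2 / t ^ 2)) ∂μ ≤ 2 := by
  have hlt : psi2Norm μ Z < ENNReal.ofReal t := by
    refine h.trans_lt ?_
    rw [← ENNReal.ofReal_coe_nnreal]
    exact (ENNReal.ofReal_lt_ofReal_iff (κ.coe_nonneg.trans_lt ht)).2 ht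
  obtain ⟨⟨s, hs0, hs⟩, hst⟩ := iInf_lt_iff.1 hlt
  have hst' : s < t := (ENNReal.ofReal_lt_ofReal_iff (κ.coe_nonneg.trans_lt ht)).1 hst
  refine (lintegral_mono fun ω => ENNReal.ofReal_le_ofReal (Real.exp_le_exp.2 ?_)).trans hs
  gcongr

lemma integrable_exp_sq (hZ : Measurable Z) {t : ℝ}
    (h : ∫⁻ ω, ENNReal.ofReal (Real.exp (|Z ω| ^ 2 / t ^ 2)) ∂μ ≤ 2) :
    Integrable (fun ω => Real.exp (Z ω ^ 2 / t ^ 2)) μ := by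
  simp only [sq_abs] at h
  refine ⟨(by fun_prop : Measurable _).aestronglyMeasurable, ?_⟩
  rw [hasFiniteIntegral_iff_ofReal (ae_of_all _ fun ω => (Real.exp_pos _).le)]
  exact h.trans_lt (by simp)

lemma integral_exp_sq_le (hZ : Measurable Z) {t : ℝ}
    (h : ∫⁻ ω, ENNReal.ofReal (Real.exp (|Z ω| ^ 2 / t ^ 2)) ∂μ ≤ 2) :
    ∫ ω, Real.exp (Z ω ^ 2 / t ^ 2) ∂μ ≤ 2 := by
  have hi := integrable_exp_sq hZ h
  rw [← ENNReal.ofReal_le_ofReal_iff (by norm_num),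
    ofReal_integral_eq_lintegral_ofReal hi (ae_of_all _ fun ω => (Real.exp_pos _).le)]
  simpa only [sq_abs, ENNReal.ofReal_ofNat] using h

variable [IsProbabilityMeasure μ]

lemma measureReal_lt_abs_le (hZ : Measurable Z) {t a : ℝ} (ha : 0 ≤ a)
    (h : ∫⁻ ω, ENNReal.ofReal (Real.exp (|Z ω| ^ 2 / t ^ 2)) ∂μ ≤ 2) :
    μ.real {ω | a < |Z ω|} ≤ 2 * Real.exp (-(a ^ 2 / t ^ 2)) := by
  have h1 := mul_meas_ge_le_integral_of_nonneg (ae_of_all _ fun ω => (Real.exp_pos _).le)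
    (integrable_exp_sq hZ h) (Real.exp (a ^ 2 / t ^ 2))
  have h2 : μ.real {ω | a < |Z ω|} ≤ μ.real {ω | Real.exp (a ^ 2 / t ^ 2) ≤
      Real.exp (Z ω ^ 2 / t ^ 2)} := by
    refine measureReal_mono fun ω hω => Real.exp_le_exp.2 ?_
    have : a ^ 2 ≤ Z ω ^ 2 := by
      rw [← sq_abs (Z ω)]
      exact pow_le_pow_left₀ ha (le_of_lt hω) 2
    gcongr
  have h3 := h1.trans (integral_exp_sq_le hZ h)
  rw [Real.exp_neg, ← div_eq_mul_inv, le_div_iff₀ (Real.exp_pos _)]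
  have := mul_le_mul_of_nonneg_left h2 (Real.exp_pos (a ^ 2 / t ^ 2)).le
  linarith

/-- Tail bound at the truncation level. -/
lemma measureReal_trunc_lt_abs_le (hZ : Measurable Z) {κ : ℝ≥0} (hκ : 0 < κ)
    (h : psi2Norm μ Z ≤ κ) {c m : ℝ} (hc : 1 / 2 ≤ c) (hm : 1 ≤ m) {a : ℝ} (ha : 0 ≤ a)
    (ha2 : 8 * (c * κ ^ 2) * Real.log m ≤ a ^ 2) : μ.real {ω | a < |Z ω|} ≤ 2 / m ^ 2 := by
  have hκ' : (0 : ℝ) < κ := hκ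
  have hlt : (κ : ℝ) < √2 * κ := by
    have : 1 < √2 := by rw [Real.lt_sqrt] <;> norm_num
    nlinarith
  -- At `t = √2 κ` the exponent is `a² / (2 κ²) ≥ 4 c log m ≥ 2 log m`; this is where `c ≥ 1 / 2`
  -- enters.
  refine (measureReal_lt_abs_le hZ ha (lintegral_exp_le_two h hlt)).trans ?_
  rw [mul_pow, Real.sq_sqrt (by norm_num), div_eq_mul_inv 2]
  gcongr
  rw [← Real.log_le_log_iff (Real.exp_pos _) (by positivity), Real.log_exp, Real.log_inv,
    Real.log_pow, neg_le_neg_iff, le_div_iff₀ (by positivity)]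
  refine le_trans ?_ ha2
  have hl := Real.log_nonneg hm
  have : 0 ≤ κ ^ 2 * Real.log m := by positivity
  push_cast
  nlinarith

omit [IsProbabilityMeasure μ] in
lemma integrable_sq_of_psi2Norm_le (hZ : Measurable Z) {κ : ℝ≥0} (h : psi2Norm μ Z ≤ κ) :
    Integrable (fun ω => Z ω ^ 2) μ := by
  have ht : (κ : ℝ) < κ + 1 := by linarith
  have ht0 : (0 : ℝ) < κ + 1 := by positivity
  have hi := (integrable_exp_sq hZ (lintegral_exp_le_two h ht)).const_mul ((κ + 1 : ℝ) ^ 2)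
  refine hi.mono' (hZ.pow_const 2).aestronglyMeasurable (ae_of_all _ fun ω => ?_)
  rw [Real.norm_of_nonneg (sq_nonneg _)]
  have := Real.add_one_le_exp (Z ω ^ 2 / (κ + 1 : ℝ) ^ 2)
  calc Z ω ^ 2 = (κ + 1 : ℝ) ^ 2 * (Z ω ^ 2 / (κ + 1 : ℝ) ^ 2) := by field_simp
    _ ≤ _ := by gcongr; linarith

lemma integral_sq_le_of_psi2Norm_le (hZ : Measurable Z) {κ : ℝ≥0} (h : psi2Norm μ Z ≤ κ) :
    ∫ ω, Z ω ^ 2 ∂μ ≤ κ ^ 2 := by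
  have key : ∀ t : ℝ, κ < t → ∫ ω, Z ω ^ 2 ∂μ ≤ t ^ 2 := by
    intro t ht
    have ht0 : 0 < t := κ.coe_nonneg.trans_lt ht
    have he := lintegral_exp_le_two h ht
    have h1 : ∫ ω, (Z ω ^ 2 / t ^ 2 + 1) ∂μ ≤ ∫ ω, Real.exp (Z ω ^ 2 / t ^ 2) ∂μ :=
      integral_mono (((integrable_sq_of_psi2Norm_le hZ h).div_const _).add (integrable_const _))
        (integrable_exp_sq hZ he) fun ω => Real.add_one_le_exp _
    rw [integral_add ((integrable_sq_of_psi2Norm_le hZ h).div_const _) (integrable_const _),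
      integral_div] at h1
    have h2 := h1.trans (integral_exp_sq_le hZ he)
    simp only [integral_const, probReal_univ, smul_eq_mul, mul_one] at h2
    have h3 : (∫ ω, Z ω ^ 2 ∂μ) / t ^ 2 ≤ 1 := by linarith
    rwa [div_le_one (by positivity)] at h3
  refine le_of_forall_pos_le_add fun e he => ?_
  have h0 : (κ : ℝ) < √((κ : ℝ) ^ 2 + e) := by
    rw [Real.lt_sqrt κ.coe_nonneg]; linarith
  have := key _ h0
  rwa [Real.sq_sqrt (by positivity)] at this

omit [IsProbabilityMeasure μ] in
lemma fourth_moment_of_psi2Norm_le (hZ : Measurable Z) {κ : ℝ≥0} (hκ : 0 < κ)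
    (h : psi2Norm μ Z ≤ κ) :
    Integrable (fun ω => Z ω ^ 4) μ ∧ ∫ ω, Z ω ^ 4 ∂μ ≤ 16 * κ ^ 4 := by
  have hκ' : (0 : ℝ) < κ := hκ
  have hlt : (κ : ℝ) < √2 * κ := by
    have : 1 < √2 := by rw [Real.lt_sqrt] <;> norm_num
    nlinarith
  have he := lintegral_exp_le_two h hlt
  have hb : ∀ ω, Z ω ^ 4 ≤ 8 * κ ^ 4 * Real.exp (Z ω ^ 2 / (√2 * κ) ^ 2) := by
    intro ω
    rw [mul_pow, Real.sq_sqrt (by norm_num)]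
    have h1 := Real.quadratic_le_exp_of_nonneg (x := Z ω ^ 2 / (2 * κ ^ 2)) (by positivity)
    have h2 : Z ω ^ 4 = 8 * κ ^ 4 * ((Z ω ^ 2 / (2 * κ ^ 2)) ^ 2 / 2) := by
      field_simp; ring
    have h3 : 0 ≤ Z ω ^ 2 / (2 * (κ : ℝ) ^ 2) := by positivity
    rw [h2]
    gcongr
    linarith
  have hi := (integrable_exp_sq hZ he).const_mul (8 * (κ : ℝ) ^ 4)
  have hint : Integrable (fun ω => Z ω ^ 4) μ :=
    hi.mono' (hZ.pow_const 4).aestronglyMeasurable (ae_of_all _ fun ω => by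
      rw [Real.norm_of_nonneg (by positivity)]; exact hb ω)
  refine ⟨hint, (integral_mono hint hi hb).trans ?_⟩
  rw [integral_const_mul]
  have := mul_le_mul_of_nonneg_left (integral_exp_sq_le hZ he)
    (show 0 ≤ 8 * (κ : ℝ) ^ 4 by positivity)
  linarith

end Psi2

/-! ### The square root of the second moment matrix -/

section Sqrt

variable {d : ℕ}

lemma act_apply (M : Matrix (Fin d) (Fin d) ℝ) (u : Vec d) :
    act M u = Matrix.toEuclideanLin M u := rfl

lemma isUnit_of_lambdaMin_pos {S : Matrix (Fin d) (Fin d) ℝ} (hS : S.IsSymm)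
    (h : 0 < lambdaMin S) : IsUnit S := by
  rw [← spectrum.zero_notMem_iff ℝ]
  intro h0
  have hH : S.IsHermitian := by
    rw [Matrix.IsHermitian, Matrix.conjTranspose_eq_transpose_of_trivial]; exact hS
  have hbdd : BddBelow (spectrum ℝ S) := by
    rw [hH.spectrum_real_eq_range_eigenvalues]
    exact (Set.finite_range _).bddBelow
  exact absurd (csInf_le hbdd h0) (not_le.2 h)

open scoped MatrixOrder in
lemma sqrtMat_spec {S : Matrix (Fin d) (Fin d) ℝ} (hS : S.IsSymm) (h : 0 < lambdaMin S) :
    (sqrtMat S).IsSymm ∧ sqrtMat S * sqrtMat S = S := by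
  have hH : S.IsHermitian := by
    rw [Matrix.IsHermitian, Matrix.conjTranspose_eq_transpose_of_trivial]; exact hS
  have hpsd : S.PosSemidef := by
    refine Matrix.PosSemidef.of_dotProduct_mulVec_nonneg hH fun v => ?_
    have h1 := lambdaMin_mul_le_inner hS (WithLp.toLp 2 v)
    have h2 : inner ℝ (WithLp.toLp 2 v : Vec d) (Matrix.toEuclideanLin S (WithLp.toLp 2 v)) =
        star v ⬝ᵥ S.mulVec v := by
      rw [inner_eq_sum]
      simp [dotProduct, Matrix.mulVec]
    rw [h2] at h1
    exact (by positivity : (0 : ℝ) ≤ lambdaMin S * ‖(WithLp.toLp 2 v : Vec d)‖ ^ 2).trans h1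
  have hnn : 0 ≤ sqrtMat S := CFC.sqrt_nonneg S
  have hp := Matrix.nonneg_iff_posSemidef.1 hnn
  refine ⟨?_, CFC.sqrt_mul_sqrt_self S (Matrix.nonneg_iff_posSemidef.2 hpsd)⟩
  have := hp.1
  rwa [Matrix.IsHermitian, Matrix.conjTranspose_eq_transpose_of_trivial] at this

lemma norm_act_sqrtMat_sq {S : Matrix (Fin d) (Fin d) ℝ} (hS : S.IsSymm)
    (h : 0 < lambdaMin S) (u : Vec d) :
    ‖act (sqrtMat S) u‖ ^ 2 = inner ℝ u (Matrix.toEuclideanLin S u) := by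
  obtain ⟨h1, h2⟩ := sqrtMat_spec hS h
  have h3 : Matrix.toEuclideanLin S u =
      Matrix.toEuclideanLin (sqrtMat S) (Matrix.toEuclideanLin (sqrtMat S) u) := by
    ext j
    rw [toEuclideanLin_apply_ofLp, toEuclideanLin_apply_ofLp, toEuclideanLin_apply_ofLp,
      Matrix.mulVec_mulVec, h2]
  rw [h3, ← toEuclideanLin_isSymmetric h1, real_inner_self_eq_norm_sq, act_apply]

lemma inner_act_sqrtMat_inv {S : Matrix (Fin d) (Fin d) ℝ} (hS : S.IsSymm)
    (h : 0 < lambdaMin S) (x u : Vec d) :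
    inner ℝ (act (sqrtMat S)⁻¹ x) (act (sqrtMat S) u) = inner ℝ x u := by
  obtain ⟨h1, h2⟩ := sqrtMat_spec hS h
  have hu : IsUnit (sqrtMat S).det := by
    have := (Matrix.isUnit_iff_isUnit_det S).1 (isUnit_of_lambdaMin_pos hS h)
    rw [← h2, Matrix.det_mul] at this
    exact isUnit_of_mul_isUnit_left this
  have hinv : ((sqrtMat S)⁻¹).IsSymm := by
    rw [Matrix.IsSymm, Matrix.transpose_nonsing_inv, h1.eq]
  rw [act_apply, act_apply, toEuclideanLin_isSymmetric hinv]
  congr 1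
  ext j
  rw [toEuclideanLin_apply_ofLp, toEuclideanLin_apply_ofLp, Matrix.mulVec_mulVec,
    Matrix.nonsing_inv_mul _ hu, Matrix.one_mulVec]

lemma norm_act_sqrtMat_pos {S : Matrix (Fin d) (Fin d) ℝ} (hS : S.IsSymm)
    (h : 0 < lambdaMin S) {u : Vec d} (hu : u ≠ 0) : 0 < ‖act (sqrtMat S) u‖ := by
  have h1 := lambdaMin_mul_le_inner hS u
  rw [← norm_act_sqrtMat_sq hS h] at h1
  have h2 : 0 < ‖u‖ := norm_pos_iff.2 hu
  have h3 : 0 < ‖act (sqrtMat S) u‖ ^ 2 := lt_of_lt_of_le (by positivity) h1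
  exact lt_of_le_of_ne (norm_nonneg _) (sq_pos_iff.1 h3).symm

/-- Marginals normalized by their standard deviation inherit the sub-Gaussian norm of the whitened
vector. -/
lemma psi2Norm_inner_div_le {P : Measure (Vec d)} {S : Matrix (Fin d) (Fin d) ℝ} (hS : S.IsSymm)
    (h : 0 < lambdaMin S) {u : Vec d} (hu : u ≠ 0) :
    psi2Norm P (fun x => inner ℝ x u / ‖act (sqrtMat S) u‖) ≤
      psi2NormVec P fun x => act (sqrtMat S)⁻¹ x := by
  have hpos := norm_act_sqrtMat_pos hS h hu
  have hnorm : ‖‖act (sqrtMat S) u‖⁻¹ • act (sqrtMat S) u‖ = 1 := by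
    rw [norm_smul, norm_inv, norm_norm, inv_mul_cancel₀ hpos.ne']
  -- The supremum is tested in the direction `Σ^(1/2) u`, normalized; pairing it with `Σ^(-1/2) x`
  -- returns the marginal `⟨x, u⟩`.
  have h1 := le_iSup (fun v : {v : Vec d // ‖v‖ = 1} =>
    psi2Norm P fun x => inner ℝ (act (sqrtMat S)⁻¹ x) (v : Vec d)) ⟨_, hnorm⟩
  have h2 : ∀ x : Vec d, inner ℝ (act (sqrtMat S)⁻¹ x)
      (‖act (sqrtMat S) u‖⁻¹ • act (sqrtMat S) u) = inner ℝ x u / ‖act (sqrtMat S) u‖ :=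
    fun x => by rw [inner_smul_right, inner_act_sqrtMat_inv hS h, div_eq_inv_mul]
  simp only [h2] at h1
  exact h1

end Sqrt

/-! ### Truncation -/

/-- The predictor, replaced by zero outside the box `[-R, R]ᵈ`. -/
noncomputable def truncVec {d : ℕ} (R : ℝ) (x : Vec d) : Vec d :=
  open Classical in if ∀ j, |x j| ≤ R then x else 0

/-- A real number, replaced by zero outside `[-L, L]`. -/
noncomputable def truncReal (L y : ℝ) : ℝ := if |y| ≤ L then y else 0

section Truncation

variable {d : ℕ}

lemma truncVec_of_le {R : ℝ} {x : Vec d} (h : ∀ j, |x j| ≤ R) : truncVec R x = x := if_pos h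

lemma truncVec_of_not_le {R : ℝ} {x : Vec d} (h : ¬ ∀ j, |x j| ≤ R) : truncVec R x = 0 := if_neg h

lemma measurableSet_box (R : ℝ) : MeasurableSet {x : Vec d | ∀ j, |x j| ≤ R} := by
  have : {x : Vec d | ∀ j, |x j| ≤ R} = ⋂ j, {x | |x j| ≤ R} := by ext; simp
  rw [this]
  exact MeasurableSet.iInter fun j => measurableSet_le (by fun_prop) measurable_const

lemma measurable_truncVec (R : ℝ) : Measurable (truncVec R : Vec d → Vec d) := by
  classical
  unfold truncVec
  exact Measurable.ite (measurableSet_box R) measurable_id measurable_const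

lemma measurable_truncReal (L : ℝ) : Measurable (truncReal L) := by
  unfold truncReal
  exact Measurable.ite (measurableSet_le (by fun_prop) measurable_const) measurable_id
    measurable_const

lemma abs_truncVec_le {R : ℝ} (hR : 0 ≤ R) (x : Vec d) (j : Fin d) : |truncVec R x j| ≤ R := by
  by_cases h : ∀ j, |x j| ≤ R
  · rw [truncVec_of_le h]; exact h j
  · rw [truncVec_of_not_le h]; simpa using hR

lemma abs_truncReal_le {L : ℝ} (hL : 0 ≤ L) (y : ℝ) : |truncReal L y| ≤ L := by
  unfold truncReal
  split_ifs with h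
  · exact h
  · simpa using hL

/-- The second moment matrix of a function of a random vector. -/
lemma inner_secondMoment_comp {Ω : Type*} [MeasurableSpace Ω] {μ : Measure Ω} {f : Ω → Vec d}
    (hf : ∀ j, MemLp (fun ω => f ω j) 2 μ) (u : Vec d) :
    inner ℝ u (Matrix.toEuclideanLin (Matrix.of fun j l => ∫ ω, f ω j * f ω l ∂μ) u) =
      ∫ ω, inner ℝ (f ω) u ^ 2 ∂μ := by
  have hi : ∀ j l, Integrable (fun ω => f ω j * f ω l) μ := fun j l => (hf j).integrable_mul (hf l)
  have e : ∀ ω, inner ℝ (f ω) u ^ 2 = ∑ j, ∑ l, u j * u l * (f ω j * f ω l) := fun ω => by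
    rw [inner_eq_sum, sq, Finset.sum_mul_sum]
    exact Finset.sum_congr rfl fun j _ => Finset.sum_congr rfl fun l _ => by ring
  simp only [e]
  rw [integral_finsetSum _ fun j _ => integrable_finsetSum _ fun l _ => (hi j l).const_mul _,
    inner_eq_sum]
  refine Finset.sum_congr rfl fun j _ => ?_
  rw [integral_finsetSum _ fun l _ => (hi j l).const_mul _, toEuclideanLin_apply_apply,
    Finset.mul_sum]
  refine Finset.sum_congr rfl fun l _ => ?_
  rw [integral_const_mul, Matrix.of_apply]
  ring

lemma memLp_inner {Ω : Type*} [MeasurableSpace Ω] {μ : Measure Ω} {f : Ω → Vec d}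
    (hf : ∀ j, MemLp (fun ω => f ω j) 2 μ) (u : Vec d) :
    MemLp (fun ω => inner ℝ (f ω) u) 2 μ := by
  simp only [inner_eq_sum]
  exact memLp_finsetSum _ fun j _ => (hf j).mul_const _

end Truncation

/-! ### Moment loss and bias caused by truncation. -/

section Estimates

variable {Ω : Type*} [MeasurableSpace Ω] {μ : Measure Ω} [IsProbabilityMeasure μ]

/-- Cauchy-Schwarz in the form of Young's inequality `Z² ≤ Z⁴ / (384 κ⁴) + 96 κ⁴` on `A`. The
constants balance the two contributions at `1 / 24` each. -/
lemma setIntegral_sq_le {Z : Ω → ℝ} {A : Set Ω} (hA : MeasurableSet A) {κ : ℝ} (hκ : 0 < κ)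
    (hZ : Integrable (fun ω => Z ω ^ 4) μ) (h4 : ∫ ω, Z ω ^ 4 ∂μ ≤ 16 * κ ^ 4)
    (hp : μ.real A ≤ 1 / (2304 * κ ^ 4)) (hZ2 : Integrable (fun ω => Z ω ^ 2) μ) :
    ∫ ω in A, Z ω ^ 2 ∂μ ≤ 1 / 12 := by
  have hi : Integrable (fun ω => Z ω ^ 4 / (384 * κ ^ 4) + A.indicator (fun _ => 96 * κ ^ 4) ω) μ :=
    (hZ.div_const _).add ((integrable_const _).indicator hA)
  rw [← integral_indicator hA]
  calc _ ≤ ∫ ω, (Z ω ^ 4 / (384 * κ ^ 4) + A.indicator (fun _ => 96 * κ ^ 4) ω) ∂μ := by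
        refine integral_mono (hZ2.indicator hA) hi fun ω => ?_
        by_cases hω : ω ∈ A
        · simp only [Set.indicator_of_mem hω]
          have : Z ω ^ 4 / (384 * κ ^ 4) + 96 * κ ^ 4 - Z ω ^ 2 =
              (Z ω ^ 2 - 192 * κ ^ 4) ^ 2 / (384 * κ ^ 4) := by field_simp; ring
          have h0 : 0 ≤ (Z ω ^ 2 - 192 * κ ^ 4) ^ 2 / (384 * κ ^ 4) := by positivity
          linarith
        · simp only [Set.indicator_of_notMem hω, add_zero]
          positivity
    _ = (∫ ω, Z ω ^ 4 ∂μ) / (384 * κ ^ 4) + μ.real A * (96 * κ ^ 4) := by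
        rw [integral_add (hZ.div_const _) ((integrable_const _).indicator hA), integral_div,
          integral_indicator hA]
        simp
    _ ≤ 16 * κ ^ 4 / (384 * κ ^ 4) + 1 / (2304 * κ ^ 4) * (96 * κ ^ 4) := by gcongr
    _ = 1 / 12 := by field_simp; norm_num

/-- Young's inequality `|Y| ≤ δ Y² / 2 + 1 / (2 δ)` on the tail event, with `δ = 1 / (N τ)`; the
contributions are `τ / N` and `2 τ / N`. -/
lemma integral_abs_tail_le {Y : Ω → ℝ} (hY : MemLp Y 2 μ) {L τ N : ℝ} (hτ : 0 ≤ τ) (hN : 0 < N)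
    (h2 : ∫ ω, Y ω ^ 2 ∂μ ≤ 2 * τ ^ 2) (hYm : Measurable Y)
    (hp : μ.real {ω | L < |Y ω|} ≤ 4 / N ^ 2) :
    ∫ ω in {ω | L < |Y ω|}, |Y ω| ∂μ ≤ 3 * τ / N := by
  set A := {ω | L < |Y ω|}
  have hA : MeasurableSet A := measurableSet_lt measurable_const hYm.abs
  have hY1 : Integrable (fun ω => |Y ω|) μ := (hY.integrable (by norm_num)).abs
  have key : ∀ δ : ℝ, 0 < δ → ∫ ω in A, |Y ω| ∂μ ≤ δ * τ ^ 2 + 2 / (N ^ 2 * δ) := by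
    intro δ hδ
    have hi : Integrable (fun ω => δ / 2 * Y ω ^ 2 + A.indicator (fun _ => 1 / (2 * δ)) ω) μ :=
      (hY.integrable_sq.const_mul _).add ((integrable_const _).indicator hA)
    rw [← integral_indicator hA]
    calc _ ≤ ∫ ω, (δ / 2 * Y ω ^ 2 + A.indicator (fun _ => 1 / (2 * δ)) ω) ∂μ := by
          refine integral_mono (hY1.indicator hA) hi fun ω => ?_
          by_cases hω : ω ∈ A
          · simp only [Set.indicator_of_mem hω]
            have : δ / 2 * |Y ω| ^ 2 + 1 / (2 * δ) - |Y ω| =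
                (δ * |Y ω| - 1) ^ 2 / (2 * δ) := by field_simp; ring
            have h0 : 0 ≤ (δ * |Y ω| - 1) ^ 2 / (2 * δ) := by positivity
            rw [sq_abs] at this
            linarith
          · simp only [Set.indicator_of_notMem hω, add_zero]
            positivity
      _ = δ / 2 * ∫ ω, Y ω ^ 2 ∂μ + μ.real A * (1 / (2 * δ)) := by
          rw [integral_add (hY.integrable_sq.const_mul _) ((integrable_const _).indicator hA),
            integral_const_mul, integral_indicator hA]
          simp
      _ ≤ δ / 2 * (2 * τ ^ 2) + 4 / N ^ 2 * (1 / (2 * δ)) := by gcongr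
      _ = _ := by field_simp; ring
  rcases hτ.eq_or_lt with h0 | h0
  · subst h0
    simp only [ne_eq, OfNat.ofNat_ne_zero, not_false_eq_true, zero_pow, mul_zero, zero_add,
      zero_div] at key ⊢
    by_contra! hm
    -- For `τ = 0` a large `δ` is allowed; this one bounds the integral by half of itself.
    have := key (4 / (N ^ 2 * ∫ ω in A, |Y ω| ∂μ)) (by positivity)
    have e : 2 / (N ^ 2 * (4 / (N ^ 2 * ∫ ω in A, |Y ω| ∂μ))) = (∫ ω in A, |Y ω| ∂μ) / 2 := by
      field_simp; norm_num
    rw [e] at this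
    linarith
  · have := key (1 / (N * τ)) (by positivity)
    have e : 1 / (N * τ) * τ ^ 2 + 2 / (N ^ 2 * (1 / (N * τ))) = 3 * τ / N := by
      field_simp; ring
    rwa [e] at this

variable {d : ℕ}

/-- The bias caused by truncation. -/
lemma norm_truncation_bias_le {X : Ω → Vec d} {ε : Ω → ℝ} {β : Vec d} {σ R L m : ℝ}
    (hX : Measurable X) (hεm : Measurable ε) (hR : 0 ≤ R)
    (hε : MemLp ε 2 μ) (hε0 : ∫ ω, ε ω ∂μ = 0) (hind : IndepFun X ε μ)
    (hY : MemLp (fun ω => response β σ (X ω) (ε ω)) 2 μ)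
    (hm : ∫ ω in {ω | L < |response β σ (X ω) (ε ω)|}, |response β σ (X ω) (ε ω)| ∂μ ≤ m)
    {g : Vec d}
    (hg : ∀ j, g j = ∫ ω, truncVec R (X ω) j * truncReal L (response β σ (X ω) (ε ω)) ∂μ)
    {S : Matrix (Fin d) (Fin d) ℝ}
    (hS : ∀ j l, S j l = ∫ ω, truncVec R (X ω) j * truncVec R (X ω) l ∂μ) :
    ‖g - Matrix.toEuclideanLin S β‖ ≤ √d * R * m := by
  set Y := fun ω => response β σ (X ω) (ε ω) with hYdef
  set A := {ω | L < |Y ω|} with hAdef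
  have hYm : Measurable Y := (measurable_response β σ).comp (hX.prodMk hεm)
  have hA : MeasurableSet A := measurableSet_lt measurable_const hYm.abs
  have hYi : Integrable Y μ := hY.integrable (by norm_num)
  have htm : Measurable fun ω => truncVec R (X ω) := (measurable_truncVec R).comp hX
  have htj : ∀ j, Measurable fun ω => truncVec R (X ω) j := fun j => (measurable_coord j).comp htm
  have hmem : ∀ j, MemLp (fun ω => truncVec R (X ω) j) 2 μ := fun j =>
    MemLp.of_bound (htj j).aestronglyMeasurable R
      (ae_of_all _ fun ω => abs_truncVec_le hR (X ω) j)
  -- Truncation kills the whole vector at once, so multiplied by a truncated coordinate the true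
  -- response equals the response of the truncated predictor. The truncated design thus satisfies
  -- its own normal equations exactly, and only the truncation of the response causes bias.
  have hswap : ∀ j ω, truncVec R (X ω) j * response β σ (truncVec R (X ω)) (ε ω) =
      truncVec R (X ω) j * Y ω := by
    intro j ω
    by_cases h : ∀ j, |X ω j| ≤ R
    · rw [truncVec_of_le h]
    · simp [truncVec_of_not_le h]
  have hcoord : ∀ j, |(g - Matrix.toEuclideanLin S β) j| ≤ R * m := by
    intro j
    have h1 := integral_coord_mul_response (β := β) (σ := σ) hmem hε hε0
      (hind.comp (measurable_truncVec R) measurable_id) j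
    simp only [hswap, ← hS] at h1
    have hi1 : Integrable (fun ω => truncVec R (X ω) j * Y ω) μ := (hmem j).integrable_mul hY
    have hi2 : Integrable (fun ω => truncVec R (X ω) j * truncReal L (Y ω)) μ := by
      refine hYi.abs.const_mul R |>.mono'
        ((htj j).mul ((measurable_truncReal L).comp hYm)).aestronglyMeasurable
        (ae_of_all _ fun ω => ?_)
      rw [Real.norm_eq_abs, abs_mul]
      refine mul_le_mul (abs_truncVec_le hR _ j) ?_ (abs_nonneg _) hR
      unfold truncReal
      split_ifs <;> simp
    rw [PiLp.sub_apply, toEuclideanLin_apply_apply, ← h1, hg, ← integral_sub hi2 hi1]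
    refine (abs_integral_le_integral_abs).trans ?_
    have hpt : ∀ ω, |truncVec R (X ω) j * truncReal L (Y ω) - truncVec R (X ω) j * Y ω| ≤
        R * A.indicator (fun ω => |Y ω|) ω := by
      intro ω
      rw [← mul_sub, abs_mul]
      refine mul_le_mul (abs_truncVec_le hR _ j) ?_ (abs_nonneg _) hR
      by_cases hω : ω ∈ A
      · rw [Set.indicator_of_mem hω, truncReal, if_neg (not_le.2 hω), zero_sub, abs_neg]
      · rw [Set.indicator_of_notMem hω, truncReal, if_pos (not_lt.1 hω), sub_self, abs_zero]
    refine (integral_mono (hi2.sub hi1).abs ((hYi.abs.indicator hA).const_mul R) hpt).trans ?_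
    rw [integral_const_mul, integral_indicator hA]
    exact mul_le_mul_of_nonneg_left hm hR
  have hm0 : 0 ≤ m := (integral_nonneg fun ω => abs_nonneg _).trans hm
  refine abs_le_of_sq_le_sq' ?_ (by positivity) |>.2
  rw [norm_sq_eq_sum, mul_assoc, mul_pow, Real.sq_sqrt (Nat.cast_nonneg d)]
  calc _ ≤ ∑ _j : Fin d, (R * m) ^ 2 := by
        refine Finset.sum_le_sum fun j _ => sq_le_sq' (abs_le.1 (hcoord j)).1 (abs_le.1 (hcoord j)).2
    _ = _ := by simp

end Estimates

/-! ### The sub-Gaussian case -/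

section SubGaussian

variable {Ω : Type*} [MeasurableSpace Ω] {μ : Measure Ω} [IsProbabilityMeasure μ] {n d : ℕ}
  {P : Measure (Vec d)} {ν : Measure ℝ} {X : Fin n → Ω → Vec d} {ε : Fin n → Ω → ℝ}
  {U : Fin n → Channel d → Ω → ℝ} {β : Vec d} {σ : ℝ}

lemma IsIID.isProbabilityMeasure {α : Type*} [MeasurableSpace α] {Z : Fin n → Ω → α}
    {Q : Measure α} (h : IsIID μ Z Q) (hn : 1 ≤ n) : IsProbabilityMeasure Q := by
  rw [← h.law ⟨0, hn⟩]
  exact Measure.isProbabilityMeasure_map (h.measurable _).aemeasurable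

omit [IsProbabilityMeasure μ] in
lemma IsIID.measureReal_preimage {α : Type*} [MeasurableSpace α] {Z : Fin n → Ω → α}
    {Q : Measure α} (h : IsIID μ Z Q) (i : Fin n) {s : Set α} (hs : MeasurableSet s) :
    μ.real {ω | Z i ω ∈ s} = Q.real s := by
  rw [← h.law i, map_measureReal_apply (h.measurable i) hs]; rfl

/-- Expectations of a function of one sample do not depend on the sample. -/
lemma RandomDesign.integral_sample_eq (h : RandomDesign μ P ν X ε U) {F : Vec d × ℝ → ℝ}
    (hF : Measurable F) (i i' : Fin n) :
    ∫ ω, F (X i ω, ε i ω) ∂μ = ∫ ω, F (X i' ω, ε i' ω) ∂μ := by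
  have key : ∀ k, ∫ ω, F (X k ω, ε k ω) ∂μ = ∫ q, F q ∂(P.prod ν) := fun k => by
    have hm := (h.predictors.measurable k).prodMk (h.errors.measurable k)
    rw [← h.predictors.law k, ← h.errors.law k,
      ← (indepFun_iff_map_prod_eq_prod_map_map (h.predictors.measurable k).aemeasurable
        (h.errors.measurable k).aemeasurable).1 (h.indepFun_sample k),
      integral_map hm.aemeasurable hF.aestronglyMeasurable]
  rw [key, key]

lemma one_le_of_psi2Norm {α : Type*} [MeasurableSpace α] {Q : Measure α} [IsProbabilityMeasure Q]
    {Z : α → ℝ} (hZ : Measurable Z) {κ : ℝ≥0} (h : psi2Norm Q Z ≤ κ)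
    (h1 : ∫ a, Z a ^ 2 ∂Q = 1) : (1 : ℝ) ≤ κ := by
  have := integral_sq_le_of_psi2Norm_le hZ h
  rw [h1] at this
  exact (one_le_sq_iff_one_le_abs _).1 this |>.trans_eq (abs_of_nonneg κ.coe_nonneg)

lemma sum_const_le_of_forall {ι : Type*} [Fintype ι] {f : ι → ℝ} {b : ℝ} (h : ∀ i, f i ≤ b) :
    ∑ i, f i ≤ Fintype.card ι * b := by
  refine (Finset.sum_le_sum fun i _ => h i).trans (le_of_eq ?_)
  simp

/-- A predictor leaves the box with small probability. -/
lemma measureReal_not_box_le [IsProbabilityMeasure P] {K : ℝ≥0} (hK0 : 0 < K)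
    (hK : ∀ j, psi2Norm P (fun x => x j) ≤ K) {c : ℝ} (hc : 1 / 2 ≤ c) (hd : 1 ≤ d) (hn : 1 ≤ n) :
    P.real {x | ¬ ∀ j, |x j| ≤ truncX c K 3 d n} ≤ 2 / (n ^ 2 * d) := by
  have hd' : (1 : ℝ) ≤ d := by exact_mod_cast hd
  have hn' : (1 : ℝ) ≤ n := by exact_mod_cast hn
  have hm : (1 : ℝ) ≤ n * d := one_le_mul_of_one_le_of_one_le hn' hd'
  have hlog := Real.log_nonneg hm
  have hsub : {x : Vec d | ¬ ∀ j, |x j| ≤ truncX c K 3 d n} ⊆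
      ⋃ j ∈ (Finset.univ : Finset (Fin d)), {x : Vec d | truncX c K 3 d n < |x j|} := by
    intro x hx
    simp only [Set.mem_ofPred_eq, not_forall, not_le] at hx
    obtain ⟨j, hj⟩ := hx
    simp only [Finset.mem_univ, Set.iUnion_true, Set.mem_iUnion]
    exact ⟨j, hj⟩
  calc _ ≤ _ := measureReal_mono hsub (measure_ne_top _ _)
    _ ≤ _ := measureReal_biUnion_finset_le _ _
    _ ≤ Fintype.card (Fin d) * (2 / (n * d : ℝ) ^ 2) := sum_const_le_of_forall fun j => by
        refine measureReal_trunc_lt_abs_le (measurable_coord j) hK0 (hK j) hc hm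
          (Real.sqrt_nonneg _) ?_
        rw [truncX, Real.sq_sqrt (by unfold tailConst; positivity), tailConst]
        linarith
    _ = _ := by
        rw [Fintype.card_fin]; field_simp

/-- A response leaves its range with small probability. -/
lemma measureReal_response_gt_le [IsProbabilityMeasure P] [IsProbabilityMeasure ν]
    (h : RandomDesign μ P ν X ε U) (i : Fin n)
    (hlam : 0 < lambdaMin (secondMoment P)) {Kbar Keps : ℝ≥0} (hKb0 : 0 < Kbar) (hKe0 : 0 < Keps)
    (hKb : psi2NormVec P (fun x => act (sqrtMat (secondMoment P))⁻¹ x) ≤ Kbar)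
    (hKe : psi2Norm ν (fun e => e) ≤ Keps) {c : ℝ} (hc : 1 / 2 ≤ c) (hn : 1 ≤ n) (hσ : 0 ≤ σ) :
    μ.real {ω | truncY c Kbar Keps 3 (secondMoment P) β σ n < |response β σ (X i ω) (ε i ω)|} ≤
      4 / (n : ℝ) ^ 2 := by
  have hn' : (1 : ℝ) ≤ n := by exact_mod_cast hn
  have hlog := Real.log_nonneg hn'
  set S := secondMoment P
  set τ := ‖act (sqrtMat S) β‖
  set a := √(2 * (3 + 1) * tailConst c Kbar) * √(Real.log n)
  set b := √(2 * (3 + 1) * tailConst c Keps) * √(Real.log n)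
  have ha2 : a ^ 2 = 8 * (c * Kbar ^ 2) * Real.log n := by
    rw [mul_pow, Real.sq_sqrt (by unfold tailConst; positivity), Real.sq_sqrt hlog, tailConst]
    ring
  have hb2 : b ^ 2 = 8 * (c * Keps ^ 2) * Real.log n := by
    rw [mul_pow, Real.sq_sqrt (by unfold tailConst; positivity), Real.sq_sqrt hlog, tailConst]
    ring
  have hL : truncY c Kbar Keps 3 S β σ n = a * τ + σ * b := by unfold truncY; ring
  have hsub : {ω | truncY c Kbar Keps 3 S β σ n < |response β σ (X i ω) (ε i ω)|} ⊆
      {ω | X i ω ∈ {x : Vec d | a * τ < |inner ℝ x β|}} ∪ {ω | ε i ω ∈ {e : ℝ | b < |e|}} := by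
    intro ω hω
    by_contra hcon
    simp only [Set.mem_union, Set.mem_ofPred_eq, not_or, not_lt] at hcon
    have hω' : truncY c Kbar Keps 3 S β σ n < |response β σ (X i ω) (ε i ω)| := hω
    refine absurd hω' (not_lt.2 ?_)
    rw [hL, response]
    refine (abs_add_le _ _).trans (add_le_add hcon.1 ?_)
    rw [abs_mul, abs_of_nonneg hσ]
    exact mul_le_mul_of_nonneg_left hcon.2 hσ
  have h1 : P.real {x : Vec d | a * τ < |inner ℝ x β|} ≤ 2 / (n : ℝ) ^ 2 := by
    by_cases hβ : β = 0
    · have : {x : Vec d | a * τ < |inner ℝ x β|} = ∅ :=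
        Set.eq_empty_of_forall_notMem fun x hx => by
          have hx' : a * τ < |inner ℝ x β| := hx
          rw [hβ, inner_zero_right, abs_zero] at hx'
          exact absurd hx' (not_lt.2 (by positivity))
      rw [this, measureReal_empty]
      positivity
    · have hτ : 0 < τ := norm_act_sqrtMat_pos (secondMoment_isSymm P) hlam hβ
      have e : {x : Vec d | a * τ < |inner ℝ x β|} = {x | a < |inner ℝ x β / τ|} := by
        ext x
        simp only [Set.mem_ofPred_eq, abs_div, abs_of_pos hτ, lt_div_iff₀ hτ]
      rw [e]
      exact measureReal_trunc_lt_abs_le (by fun_prop) hKb0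
        ((psi2Norm_inner_div_le (secondMoment_isSymm P) hlam hβ).trans hKb) hc hn'
        (by positivity) ha2.ge
  have h2 : ν.real {e : ℝ | b < |e|} ≤ 2 / (n : ℝ) ^ 2 :=
    measureReal_trunc_lt_abs_le measurable_id' hKe0 hKe hc hn' (by positivity) hb2.ge
  calc _ ≤ _ := measureReal_mono hsub
    _ ≤ _ := measureReal_union_le _ _
    _ ≤ 2 / (n : ℝ) ^ 2 + 2 / (n : ℝ) ^ 2 := by
        rw [h.predictors.measureReal_preimage i (measurableSet_lt measurable_const (by fun_prop)),
          h.errors.measureReal_preimage i (measurableSet_lt measurable_const (by fun_prop))]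
        exact add_le_add h1 h2
    _ = _ := by ring

/-- Truncation of the predictors does not increase their second moments. -/
lemma inner_truncated_secondMoment_le [IsProbabilityMeasure P]
    (hX : ∀ j, MemLp (fun x : Vec d => x j) 2 P) {R : ℝ} (hR : 0 ≤ R) (u : Vec d) :
    ∫ x, inner ℝ (truncVec R x) u ^ 2 ∂P ≤
      inner ℝ u (Matrix.toEuclideanLin (secondMoment P) u) := by
  have htmem : ∀ j, MemLp (fun x : Vec d => truncVec R x j) 2 P := fun j =>
    MemLp.of_bound ((measurable_coord j).comp (measurable_truncVec R)).aestronglyMeasurable R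
      (ae_of_all _ fun x => abs_truncVec_le hR x j)
  have hSu : inner ℝ u (Matrix.toEuclideanLin (secondMoment P) u) = ∫ x, inner ℝ x u ^ 2 ∂P :=
    inner_secondMoment_comp hX u
  rw [hSu]
  refine integral_mono (memLp_inner htmem u).integrable_sq (memLp_inner hX u).integrable_sq
    fun x => ?_
  by_cases hx : ∀ j, |x j| ≤ R
  · simp only [truncVec_of_le hx, le_refl]
  · simp only [truncVec_of_not_le hx, inner_zero_left]
    rw [zero_pow two_ne_zero]
    positivity

/-- Truncation of the predictors barely changes their second moments. -/
lemma inner_truncated_secondMoment_ge [IsProbabilityMeasure P]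
    (hX : ∀ j, MemLp (fun x : Vec d => x j) 2 P)
    (hlam : 0 < lambdaMin (secondMoment P)) {Kbar : ℝ≥0} (hKb0 : 0 < Kbar)
    (hKb : psi2NormVec P (fun x => act (sqrtMat (secondMoment P))⁻¹ x) ≤ Kbar) {R : ℝ}
    (hp : P.real {x | ¬ ∀ j, |x j| ≤ R} ≤ 1 / (2304 * (Kbar : ℝ) ^ 4)) (u : Vec d) :
    11 / 12 * inner ℝ u (Matrix.toEuclideanLin (secondMoment P) u) ≤
      ∫ x, inner ℝ (truncVec R x) u ^ 2 ∂P := by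
  set S := secondMoment P with hS
  have hSu : inner ℝ u (Matrix.toEuclideanLin S u) = ∫ x, inner ℝ x u ^ 2 ∂P :=
    inner_secondMoment_comp hX u
  by_cases hu : u = 0
  · simp [hu]
  have hτ := norm_act_sqrtMat_pos (secondMoment_isSymm P) hlam hu
  have hτ2 := norm_act_sqrtMat_sq (secondMoment_isSymm P) hlam u
  set τ := ‖act (sqrtMat S) u‖
  -- Normalizing by `τ` makes the loss relative to the quadratic form itself, so the requirement on
  -- the box probability involves `Kbar` but not `λ_min`.
  have hψ := (psi2Norm_inner_div_le (secondMoment_isSymm P) hlam hu).trans hKb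
  have hZm : Measurable fun x : Vec d => inner ℝ x u / τ := by fun_prop
  obtain ⟨hi4, h4⟩ := fourth_moment_of_psi2Norm_le hZm hKb0 hψ
  have hA : MeasurableSet {x : Vec d | ¬ ∀ j, |x j| ≤ R} := (measurableSet_box R).compl
  have h1 := setIntegral_sq_le hA hKb0 hi4 h4 hp (integrable_sq_of_psi2Norm_le hZm hψ)
  simp only [div_pow] at h1
  rw [integral_div, div_le_iff₀ (by positivity)] at h1
  have hint : Integrable (fun x : Vec d => inner ℝ x u ^ 2) P := (memLp_inner hX u).integrable_sq
  have e : ∀ x : Vec d, inner ℝ (truncVec R x) u ^ 2 = inner ℝ x u ^ 2 -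
      {x : Vec d | ¬ ∀ j, |x j| ≤ R}.indicator (fun x => inner ℝ x u ^ 2) x := fun x => by
    by_cases hx : ∀ j, |x j| ≤ R
    · rw [truncVec_of_le hx, Set.indicator_of_notMem (by simpa using hx), sub_zero]
    · rw [truncVec_of_not_le hx, Set.indicator_of_mem hx, sub_self]
      simp
  simp only [e]
  rw [integral_sub hint (hint.indicator hA), integral_indicator hA, ← hSu]
  rw [← hτ2]
  linarith

/-- The response has second moment at most `2 τ²` with `τ = ‖Σ^(1/2) β‖ + σ`. This turns the tail
probability into the tail integral needed by `norm_truncation_bias_le`. -/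
lemma RandomDesign.norm_response_bias_le [IsProbabilityMeasure P]
    (h : RandomDesign μ P ν X ε U) (hX : ∀ j, MemLp (fun x : Vec d => x j) 2 P)
    (hν : IsStandardized ν) (hlam : 0 < lambdaMin (secondMoment P)) (hσ : 0 ≤ σ) {N R L : ℝ}
    (hN : 0 < N) (hR : 0 ≤ R) (i : Fin n)
    (hp : μ.real {ω | L < |response β σ (X i ω) (ε i ω)|} ≤ 4 / N ^ 2) :
    ‖(WithLp.toLp 2 fun j => ∫ ω, truncVec R (X i ω) j *
        truncReal L (response β σ (X i ω) (ε i ω)) ∂μ : Vec d) -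
      Matrix.toEuclideanLin (Matrix.of fun j l => ∫ x, truncVec R x j * truncVec R x l ∂P) β‖ ≤
      √d * R * (3 * (‖act (sqrtMat (secondMoment P)) β‖ + σ) / N) := by
  set S := secondMoment P with hSdef
  set τ := ‖act (sqrtMat S) β‖ + σ with hτdef
  have hτ0 : 0 ≤ τ := by positivity
  have hSu : ∀ u : Vec d, inner ℝ u (Matrix.toEuclideanLin S u) = ∫ x, inner ℝ x u ^ 2 ∂P :=
    inner_secondMoment_comp hX
  have htc : ∀ j, Measurable fun x : Vec d => truncVec R x j := fun j =>
    (measurable_coord j).comp (measurable_truncVec R)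
  have hmean : ∫ ω, ε i ω ∂μ = 0 :=
    (h.errors.integral_comp i measurable_id).trans hν.1
  have hvar : ∫ ω, ε i ω ^ 2 ∂μ = 1 :=
    (h.errors.integral_comp i (measurable_id.pow_const 2)).trans hν.2
  have hε2 : MemLp (ε i) 2 μ := integrable_of_integral_sq_eq_one (h.errors.measurable i) hvar
  have hXi2 : ∀ j, MemLp (fun ω => X i ω j) 2 μ := fun j =>
    (show MemLp ((fun x : Vec d => x j) ∘ X i) 2 μ from
      (h.predictors.law i ▸ hX j).comp_of_map (h.predictors.measurable i).aemeasurable)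
  have hXβ : MemLp (fun ω => inner ℝ (X i ω) β) 2 μ := memLp_inner hXi2 β
  have hY2 : MemLp (fun ω => response β σ (X i ω) (ε i ω)) 2 μ := hXβ.add (hε2.const_mul σ)
  have hYm : Measurable fun ω => response β σ (X i ω) (ε i ω) :=
    (measurable_response β σ).comp ((h.predictors.measurable i).prodMk (h.errors.measurable i))
  have hYvar : ∫ ω, response β σ (X i ω) (ε i ω) ^ 2 ∂μ ≤ 2 * τ ^ 2 := by
    have h1 : ∫ ω, inner ℝ (X i ω) β ^ 2 ∂μ = ‖act (sqrtMat S) β‖ ^ 2 := by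
      rw [norm_act_sqrtMat_sq (secondMoment_isSymm P) hlam, hSu β]
      exact h.predictors.integral_comp i (f := fun x => inner ℝ x β ^ 2) (by fun_prop)
    calc _ ≤ ∫ ω, (2 * inner ℝ (X i ω) β ^ 2 + 2 * σ ^ 2 * ε i ω ^ 2) ∂μ := by
          refine integral_mono hY2.integrable_sq
            ((hXβ.integrable_sq.const_mul _).add (hε2.integrable_sq.const_mul _)) fun ω => ?_
          simp only [response]
          nlinarith [sq_nonneg (inner ℝ (X i ω) β - σ * ε i ω)]
      _ = 2 * ‖act (sqrtMat S) β‖ ^ 2 + 2 * σ ^ 2 := by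
          rw [integral_add (hXβ.integrable_sq.const_mul _) (hε2.integrable_sq.const_mul _),
            integral_const_mul, integral_const_mul, h1, hvar, mul_one]
      _ ≤ _ := by
          rw [hτdef]
          nlinarith [mul_nonneg (norm_nonneg (act (sqrtMat S) β)) hσ]
  exact norm_truncation_bias_le (h.predictors.measurable i) (h.errors.measurable i) hR hε2 hmean
    (h.indepFun_sample i) hY2 (integral_abs_tail_le hY2 hτ0 hN hYvar hYm hp)
    (fun j => rfl) (fun j l => (h.predictors.integral_comp i ((htc j).mul (htc l))).symm)

/-- The bias is of order `1 / N` and the stochastic term of order `1 / √N`. After squaring and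
inserting `L ≥ 2 τ`, only `81 ≤ 16 N` is required. -/
lemma three_mul_bias_le {N ℓ R L τ : ℝ} (hN : 100 ≤ N) (hℓ : 1 ≤ ℓ) (hτ : 0 ≤ τ)
    (hL : 2 * τ ≤ L) :
    3 * (√d * R * (3 * τ / N)) ≤ √(4 * d * R ^ 2 * L ^ 2 * ℓ / N) := by
  have hN0 : 0 < N := by linarith
  refine Real.le_sqrt_of_sq_le ?_
  have e : (3 * (√d * R * (3 * τ / N))) ^ 2 = 81 * d * R ^ 2 * τ ^ 2 / N ^ 2 := by
    rw [mul_pow, mul_pow, mul_pow, Real.sq_sqrt (by positivity)]; ring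
  have h1 : (2 * τ) ^ 2 ≤ L ^ 2 := pow_le_pow_left₀ (by positivity) hL 2
  have h2 : (81 : ℝ) ≤ 16 * N := by linarith
  rw [e]
  calc 81 * d * R ^ 2 * τ ^ 2 / N ^ 2 ≤ (16 * N) * d * R ^ 2 * τ ^ 2 / N ^ 2 := by gcongr
    _ = 4 * d * R ^ 2 * (2 * τ) ^ 2 * 1 / N := by field_simp; ring
    _ ≤ 4 * d * R ^ 2 * L ^ 2 * ℓ / N := by gcongr

omit [MeasurableSpace Ω] in
-- The least eigenvalue is at least `(11/12 - 1/2) λ_min = 5/12 λ_min`, and the residual is at most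
-- `T1 + 4/3 T2`, the bias being a third of `T2`. Against `5/12 λ_min`, twice `err` allows `5/3 (T1
-- + T2)`.
lemma mem_errorEvent_of_plugIn_close {R L b : ℝ} {ω : Ω} {S T : Matrix (Fin d) (Fin d) ℝ}
    {g : Vec d} (hS : S.IsSymm) (hlam : 0 < lambdaMin S)
    (hge : ∀ u : Vec d, 11 / 12 * inner ℝ u (Matrix.toEuclideanLin S u) ≤
      inner ℝ u (Matrix.toEuclideanLin T u))
    (hb : 3 * b ≤ √(4 * d * R ^ 2 * L ^ 2 * logFactor d n / n))
    (hbias : ‖g - Matrix.toEuclideanLin T β‖ ≤ b)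
    (h1 : ∀ u : Vec d, inner ℝ u (Matrix.toEuclideanLin T u) - lambdaMin S / 2 * ‖u‖ ^ 2 ≤
      inner ℝ u (Matrix.toEuclideanLin (sigmaHat R (fun i => X i ω) (fun i c => U i c ω)) u))
    (h2 : ‖Matrix.toEuclideanLin (sigmaHat R (fun i => X i ω) (fun i c => U i c ω) - T) β‖ ≤
      ‖β‖ * √((32 * d * R ^ 4 + 8 * d * R ^ 2 * opNorm S) * logFactor d n / n) +
        ‖β‖ * (8 * (2 * d + 1) * R ^ 2 * logFactor d n / n))
    (h3 : ‖crossVec R L (fun i => X i ω) (fun i => response β σ (X i ω) (ε i ω))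
      (fun i c => U i c ω) - g‖ ≤ √(4 * d * R ^ 2 * L ^ 2 * logFactor d n / n)) :
    ω ∈ errorEvent R L β σ X ε U (2 * err S β n R L) := by
  refine mem_errorEvent (ρ := 5 / 12 * lambdaMin S) (by positivity) (fun u => ?_) ?_
  · have h4 := lambdaMin_mul_le_inner hS u
    linarith [h1 u, hge u]
  · set T1 := ‖β‖ * √((32 * d * R ^ 4 + 8 * d * R ^ 2 * opNorm S) * logFactor d n / n) +
      ‖β‖ * (8 * (2 * d + 1) * R ^ 2 * logFactor d n / n) with hT1
    set T2 := √(4 * d * R ^ 2 * L ^ 2 * logFactor d n / n)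
    have hT20 : 0 ≤ T2 := Real.sqrt_nonneg _
    have hT10 : 0 ≤ T1 := (norm_nonneg _).trans h2
    have h4 : 5 / 12 * lambdaMin S * (2 * err S β n R L) = 5 / 3 * (T1 + T2) := by
      rw [show err S β n R L = 2 / lambdaMin S * (T1 + T2) from rfl]; field_simp; ring
    rw [h4]
    set M := sigmaHat R (fun i => X i ω) fun i c => U i c ω
    set q := crossVec R L (fun i => X i ω) (fun i => response β σ (X i ω) (ε i ω))
      (fun i c => U i c ω)
    have h5 : q - Matrix.toEuclideanLin M β =
        (q - g) - Matrix.toEuclideanLin (M - T) β + (g - Matrix.toEuclideanLin T β) := by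
      rw [map_sub, LinearMap.sub_apply]; abel
    rw [h5]
    have h6 := norm_add_le ((q - g) - Matrix.toEuclideanLin (M - T) β)
      (g - Matrix.toEuclideanLin T β)
    have h7 := norm_sub_le (q - g) (Matrix.toEuclideanLin (M - T) β)
    linarith

/-- Concentration of the truncated sample costs `2 / n`, responses leaving their range `4 / n`, and
predictors leaving the box `2 / (n d)`. Outside these events the truncated and true estimators
coincide. The concentration bound is applied around the truncated moments but scaled by the true
`Σ`, whose quadratic form dominates. -/
theorem subGaussian_error_bound {c : ℝ} (hc : 1 / 2 ≤ c) {K Kbar Keps : ℝ≥0} (hd : 1 ≤ d)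
    (hσ : 0 ≤ σ) (h : RandomDesign μ P ν X ε U) (hP : SubGaussianDesign P)
    (hν : SubGaussianNoise ν) (hlam : 0 < lambdaMin (secondMoment P))
    (hK : (⨆ j, psi2Norm P (fun x => x j)) = K)
    (hKb : psi2NormVec P (fun x => act (sqrtMat (secondMoment P))⁻¹ x) = Kbar)
    (hKe : psi2Norm ν (fun e => e) = Keps)
    (hsample : sampleBound (secondMoment P) n (truncX c K 3 d n) ≤ n)
    (hn : 100 * ((Kbar : ℝ) ^ 2 + 1) ≤ n) :
    1 - 6 / (n : ℝ) - 2 / ((n : ℝ) * d) ≤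
      μ.real (errorEvent (truncX c K 3 d n) (truncY c Kbar Keps 3 (secondMoment P) β σ n) β σ X ε U
        (2 * err (secondMoment P) β n (truncX c K 3 d n)
          (truncY c Kbar Keps 3 (secondMoment P) β σ n))) := by
  set R := truncX c K 3 d n with hRdef
  set L := truncY c Kbar Keps 3 (secondMoment P) β σ n with hLdef
  set S := secondMoment P with hSdef
  have hn100 : (100 : ℝ) ≤ n := by nlinarith [sq_nonneg (Kbar : ℝ)]
  have hn0 : (0 : ℝ) < n := by linarith
  have hn1 : 1 ≤ n := by exact_mod_cast (by linarith : (1 : ℝ) ≤ n)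
  have hd' : (1 : ℝ) ≤ d := by exact_mod_cast hd
  have hPp := h.predictors.isProbabilityMeasure hn1
  have hνp := h.errors.isProbabilityMeasure hn1
  have hX2 : ∀ j, MemLp (fun x : Vec d => x j) 2 P := fun j =>
    integrable_of_integral_sq_eq_one (measurable_coord j) (hP.unit_variance j)
  have hSymm := secondMoment_isSymm P
  have hKj : ∀ j, psi2Norm P (fun x => x j) ≤ K := fun j => hK ▸ le_iSup (fun j =>
    psi2Norm P fun x => x j) j
  have hK1 : (1 : ℝ) ≤ K := one_le_of_psi2Norm (measurable_coord ⟨0, hd⟩) (hKj _)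
    (hP.unit_variance _)
  have hKe1 : (1 : ℝ) ≤ Keps := one_le_of_psi2Norm measurable_id' hKe.le hν.standardized.2
  -- Every normalized marginal has unit second moment, so its sub-Gaussian norm is at least 1.
  have hKb1 : (1 : ℝ) ≤ Kbar := by
    have hu : (EuclideanSpace.single ⟨0, hd⟩ 1 : Vec d) ≠ 0 := by simp
    refine one_le_of_psi2Norm (by fun_prop) ((psi2Norm_inner_div_le hSymm hlam hu).trans hKb.le) ?_
    have hτ := norm_act_sqrtMat_pos hSymm hlam hu
    simp only [div_pow]
    rw [integral_div, div_eq_one_iff_eq (by positivity), norm_act_sqrtMat_sq hSymm hlam]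
    exact (inner_secondMoment_comp hX2 _).symm
  have hK0 : 0 < K := by exact_mod_cast (zero_lt_one.trans_le hK1)
  have hKb0 : 0 < Kbar := by exact_mod_cast (zero_lt_one.trans_le hKb1)
  have hKe0 : 0 < Keps := by exact_mod_cast (zero_lt_one.trans_le hKe1)
  have hlog1 : 1 ≤ Real.log n := by
    rw [Real.le_log_iff_exp_le hn0]
    linarith [Real.exp_one_lt_d9]
  have hℓ1 : 1 ≤ logFactor d n := hlog1.trans (le_max_left _ _)
  set τ := ‖act (sqrtMat S) β‖ + σ with hτdef
  have hτ0 : 0 ≤ τ := by positivity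
  have hscale : ∀ κ : ℝ≥0, (1 : ℝ) ≤ κ → 2 ≤ √(2 * (3 + 1) * tailConst c κ) := fun κ hκ => by
    refine Real.le_sqrt_of_sq_le ?_
    have h1 : (1 : ℝ) ≤ κ ^ 2 := one_le_pow₀ hκ
    unfold tailConst
    nlinarith
  have hLτ : 2 * τ ≤ L := by
    have h1 := hscale Kbar hKb1
    have h2 := hscale Keps hKe1
    have h3 : 1 ≤ √(Real.log n) := by rw [Real.one_le_sqrt]; exact hlog1
    rw [hLdef, truncY]
    calc 2 * τ = (2 * ‖act (sqrtMat S) β‖ + σ * 2) * 1 := by rw [hτdef]; ring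
      _ ≤ _ := by gcongr
  have hL0 : 0 ≤ L := le_trans (by positivity) hLτ
  have hR0 : 0 < R := by
    refine Real.sqrt_pos.2 ?_
    have : 0 < Real.log (n * d) := Real.log_pos (by nlinarith)
    unfold tailConst
    positivity
  set xt : Fin n → Ω → Vec d := fun i ω => truncVec R (X i ω)
  set yt : Fin n → Ω → ℝ := fun i ω => truncReal L (response β σ (X i ω) (ε i ω))
  have hsamp : DitheredSample μ xt yt U R L :=
    h.ditheredSample (φ := fun q => truncVec R q.1)
      (ψ := fun q => truncReal L (response β σ q.1 q.2))
      ((measurable_truncVec R).comp measurable_fst)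
      ((measurable_truncReal L).comp (measurable_response β σ))
      (fun i j => ae_of_all _ fun ω => abs_truncVec_le hR0.le _ j)
      (fun i => ae_of_all _ fun ω => abs_truncReal_le hL0 _)
  set St : Matrix (Fin d) (Fin d) ℝ :=
    Matrix.of fun j l => ∫ x, truncVec R x j * truncVec R x l ∂P with hStdef
  set i₀ : Fin n := ⟨0, hn1⟩
  set g : Vec d := WithLp.toLp 2 fun j => ∫ ω, xt i₀ ω j * yt i₀ ω ∂μ with hgdef
  have htc : ∀ j, Measurable fun x : Vec d => truncVec R x j := fun j =>
    (measurable_coord j).comp (measurable_truncVec R)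
  have hStint : ∀ i j l, St j l = ∫ ω, xt i ω j * xt i ω l ∂μ := fun i j l =>
    (h.predictors.integral_comp i ((htc j).mul (htc l))).symm
  have hSt : ∀ j l, n * St j l = ∑ i, ∫ ω, xt i ω j * xt i ω l ∂μ := fun j l => by
    simp only [← hStint]; simp
  have hg : ∀ j, n * g j = ∑ i, ∫ ω, xt i ω j * yt i ω ∂μ := fun j => by
    have : ∀ i, ∫ ω, xt i ω j * yt i ω ∂μ = g j := fun i =>
      h.integral_sample_eq (F := fun q => truncVec R q.1 j * truncReal L (response β σ q.1 q.2))
        (((htc j).comp measurable_fst).mul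
          ((measurable_truncReal L).comp (measurable_response β σ))) i i₀
    simp [this]
  have htmem : ∀ j, MemLp (fun x : Vec d => truncVec R x j) 2 P := fun j =>
    MemLp.of_bound (htc j).aestronglyMeasurable R
      (ae_of_all _ fun x => abs_truncVec_le hR0.le x j)
  have hStu : ∀ u : Vec d, inner ℝ u (Matrix.toEuclideanLin St u) =
      ∫ x, inner ℝ (truncVec R x) u ^ 2 ∂P := inner_secondMoment_comp htmem
  have hle : ∀ u : Vec d, inner ℝ u (Matrix.toEuclideanLin St u) ≤ opNorm S * ‖u‖ ^ 2 := fun u => by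
    rw [hStu]
    exact (inner_truncated_secondMoment_le hX2 hR0.le u).trans
      (inner_toEuclideanLin_le_opNorm S u)
  have hbox := measureReal_not_box_le hK0 hKj hc hd hn1
  have hge : ∀ u : Vec d, 11 / 12 * inner ℝ u (Matrix.toEuclideanLin S u) ≤
      inner ℝ u (Matrix.toEuclideanLin St u) := fun u => by
    rw [hStu]
    refine inner_truncated_secondMoment_ge hX2 hlam hKb0 hKb.le (hbox.trans ?_) u
    rw [div_le_div_iff₀ (by positivity) (by positivity), one_mul]
    -- The box probability `2 / (n² d)` must fall below `1 / (2304 Kbar⁴)`; it suffices that `n ≥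
    -- 100 Kbar²`, as `100² ≥ 2 · 2304`.
    have h1 : (100 * (Kbar : ℝ) ^ 2) ^ 2 ≤ (n : ℝ) ^ 2 := by
      refine pow_le_pow_left₀ (by positivity) (by linarith) 2
    calc 2 * (2304 * (Kbar : ℝ) ^ 4) ≤ (100 * (Kbar : ℝ) ^ 2) ^ 2 := by
          nlinarith [pow_nonneg Kbar.coe_nonneg 4]
      _ ≤ (n : ℝ) ^ 2 := h1
      _ ≤ n ^ 2 * d := le_mul_of_one_le_right (by positivity) hd'
  have hytail : ∀ i, μ.real {ω | L < |response β σ (X i ω) (ε i ω)|} ≤ 4 / (n : ℝ) ^ 2 := fun i =>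
    measureReal_response_gt_le h i hlam hKb0 hKe0 hKb.le hKe.le hc hn1 hσ
  have hbias : ‖g - Matrix.toEuclideanLin St β‖ ≤ √d * R * (3 * τ / n) :=
    h.norm_response_bias_le hX2 hν.standardized hlam hσ hn0 hR0.le i₀ (hytail i₀)
  have hcross := three_mul_bias_le (d := d) (R := R) hn100 hℓ1 hτ0 hLτ
  have hconc := plugIn_concentration hsamp hd hn1 hR0 hL0 hSt hg hlam hle hsample β
  set G := {ω |
      (∀ u : Vec d, inner ℝ u (Matrix.toEuclideanLin St u) - lambdaMin S / 2 * ‖u‖ ^ 2 ≤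
        inner ℝ u (Matrix.toEuclideanLin
          (sigmaHat R (fun i => xt i ω) (fun i c => U i c ω)) u)) ∧
      ‖Matrix.toEuclideanLin (sigmaHat R (fun i => xt i ω) (fun i c => U i c ω) - St) β‖ ≤
        ‖β‖ * √((32 * d * R ^ 4 + 8 * d * R ^ 2 * opNorm S) * logFactor d n / n) +
          ‖β‖ * (8 * (2 * d + 1) * R ^ 2 * logFactor d n / n) ∧
      ‖crossVec R L (fun i => xt i ω) (fun i => yt i ω) (fun i c => U i c ω) - g‖ ≤
        √(4 * d * R ^ 2 * L ^ 2 * logFactor d n / n)}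
  set B1 := ⋃ i ∈ (Finset.univ : Finset (Fin n)), {ω | X i ω ∈ {x : Vec d | ¬ ∀ j, |x j| ≤ R}}
  set B2 := ⋃ i ∈ (Finset.univ : Finset (Fin n)), {ω | L < |response β σ (X i ω) (ε i ω)|}
  have hB1 : μ.real B1 ≤ 2 / (n * d) := by
    refine (measureReal_biUnion_finset_le _ _).trans
      ((sum_const_le_of_forall (b := 2 / ((n : ℝ) ^ 2 * d)) fun i => ?_).trans_eq ?_)
    · exact (h.predictors.measureReal_preimage i (s := {x : Vec d | ¬ ∀ j, |x j| ≤ R})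
        (measurableSet_box R).compl).trans_le hbox
    · rw [Fintype.card_fin]; field_simp
  have hB2 : μ.real B2 ≤ 4 / n := by
    refine (measureReal_biUnion_finset_le _ _).trans ((sum_const_le_of_forall hytail).trans_eq ?_)
    rw [Fintype.card_fin]; field_simp
  have hcover : G ⊆ errorEvent R L β σ X ε U (2 * err S β n R L) ∪ (B1 ∪ B2) := by
    intro ω hω
    by_cases hB : ω ∈ B1 ∪ B2
    · exact Or.inr hB
    refine Or.inl ?_
    simp only [B1, B2, Set.mem_union, Finset.mem_univ, Set.iUnion_true, Set.mem_iUnion, not_or,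
      not_exists, Set.mem_ofPred_eq, not_not, not_lt] at hB
    have hxt : (fun i => xt i ω) = fun i => X i ω := funext fun i => truncVec_of_le (hB.1 i)
    have hyt : (fun i => yt i ω) = fun i => response β σ (X i ω) (ε i ω) :=
      funext fun i => if_pos (hB.2 i)
    obtain ⟨h1, h2, h3⟩ := hω
    rw [hxt] at h1 h2 h3
    rw [hyt] at h3
    exact mem_errorEvent_of_plugIn_close hSymm hlam hge hcross hbias h1 h2 h3
  have h1 := measureReal_mono (μ := μ) hcover
  have h2 := measureReal_union_le (μ := μ) (errorEvent R L β σ X ε U (2 * err S β n R L)) (B1 ∪ B2)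
  have h3 := measureReal_union_le (μ := μ) B1 B2
  have h4 : (6 : ℝ) / n = 2 / n + 4 / n := by ring
  linarith

end SubGaussian

lemma errorEvent_mono {Ω : Type*} {n d : ℕ} {R L : ℝ} {β : Vec d} {σ : ℝ} {X : Fin n → Ω → Vec d}
    {ε : Fin n → Ω → ℝ} {U : Fin n → Channel d → Ω → ℝ} {r r' : ℝ} (h : r ≤ r') :
    errorEvent R L β σ X ε U r ⊆ errorEvent R L β σ X ε U r' :=
  fun _ ⟨b, hb, hr⟩ => ⟨b, hb, hr.trans h⟩

end OneBitRegression

/-! ### The main theorem. -/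

open OneBitRegression in
theorem theorem2 :
    -- fixed ranges, random design
    (∀ (d n : ℕ) (Ω : Type uΩ) [MeasurableSpace Ω] (μ : Measure Ω) [IsProbabilityMeasure μ]
        (P : Measure (Vec d)) (ν : Measure ℝ) (X : Fin n → Ω → Vec d) (ε : Fin n → Ω → ℝ)
        (U : Fin n → Channel d → Ω → ℝ) (β : Vec d) (σ R L : ℝ),
      1 ≤ d → 1 ≤ n → 0 ≤ σ →
      RandomDesign μ P ν X ε U → IsStandardized ν →
      0 < lambdaMin (secondMoment P) →
      (∀ i j, ∀ᵐ ω ∂μ, |X i ω j| ≤ R) →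
      (∀ i, ∀ᵐ ω ∂μ, |response β σ (X i ω) (ε i ω)| ≤ L) →
      sampleBound (secondMoment P) n R ≤ n →
      1 - 2 / (n : ℝ) ≤ μ.real (errorEvent R L β σ X ε U (err (secondMoment P) β n R L))) ∧
    -- fixed ranges, fixed design
    (∀ (d n : ℕ) (Ω : Type uΩ) [MeasurableSpace Ω] (μ : Measure Ω) [IsProbabilityMeasure μ]
        (x : Fin n → Vec d) (ν : Measure ℝ) (ε : Fin n → Ω → ℝ)
        (U : Fin n → Channel d → Ω → ℝ) (β : Vec d) (σ R L : ℝ),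
      1 ≤ d → 1 ≤ n → 0 ≤ σ →
      FixedDesign μ ν ε U → IsStandardized ν →
      0 < lambdaMin (empiricalSecondMoment x) →
      (∀ i j, |x i j| ≤ R) →
      (∀ i, ∀ᵐ ω ∂μ, |response β σ (x i) (ε i ω)| ≤ L) →
      sampleBound (empiricalSecondMoment x) n R ≤ n →
      1 - 2 / (n : ℝ) ≤ μ.real (errorEvent R L β σ (fun i _ => x i) ε U
        (err (empiricalSecondMoment x) β n R L))) ∧
    -- sub-Gaussian case with truncation levels that depend on the sample size
    (∀ (c : ℝ), 1 / 2 ≤ c → ∀ (K Kbar Keps : ℝ≥0), ∃ C > (0 : ℝ), ∃ C' > (0 : ℝ),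
      ∀ (d n : ℕ) (Ω : Type uΩ) [MeasurableSpace Ω] (μ : Measure Ω) [IsProbabilityMeasure μ]
        (P : Measure (Vec d)) (ν : Measure ℝ) (X : Fin n → Ω → Vec d) (ε : Fin n → Ω → ℝ)
        (U : Fin n → Channel d → Ω → ℝ) (β : Vec d) (σ R L : ℝ),
      1 ≤ d → 1 ≤ n → 0 ≤ σ →
      RandomDesign μ P ν X ε U →
      SubGaussianDesign P → SubGaussianNoise ν →
      0 < lambdaMin (secondMoment P) →
      (⨆ j, psi2Norm P (fun x => x j)) = K →
      psi2NormVec P (fun x => act (sqrtMat (secondMoment P))⁻¹ x) = Kbar →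
      psi2Norm ν (fun e => e) = Keps →
      R = truncX c K 3 d n →
      L = truncY c Kbar Keps 3 (secondMoment P) β σ n →
      sampleBound (secondMoment P) n R ≤ n →
      C * ((lambdaMin (secondMoment P))⁻¹ * d *
        max (‖act (sqrtMat (secondMoment P)) β‖ + σ) 1) ^ (2 / 3 : ℝ) ≤ n →
      1 - 6 / (n : ℝ) - 2 / ((n : ℝ) * d) ≤
        μ.real (errorEvent R L β σ X ε U
          (2 * err (secondMoment P) β n R L + C' * (d / (n : ℝ) ^ (3 / 2 : ℝ))))) := by
  refine ⟨?_, ?_, ?_⟩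
  · intro d n Ω _ μ _ P ν X ε U β σ R L hd hn _ h hν hlam hR hL hs
    exact random_bounded_error_bound hd hn h hν hlam hR hL hs
  · intro d n Ω _ μ _ x ν ε U β σ R L hd hn _ h hν hlam hR hL hs
    exact fixed_bounded_error_bound hd hn h hν hlam hR hL hs
  · intro c hc K Kbar Keps
    -- Unit variances give `λ_min ≤ 1`, so the base of the power `2 / 3` is at least 1 and the size
    -- condition implies `n ≥ C`. The bound `2 err` already holds for such `n`; the term with `C'`
    -- is added by monotonicity, so any positive constant serves.
    refine ⟨100 * ((Kbar : ℝ) ^ 2 + 1), by positivity, 1, one_pos, ?_⟩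
    intro d n Ω _ μ _ P ν X ε U β σ R L hd hn hσ h hP hν hlam hK hKb hKe hR hL hs hC
    subst hR hL
    have hd' : (1 : ℝ) ≤ d := by exact_mod_cast hd
    have hlam1 : lambdaMin (secondMoment P) ≤ 1 := by
      refine (lambdaMin_le_diag (secondMoment_isSymm P) ⟨0, hd⟩).trans_eq ?_
      rw [secondMoment, Matrix.of_apply, ← hP.unit_variance ⟨0, hd⟩]
      simp only [sq]
    have hscale : 1 ≤ (lambdaMin (secondMoment P))⁻¹ * d *
        max (‖act (sqrtMat (secondMoment P)) β‖ + σ) 1 :=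
      one_le_mul_of_one_le_of_one_le
        (one_le_mul_of_one_le_of_one_le ((one_le_inv₀ hlam).2 hlam1) hd') (le_max_right _ _)
    have hn' : 100 * ((Kbar : ℝ) ^ 2 + 1) ≤ n :=
      (le_mul_of_one_le_right (by positivity)
        (Real.one_le_rpow hscale (by norm_num))).trans hC
    exact (subGaussian_error_bound hc hd hσ h hP hν hlam hK hKb hKe hs hn').trans
      (measureReal_mono (errorEvent_mono (le_add_of_nonneg_right (by positivity))))
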